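/- Let $B$ be a compact (Hausdorff) smooth manifold without boundary and let $E\to B$ be a smooth complex vector bundle of rank $n$ with a smooth hermitian metric. Let $P$ be a complex polynomial in the entries of an $n\times n$ matrix which is invariant under conjugation by $U(n)$. For a connection $\nabla$ on $E$ with curvature $F(\nabla)$, let $P(E,\nabla)=P(F(\nabla))$ be the complex-valued Chern–Weil form on $B$, obtained by substituting the curvature 2-forms in an orthonormal basis of the fibre into $P$. For two connections $\nabla_0,\nabla_1$ on $E$ let $\pi_2:\mathbb R\times B\to B$ be the projection and put $$\tilde\nabla=\frac{d}{dt}+(1-t)\nabla_0+t\nabla_1\ \text{ on }\ \pi_2^*E,\qquad TP(\nabla_0,\nabla_1)=\int_{[0,1]}P(\pi_2^*E,\tilde\nabla),$$ where the integral is along the fibre direction $t\in[0,1]$, i.e. $(\int_{[0,1]}\alpha)_b(v_1,\dots,v_k)=\int_0^1\alpha_{(t,b)}(\partial_t,v_1,\dots,v_k)\,dt$. For a smooth unitary gauge transformation $U$ of $E$ (a smooth section of the bundle $\mathscr U(E)$ of unitary automorphisms of the fibres) and a smooth connection $\nabla$ compatible with the metric, let $$TP(E,U,\nabla):=TP(\nabla,U^{-1}\nabla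 U),$$ whose component of degree $2k+1$ comes from the homogeneous part of degree $k+1$ of $P$; it has components in odd degrees only. Then: (a) $TP(E,U,\nabla)$ is a smooth form and $d\,TP(E,U,\nabla)=0$. (b) For any two metric compatible connections $\nabla,\nabla'$ the form $TP(E,U,\nabla)-TP(E,U,\nabla')$ is exact. (c) If the smooth unitary gauge transformations $U_0,U_1$ are homotopic through continuous sections of $\mathscr U(E)$, then $TP(E,U_0,\nabla)-TP(E,U_1,\nabla)$ is exact. (d) If $\varphi:B_1\to B$ is a smooth map from a smooth manifold $B_1$ (Hausdorff, without boundary), then $\varphi^*E$ with the pulled back metric is hermitian, $\varphi^*U$ is a smooth unitary gauge transformation, $\varphi^*\nabla$ is a smooth metric compatible connection, and $\varphi^*TP(E,U,\nabla)=TP(\varphi^*E,\varphi^*U,\varphi^*\nabla)$. -/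

import Mathlib

open Bundle Manifold
open scoped ContDiff

namespace OddChernWeil

noncomputable section

/-! ### Complex-valued differential forms on a manifold -/

section Forms

variable {V : Type*} [NormedAddCommGroup V] [NormedSpace ℝ V]
  {H : Type*} [TopologicalSpace H] (I : ModelWithCorners ℝ V H)
  (M : Type*) [TopologicalSpace M] [ChartedSpace H M]

/-- A complex-valued differential `k`-form on `M`, with no regularity required. -/
abbrev DiffForm (k : ℕ) : Type _ := ∀ x : M, TangentSpace I x [⋀^Fin k]→L[ℝ] ℂ

variable {I M} {k : ℕ}

/-- The expression of a form in the preferred chart at `x₀`, i.e. its pullback under the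
inverse of this chart. -/
def inChart (α : DiffForm I M k) (x₀ : M) (y : V) : V [⋀^Fin k]→L[ℝ] ℂ :=
  (α ((extChartAt I x₀).symm y)).compContinuousLinearMap
    (mfderivWithin 𝓘(ℝ, V) I (extChartAt I x₀).symm (Set.range I) y)

/-- A form is smooth if its expression in every preferred chart is smooth. -/
def IsSmoothForm (α : DiffForm I M k) : Prop :=
  ∀ x₀ : M, ContDiffOn ℝ ∞ (inChart α x₀) (extChartAt I x₀).target

/-- The exterior derivative, computed at `x` in the preferred chart at `x`. -/
def extD (α : DiffForm I M k) : DiffForm I M (k + 1) := fun x ↦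
  (extDerivWithin (inChart α x) (Set.range I) (extChartAt I x x)).compContinuousLinearMap
    (mfderiv I 𝓘(ℝ, V) (extChartAt I x) x)

/-- A form is exact if it is the exterior derivative of a smooth form. -/
def IsExactForm (α : DiffForm I M (k + 1)) : Prop :=
  ∃ β : DiffForm I M k, IsSmoothForm β ∧ extD β = α

/-- The pullback `φ^* α` of a form under a map `φ`. -/
def formPullback {V' : Type*} [NormedAddCommGroup V'] [NormedSpace ℝ V']
    {H' : Type*} [TopologicalSpace H'] (I' : ModelWithCorners ℝ V' H')
    {M' : Type*} [TopologicalSpace M'] [ChartedSpace H' M']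
    (φ : M' → M) (α : DiffForm I M k) : DiffForm I' M' k := fun x ↦
  (α (φ x)).compContinuousLinearMap (mfderiv I' I φ x)

/-- A complex-valued covector as an alternating `1`-form. -/
def oneForm {T : Type*} [AddCommGroup T] [Module ℝ T] [TopologicalSpace T]
    (α : T →L[ℝ] ℂ) : T [⋀^Fin 1]→L[ℝ] ℂ :=
  ContinuousAlternatingMap.ofSubsingleton ℝ T ℂ (0 : Fin 1) α

/-- The wedge product of two covectors, `(α ∧ β)(v, w) = α v * β w - α w * β v`. -/
def wedge {T : Type*} [AddCommGroup T] [Module ℝ T] [TopologicalSpace T]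
    (α β : T →L[ℝ] ℂ) : T [⋀^Fin 2]→L[ℝ] ℂ :=
  ContinuousMultilinearMap.alternatization
    ((ContinuousMultilinearMap.mkPiAlgebra ℝ (Fin 2) ℂ).compContinuousLinearMap ![α, β])

theorem wedge_apply {T : Type*} [AddCommGroup T] [Module ℝ T] [TopologicalSpace T]
    (α β : T →L[ℝ] ℂ) (v w : T) : wedge α β ![v, w] = α v * β w - α w * β v := by
  rw [wedge, ContinuousMultilinearMap.alternatization_apply_apply,
    show (Finset.univ : Finset (Equiv.Perm (Fin 2))) = {1, Equiv.swap 0 1} by decide]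
  rw [Finset.sum_pair (by decide)]
  simp [sub_eq_add_neg]

end Forms

/-! ### Invariant polynomials and their values on matrices of `2`-forms -/

section Polynomials

variable {n : ℕ}

/-- The value of a polynomial in the matrix entries at a matrix. -/
def evalMatrix (P : MvPolynomial (Fin n × Fin n) ℂ) (A : Matrix (Fin n) (Fin n) ℂ) : ℂ :=
  MvPolynomial.eval (fun ij ↦ A ij.1 ij.2) P

/-- Invariance under conjugation by the structure group `U(n)`. -/
def IsInvariantPolynomial (P : MvPolynomial (Fin n × Fin n) ℂ) : Prop :=
  ∀ u ∈ Matrix.unitaryGroup (Fin n) ℂ, ∀ A : Matrix (Fin n) (Fin n) ℂ,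
    evalMatrix P (u * A * u⁻¹) = evalMatrix P A

/-- The complete polarization of the degree `k` homogeneous part `P_k` of `P`: the symmetric
`k`-linear map `(1 / k!) D^k P (0)`, whose restriction to the diagonal is `P_k`. -/
def polarization (P : MvPolynomial (Fin n × Fin n) ℂ) (k : ℕ) :
    ContinuousMultilinearMap ℂ (fun _ : Fin k ↦ (Fin n × Fin n → ℂ)) ℂ :=
  ((k.factorial : ℂ)⁻¹) • iteratedFDeriv ℂ k (fun a ↦ MvPolynomial.eval a P) 0

variable {T : Type*} [AddCommGroup T] [Module ℝ T] [TopologicalSpace T]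

theorem substTwoForms_aux {k : ℕ} [DecidableEq (Fin k × Fin 2)] (Ω : Fin n → Fin n → T [⋀^Fin 2]→L[ℝ] ℂ)
    (v : Fin k × Fin 2 → T) (p : Fin k × Fin 2) (z : T) :
    (fun i (ab : Fin n × Fin n) ↦ Ω ab.1 ab.2 fun j ↦ Function.update v p z (i, j)) =
      Function.update (fun i (ab : Fin n × Fin n) ↦ Ω ab.1 ab.2 fun j ↦ v (i, j)) p.1
        (fun ab ↦ Ω ab.1 ab.2 (Function.update (fun j ↦ v (p.1, j)) p.2 z)) := by
  obtain ⟨a, b⟩ := p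
  funext i ab
  by_cases hi : i = a
  · subst hi
    rw [Function.update_self]
    congr 1
    funext j
    by_cases hj : j = b
    · subst hj; simp
    · simp [Function.update_of_ne, hj]
  · rw [Function.update_of_ne hi]
    congr 1
    funext j
    rw [Function.update_of_ne]
    simp [hi]

/-- The multilinear map `v ↦ Q (Ω (v₁₀, v₁₁), …, Ω (v_{k0}, v_{k1}))`. -/
def substTwoForms {k : ℕ} (Q : ContinuousMultilinearMap ℂ (fun _ : Fin k ↦ (Fin n × Fin n → ℂ)) ℂ)
    (Ω : Fin n → Fin n → T [⋀^Fin 2]→L[ℝ] ℂ) :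
    ContinuousMultilinearMap ℝ (fun _ : Fin k × Fin 2 ↦ T) ℂ where
  toFun v := Q fun i ab ↦ Ω ab.1 ab.2 fun j ↦ v (i, j)
  map_update_add' := by
    intro _ v p x y
    have h (z : T) : (fun i (ab : Fin n × Fin n) ↦
        Ω ab.1 ab.2 fun j ↦ Function.update v p z (i, j)) =
        Function.update (fun i (ab : Fin n × Fin n) ↦ Ω ab.1 ab.2 fun j ↦ v (i, j)) p.1
          (fun ab ↦ Ω ab.1 ab.2 (Function.update (fun j ↦ v (p.1, j)) p.2 z)) :=
      substTwoForms_aux Ω v p z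
    simp only [h]
    rw [← Q.map_update_add]
    congr 2
    funext ab
    simp
  map_update_smul' := by
    intro _ v p c x
    have h (z : T) : (fun i (ab : Fin n × Fin n) ↦
        Ω ab.1 ab.2 fun j ↦ Function.update v p z (i, j)) =
        Function.update (fun i (ab : Fin n × Fin n) ↦ Ω ab.1 ab.2 fun j ↦ v (i, j)) p.1
          (fun ab ↦ Ω ab.1 ab.2 (Function.update (fun j ↦ v (p.1, j)) p.2 z)) :=
      substTwoForms_aux Ω v p z
    simp only [h]
    rw [← Complex.coe_smul, ← Q.map_update_smul]
    congr 2
    funext ab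
    simp
  cont := by
    refine Q.cont.comp (continuous_pi fun i ↦ continuous_pi fun ab ↦ ?_)
    exact (Ω ab.1 ab.2).cont.comp (continuous_pi fun j ↦ continuous_apply (i, j))

/-- The degree `2k` part of `P(Ω)`, for a matrix `Ω` of (commuting) `2`-forms: the entries of `Ω`
are substituted in the degree `k` homogeneous part of `P` and multiplied with the wedge product.
Explicitly, with the polarization `Q` of this part,
`P(Ω)(v) = 2^{-k} ∑_σ sign(σ) Q(Ω(v_{σ 1}, v_{σ 2}), …, Ω(v_{σ (2k-1)}, v_{σ (2k)}))`. -/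
def polyForm (P : MvPolynomial (Fin n × Fin n) ℂ) (k : ℕ)
    (Ω : Fin n → Fin n → T [⋀^Fin 2]→L[ℝ] ℂ) : T [⋀^Fin (2 * k)]→L[ℝ] ℂ :=
  ((2 : ℂ) ^ k)⁻¹ • ContinuousMultilinearMap.alternatization
    ((substTwoForms (polarization P k) Ω).domDomCongr
      (finProdFinEquiv.trans (finCongr (Nat.mul_comm k 2))))

end Polynomials

/-! ### Hermitian bundles, connections and gauge transformations

A hermitian vector bundle of rank `n` is a smooth vector bundle with model fibre `ℂⁿ`, complex
linear trivializations and a smooth hermitian metric on its fibres. -/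

/-- The model fibre `ℂⁿ`. -/
abbrev Fib (n : ℕ) : Type := EuclideanSpace ℂ (Fin n)

section PullbackBundle

variable {B B' : Type*}

/-- The pullback bundle `f^* E`, with fibre `E (f x)` at `x`. It is Mathlib's `f *ᵖ E`, under a
name of its own so that the fibres carry the norms and inner products of the fibres of `E`. -/
def Pull (f : B' → B) (E : B → Type*) : B' → Type _ := fun x ↦ E (f x)

variable (f : B' → B) (E : B → Type*)

instance pullNormedAddCommGroup [h : ∀ x, NormedAddCommGroup (E x)] (x : B') :
    NormedAddCommGroup (Pull f E x) :=
  h (f x)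

instance pullInnerProductSpace [∀ x, NormedAddCommGroup (E x)]
    [h : ∀ x, InnerProductSpace ℂ (E x)] (x : B') : InnerProductSpace ℂ (Pull f E x) :=
  h (f x)

variable [TopologicalSpace B'] [TopologicalSpace B] {n : ℕ} [TopologicalSpace (TotalSpace (Fib n) E)]

instance pullTopologicalSpace : TopologicalSpace (TotalSpace (Fib n) (Pull f E)) :=
  Pullback.TotalSpace.topologicalSpace (Fib n) E f

variable [∀ x, NormedAddCommGroup (E x)] [∀ x, InnerProductSpace ℂ (E x)]
  {K : Type*} [FunLike K B' B] [ContinuousMapClass K B' B] (g : K)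
  [FiberBundle (Fib n) E]

instance pullFiberBundle : FiberBundle (Fib n) (Pull g E) :=
  FiberBundle.pullback (F := Fib n) (E := E) g

instance pullVectorBundleComplex [VectorBundle ℂ (Fib n) E] : VectorBundle ℂ (Fib n) (Pull g E) :=
  VectorBundle.pullback ℂ (F := Fib n) (E := E) g

instance pullVectorBundleReal [VectorBundle ℝ (Fib n) E] : VectorBundle ℝ (Fib n) (Pull g E) :=
  VectorBundle.pullback ℝ (F := Fib n) (E := E) g

end PullbackBundle

section Bundles

theorem finrank_fibre {M : Type*} [TopologicalSpace M] {n : ℕ} (E : M → Type*)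
    [TopologicalSpace (TotalSpace (Fib n) E)] [∀ x, NormedAddCommGroup (E x)]
    [∀ x, InnerProductSpace ℂ (E x)] [FiberBundle (Fib n) E] [VectorBundle ℂ (Fib n) E] (x : M) :
    FiniteDimensional ℂ (E x) ∧ Module.finrank ℂ (E x) = n := by
  have e := ((trivializationAt (Fib n) E x).continuousLinearEquivAt ℂ x
    (mem_baseSet_trivializationAt (Fib n) E x)).toLinearEquiv
  exact ⟨e.symm.finiteDimensional, by simpa using e.finrank_eq⟩

variable {V : Type*} [NormedAddCommGroup V] [NormedSpace ℝ V]
  {H : Type*} [TopologicalSpace H] {I : ModelWithCorners ℝ V H}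
  {M : Type*} [TopologicalSpace M] [ChartedSpace H M]
  {n : ℕ} {E : M → Type*} [TopologicalSpace (TotalSpace (Fib n) E)]
  [∀ x, NormedAddCommGroup (E x)] [∀ x, InnerProductSpace ℂ (E x)]
  [FiberBundle (Fib n) E] [VectorBundle ℂ (Fib n) E] [VectorBundle ℝ (Fib n) E]

variable (I E) in
/-- The type of operators sending sections of `E` to `E`-valued `1`-forms; the value
`cov σ x v` is written `(∇_v σ)(x)` on paper. -/
abbrev Operator : Type _ := (∀ x : M, E x) → ∀ x : M, TangentSpace I x →L[ℝ] E x

variable (I n) in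
/-- A section of `E`, viewed as a map to the total space, is differentiable at `x`. -/
def IsDiffSectionAt (σ : ∀ x, E x) (x : M) : Prop :=
  MDifferentiableAt I (I.prod 𝓘(ℝ, Fib n)) (fun y ↦ TotalSpace.mk' (Fib n) y (σ y)) x

variable (n) in
/-- `cov` is a smooth connection on the complex vector bundle `E` which is compatible with the
hermitian metric. -/
structure IsHermitianConnection [IsManifold I 1 M] (cov : Operator I E) : Prop where
  isCovariantDerivative : IsCovariantDerivativeOn (Fib n) cov Set.univ
  smooth : ContMDiffCovariantDerivativeOn (Fib n) ∞ cov Set.univ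
  complex_linear : ∀ (c : ℂ) (σ : ∀ x, E x) (x : M), IsDiffSectionAt I n σ x →
    ∀ v : TangentSpace I x, cov (fun y ↦ c • σ y) x v = c • cov σ x v
  metric : ∀ (σ τ : ∀ x, E x) (x : M), IsDiffSectionAt I n σ x → IsDiffSectionAt I n τ x →
    ∀ v : TangentSpace I x,
      mvfderiv I (fun y ↦ inner ℂ (σ y) (τ y)) x v =
        inner ℂ (cov σ x v) (τ x) + inner ℂ (σ x) (cov τ x v)

/-- A unitary isomorphism of a fibre as a real-linear map. -/
def unitaryCLM {x : M} (u : E x ≃ₗᵢ[ℂ] E x) : E x →L[ℝ] E x :=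
  (u.toContinuousLinearEquiv : E x →L[ℂ] E x).restrictScalars ℝ

variable (I n) in
/-- The family of unitary isomorphisms `U x` is a smooth section of the endomorphism bundle,
i.e. `U` is a unitary gauge transformation of `E`. -/
def IsGauge (U : ∀ x, E x ≃ₗᵢ[ℂ] E x) : Prop :=
  ContMDiff I (I.prod 𝓘(ℝ, Fib n →L[ℝ] Fib n)) ∞
    fun x ↦ TotalSpace.mk' (Fib n →L[ℝ] Fib n) (E := fun x ↦ E x →L[ℝ] E x) x (unitaryCLM (U x))

variable (n) in
/-- `U₀` and `U₁` are homotopic through continuous sections of the bundle of unitary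
isomorphisms. -/
def GaugeHomotopic (U₀ U₁ : ∀ x, E x ≃ₗᵢ[ℂ] E x) : Prop :=
  ∃ h : unitInterval → ∀ x, E x ≃ₗᵢ[ℂ] E x,
    Continuous (fun p : unitInterval × M ↦
      TotalSpace.mk' (Fib n →L[ℝ] Fib n) (E := fun x ↦ E x →L[ℝ] E x) p.2
        (unitaryCLM (h p.1 p.2))) ∧
    h 0 = U₀ ∧ h 1 = U₁

/-- The gauge transformed connection `U⁻¹ ∇ U`. -/
def gaugeConj (U : ∀ x, E x ≃ₗᵢ[ℂ] E x) (cov : Operator I E) : Operator I E := fun σ x ↦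
  (unitaryCLM (U x).symm).comp (cov (fun y ↦ U y (σ y)) x)

/-! ### Local frames, curvature and Chern-Weil forms -/

variable (E) in
/-- The `j`-th section of the local frame given by the preferred trivialization at `x₀`. -/
def frame (x₀ : M) (j : Fin n) (y : M) : E y :=
  (trivializationAt (Fib n) E x₀).symmL ℂ y (EuclideanSpace.single j 1)

variable (E) in
/-- The `i`-th component of a vector with respect to the frame `frame E x₀`. -/
def frameCoord (x₀ : M) (i : Fin n) (y : M) : E y →L[ℂ] ℂ :=
  (EuclideanSpace.proj i : Fib n →L[ℂ] ℂ).comp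
    ((trivializationAt (Fib n) E x₀).continuousLinearMapAt ℂ y)

variable (I n E) in
/-- The hermitian metric of `E` is smooth: its coefficients with respect to the local frames given
by the preferred trivializations are smooth functions. -/
def IsSmoothHermitianMetric : Prop :=
  ∀ (x₀ : M) (i j : Fin n), ContMDiffOn I 𝓘(ℝ, ℂ) ∞
    (fun y ↦ (inner ℂ (frame E x₀ i y) (frame E x₀ j y) : ℂ))
    (trivializationAt (Fib n) E x₀).baseSet

/-- The entry `ω_{ij}` of the connection matrix in the frame at `x₀`, determined by
`∇ e_j = ∑ i, ω_{ij} e_i`. -/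
def connForm (cov : Operator I E) (x₀ : M) (i j : Fin n) (y : M) : TangentSpace I y →L[ℝ] ℂ :=
  ((frameCoord E x₀ i y).restrictScalars ℝ).comp (cov (frame E x₀ j) y)

/-- The curvature matrix `Ω = dω + ω ∧ ω` at `x`, in the frame at `x`. -/
def curvature (cov : Operator I E) (x : M) (i j : Fin n) : TangentSpace I x [⋀^Fin 2]→L[ℝ] ℂ :=
  extD (fun y ↦ oneForm (connForm cov x i j y)) x +
    ∑ k, wedge (connForm cov x i k x) (connForm cov x k j x)

variable (E) in
/-- An orthonormal basis of the fibre at `x`. -/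
def fibreBasis (x : M) : OrthonormalBasis (Fin n) ℂ (E x) :=
  haveI := (finrank_fibre (n := n) E x).1
  (stdOrthonormalBasis ℂ (E x)).reindex (finCongr (finrank_fibre (n := n) E x).2)

variable (E) in
/-- The matrix of `fibreBasis E x` with respect to the frame at `x`. -/
def basisChange (x : M) : Matrix (Fin n) (Fin n) ℂ :=
  Matrix.of fun i j ↦ frameCoord E x i x (fibreBasis E x j)

/-- The matrix, in an orthonormal basis of the fibre at `x`, of the curvature `F(∇)` as a `2`-form
with values in endomorphisms. -/
def unitaryCurvature (cov : Operator I E) (x : M) (i j : Fin n) :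
    TangentSpace I x [⋀^Fin 2]→L[ℝ] ℂ :=
  ∑ k, ∑ l, ((basisChange E x)⁻¹ i k * basisChange E x l j) • curvature cov x k l

/-- The degree `2k` part of the Chern-Weil form `P(E, ∇) = P(F(∇))`. -/
def chernWeil (P : MvPolynomial (Fin n × Fin n) ℂ) (k : ℕ) (cov : Operator I E) :
    DiffForm I M (2 * k) := fun x ↦
  polyForm P k (unitaryCurvature cov x)

/-! ### Transgression -/

/-- The connection `d/dt + (1 - t) ∇₀ + t ∇₁` on the pullback `π₂^* E` of `E` to `ℝ × M` under the
projection `π₂` to the second factor. A section `σ` of `π₂^* E` is a family of sections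
`σ (t, ·)` of `E`. -/
def pathConnection (cov₀ cov₁ : Operator I E) :
    Operator (𝓘(ℝ, ℝ).prod I) (Pull (ContMDiffMap.snd : C^∞⟮𝓘(ℝ, ℝ).prod I, ℝ × M; I, M⟯) E) := fun σ p ↦
  let dt : ℝ × V →L[ℝ] ℝ := ContinuousLinearMap.fst ℝ ℝ V
  let pr : ℝ × V →L[ℝ] TangentSpace I p.2 := ContinuousLinearMap.snd ℝ ℝ V
  let s : ℝ → ∀ x, E x := fun t x ↦ σ (t, x)
  let D : ℝ × V →L[ℝ] E p.2 := dt.smulRight (deriv (fun t ↦ s t p.2) p.1) +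
    ((1 - p.1) • cov₀ (s p.1) p.2 + p.1 • cov₁ (s p.1) p.2).comp pr
  D

/-- Integration over `[0, 1]` along the fibres of `π₂ : ℝ × M → M`, with the fibre oriented
first: `(∫ α)_x (v₁, …, v_k) = ∫_0^1 α_{(t, x)} (∂_t, v₁, …, v_k) dt`. -/
def fibreIntegral {k : ℕ} (α : DiffForm (𝓘(ℝ, ℝ).prod I) (ℝ × M) (k + 1)) : DiffForm I M k :=
  fun x ↦
    let β : ℝ → V [⋀^Fin k]→L[ℝ] ℂ := fun t ↦
      ((show (ℝ × V) [⋀^Fin (k + 1)]→L[ℝ] ℂ from α (t, x)).curryLeft (1, 0)).compContinuousLinearMap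
        (ContinuousLinearMap.inr ℝ ℝ V)
    ((∫ t in (0 : ℝ)..1, β t : V [⋀^Fin k]→L[ℝ] ℂ))

/-- The degree `2k + 1` part of the transgression form `TP(∇₀, ∇₁) = ∫_{[0, 1]} P(π₂^* E, ∇̃)`,
where `∇̃` is `pathConnection`. -/
def transgression (P : MvPolynomial (Fin n × Fin n) ℂ) (k : ℕ) (cov₀ cov₁ : Operator I E) :
    DiffForm I M (2 * k + 1) :=
  fibreIntegral (chernWeil P (k + 1)
    (E := Pull (ContMDiffMap.snd : C^∞⟮𝓘(ℝ, ℝ).prod I, ℝ × M; I, M⟯) E) (pathConnection cov₀ cov₁))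

/-- The degree `2k + 1` part of the odd Chern-Weil form `TP(E, U, ∇) = TP(∇, U⁻¹ ∇ U)`. -/
def oddChernWeil (P : MvPolynomial (Fin n × Fin n) ℂ) (k : ℕ) (U : ∀ x, E x ≃ₗᵢ[ℂ] E x)
    (cov : Operator I E) : DiffForm I M (2 * k + 1) :=
  transgression P k cov (gaugeConj U cov)

/-! ### Pullbacks -/

variable {V' : Type*} [NormedAddCommGroup V'] [NormedSpace ℝ V']
  {H' : Type*} [TopologicalSpace H'] {I' : ModelWithCorners ℝ V' H'}
  {M' : Type*} [TopologicalSpace M'] [ChartedSpace H' M']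

instance pullContMDiffVectorBundle [ContMDiffVectorBundle ∞ (Fib n) E I]
    (φ : C^∞⟮I', M'; I, M⟯) : ContMDiffVectorBundle ∞ (Fib n) (Pull φ E) I' :=
  ContMDiffVectorBundle.pullback (Fib n) E I' φ

variable (n) in
/-- The pullback connection `φ^* ∇` on `φ^* E`: near `x` a section of `φ^* E` is
`σ = ∑ j, f_j • (e_j ∘ φ)` with the frame `e` at `φ x`, and
`(φ^* ∇)_v σ = ∑ j, (df_j(v) e_j (φ x) + f_j(x) ∇_{dφ(v)} e_j)`. -/
def connPullback (φ : C^∞⟮I', M'; I, M⟯) (cov : Operator I E) :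
    Operator I' (Pull φ E) := fun σ x ↦
  let f : Fin n → M' → ℂ := fun j y ↦ frameCoord E (φ x) j (φ y) (σ y)
  let D : TangentSpace I' x →L[ℝ] E (φ x) := ∑ j,
    ((mvfderiv I' (f j) x).smulRight (frame E (φ x) j (φ x)) +
      f j x • (cov (frame E (φ x) j) (φ x)).comp (mfderiv I' I φ x))
  D

/-- The pullback `φ^* U` of a gauge transformation. -/
def gaugePullback (φ : C^∞⟮I', M'; I, M⟯) (U : ∀ x, E x ≃ₗᵢ[ℂ] E x) (x : M') :
    (Pull φ E) x ≃ₗᵢ[ℂ] (Pull φ E) x :=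
  U (φ x)

end Bundles

end

end OddChernWeil

open OddChernWeil

/-!
In a local frame a connection is `d + ω` for a matrix `ω` of covector fields, with curvature
`Ω = dω + ω ∧ ω`. A polynomial invariant under `U(n)` is invariant under `GL(n, ℂ)`, because
`U(n)` is Zariski dense in `GL(n, ℂ)` (`isConjInvariant_polarization`); hence the form `P(Ω)` does
not depend on the frame, and the Bianchi identity shows that it is closed. All forms are therefore
computed with connection matrices in the cocycle of local frames of the bundle (`FrameAtlas`,
`transgression_eq`).

Integration over `[0, 1]` along the fibres of `ℝ × M → M` satisfies the homotopy formula
`d ∫ α = α|_{t = 1} - α|_{t = 0} - ∫ dα` (`extD_fibreIntegral`). Applied to the closed form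
`P(∇̃)` it gives `d TP(∇₀, ∇₁) = P(∇₁) - P(∇₀)`, which vanishes when `∇₁` is a gauge transform of
`∇₀`. This is the closedness of the odd forms. For the two invariance statements the same argument
is applied once more on `ℝ × M`: a path of connections, or a smooth homotopy `u` of gauge
transformations, gives two gauge equivalent connections on `ℝ × M`, whose transgression form is
closed and restricts to the two forms to be compared at `t = 0` and `t = 1`, so that its fibre
integral is a primitive of their difference (`FrameAtlas.isExactForm_tp_slice`).

A continuous homotopy of unitary gauge transformations need not be smooth, and its smoothing need
not be unitary; by the invariance of `P` under `GL(n, ℂ)` a smooth homotopy through invertible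
complex linear maps suffices. It is obtained by convexity: the complex linear maps `A` of a fibre
with `Re ⟪A v, h v⟫ > 0` for all `v ≠ 0`, where `h` is unitary, are invertible and form a convex
set, in which local smooth choices are glued with a partition of unity
(`exists_isAut_of_gaugeHomotopic`).

Naturality holds since pullback commutes with all the operations involved; in the frames pulled
back from `M` the connection matrices of `φ^* ∇` are the pullbacks of those of `∇`
(`connForm_connPullback`).
-/

namespace OddChernWeil

open Matrix Filter Topology

/-! ### Invariance of polynomials and of their polarizations under conjugation -/

section Invariance

variable {n k : ℕ}

/-- The entries of a matrix, as a point of the space on which polynomials in the entries live. -/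
def entries (A : Matrix (Fin n) (Fin n) ℂ) : Fin n × Fin n → ℂ := fun ab ↦ A ab.1 ab.2

/-- A `k`-linear form on `n × n` matrices which is invariant under simultaneous conjugation of its
arguments, written without inverses so that it makes sense for singular matrices `X` as well. -/
def IsConjInvariant (Q : ContinuousMultilinearMap ℂ (fun _ : Fin k ↦ (Fin n × Fin n → ℂ)) ℂ) :
    Prop :=
  ∀ (b : Fin k → Matrix (Fin n) (Fin n) ℂ) (X : Matrix (Fin n) (Fin n) ℂ),
    Q (fun i ↦ entries (b i * X)) = Q (fun i ↦ entries (X * b i))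

/-- The map `A ↦ u A v` on matrices. -/
noncomputable def conjCLM (u v : Matrix (Fin n) (Fin n) ℂ) : (Fin n × Fin n → ℂ) →L[ℂ] (Fin n × Fin n → ℂ) :=
  LinearMap.toContinuousLinearMap
    { toFun := fun a ↦ entries (u * Matrix.of (fun i j ↦ a (i, j)) * v)
      map_add' := fun a b ↦ by
        ext ab
        have : Matrix.of (fun i j ↦ (a + b) (i, j)) =
          Matrix.of (fun i j ↦ a (i, j)) + Matrix.of (fun i j ↦ b (i, j)) := rfl
        simp only [entries, this, Matrix.mul_add, Matrix.add_mul]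
        rfl
      map_smul' := fun c a ↦ by
        ext ab
        have : Matrix.of (fun i j ↦ (c • a) (i, j)) = c • Matrix.of (fun i j ↦ a (i, j)) := rfl
        simp only [entries, this, Matrix.mul_smul, Matrix.smul_mul]
        rfl }

theorem conjCLM_entries (u v A : Matrix (Fin n) (Fin n) ℂ) :
    conjCLM u v (entries A) = entries (u * A * v) := rfl

theorem contDiff_eval (P : MvPolynomial (Fin n × Fin n) ℂ) (N : WithTop ℕ∞) :
    ContDiff ℂ N (fun a ↦ MvPolynomial.eval a P) :=
  (AnalyticOnNhd.eval_mvPolynomial P).contDiff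

theorem polarization_conj_unitary {P : MvPolynomial (Fin n × Fin n) ℂ}
    (hP : IsInvariantPolynomial P) {u : Matrix (Fin n) (Fin n) ℂ}
    (hu : u ∈ Matrix.unitaryGroup (Fin n) ℂ) (b : Fin k → Matrix (Fin n) (Fin n) ℂ) :
    polarization P k (fun i ↦ entries (u * b i * u⁻¹)) = polarization P k (fun i ↦ entries (b i)) := by
  have h : (fun a ↦ MvPolynomial.eval a P) ∘ (conjCLM u u⁻¹) = fun a ↦ MvPolynomial.eval a P := by
    funext a
    exact hP u hu (Matrix.of fun i j ↦ a (i, j))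
  have h2 := ContinuousLinearMap.iteratedFDeriv_comp_right (𝕜 := ℂ) (conjCLM u u⁻¹)
    (contDiff_eval P k) (0 : Fin n × Fin n → ℂ) (le_refl (k : WithTop ℕ∞))
  rw [h, map_zero] at h2
  have h3 := congrArg (fun T ↦ T (fun i ↦ entries (b i))) h2
  simp only [ContinuousMultilinearMap.compContinuousLinearMap_apply, conjCLM_entries] at h3
  simp only [polarization, _root_.smul_apply]
  rw [← h3]

open scoped ComplexOrder in
/-- The Cayley transform of a skew-hermitian matrix `X` is unitary; applied to it, unitary
invariance becomes an identity which is polynomial in `X`. -/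
theorem polarization_skew {P : MvPolynomial (Fin n × Fin n) ℂ}
    (hP : IsInvariantPolynomial P) {X : Matrix (Fin n) (Fin n) ℂ} (hX : Xᴴ = -X)
    (b : Fin k → Matrix (Fin n) (Fin n) ℂ) :
    polarization P k (fun i ↦ entries ((1 + X) * b i * (1 - X))) =
      polarization P k (fun i ↦ entries ((1 - X) * b i * (1 + X))) := by
  have hpos : ((1 - X) * (1 + X)).PosDef := by
    have : (1 - X) * (1 + X) = 1 + Xᴴ * X := by rw [hX]; noncomm_ring
    rw [this]
    exact Matrix.PosDef.one.add_posSemidef (Matrix.posSemidef_conjTranspose_mul_self X)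
  have hdet := hpos.isUnit
  have hm : IsUnit (1 - X).det := by
    have := (Matrix.isUnit_iff_isUnit_det _).1 hdet
    rw [Matrix.det_mul] at this
    exact isUnit_of_mul_isUnit_left this
  have hp : IsUnit (1 + X).det := by
    have := (Matrix.isUnit_iff_isUnit_det _).1 hdet
    rw [Matrix.det_mul] at this
    exact isUnit_of_mul_isUnit_right this
  have hcomm : (1 - X) * (1 + X) = (1 + X) * (1 - X) := by noncomm_ring
  set p := 1 + X with hp'
  set m := 1 - X with hm'
  have hcomm' : p * m⁻¹ = m⁻¹ * p := by
    calc p * m⁻¹ = m⁻¹ * (m * p) * m⁻¹ := by rw [← mul_assoc, Matrix.nonsing_inv_mul _ hm, one_mul]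
      _ = m⁻¹ * p := by rw [hcomm, mul_assoc, mul_assoc, Matrix.mul_nonsing_inv _ hm, mul_one]
  have hpm : pᴴ = m := by simp [hp', hm', hX, sub_eq_add_neg]
  have hmp : mᴴ = p := by rw [← hpm, Matrix.conjTranspose_conjTranspose]
  have hinv : (m⁻¹ * p)⁻¹ = p⁻¹ * m := by
    rw [Matrix.mul_inv_rev, Matrix.nonsing_inv_nonsing_inv _ hm]
  have hu : m⁻¹ * p ∈ Matrix.unitaryGroup (Fin n) ℂ := by
    rw [Matrix.mem_unitaryGroup_iff, Matrix.star_eq_conjTranspose, Matrix.conjTranspose_mul, hpm,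
      Matrix.conjTranspose_nonsing_inv, hmp]
    calc m⁻¹ * p * (m * p⁻¹) = m⁻¹ * (p * m) * p⁻¹ := by noncomm_ring
      _ = 1 := by rw [← hcomm, ← mul_assoc, Matrix.nonsing_inv_mul _ hm, one_mul,
        Matrix.mul_nonsing_inv _ hp]
  have := polarization_conj_unitary (k := k) hP hu (fun i ↦ m * b i * p)
  rw [← this]
  congr 1
  funext i
  rw [hinv, ← hcomm']
  have : p * m⁻¹ * (m * b i * p) * (p⁻¹ * m) = p * (m⁻¹ * m) * b i * (p * p⁻¹) * m := by
    noncomm_ring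
  rw [this, Matrix.nonsing_inv_mul _ hm, Matrix.mul_nonsing_inv _ hp, mul_one, mul_one]

/-- Multilinear expressions in matrices depending analytically on one variable are analytic. -/
theorem analyticOnNhd_multilinear
    (Q : ContinuousMultilinearMap ℂ (fun _ : Fin k ↦ (Fin n × Fin n → ℂ)) ℂ)
    {b : Fin k → ℂ → Matrix (Fin n) (Fin n) ℂ}
    (hb : ∀ i a c, Differentiable ℂ fun z ↦ b i z a c) :
    AnalyticOnNhd ℂ (fun z ↦ Q (fun i ↦ entries (b i z))) Set.univ := by
  have : Differentiable ℂ (fun z ↦ Q (fun i ↦ entries (b i z))) := by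
    refine fun z ↦ (Q.hasFDerivAt _).differentiableAt.comp z ?_
    refine differentiableAt_pi.2 fun i ↦ differentiableAt_pi.2 fun ab ↦ hb i ab.1 ab.2 z
  exact this.differentiableOn.analyticOnNhd isOpen_univ

theorem differentiable_affine_mul (Y W b Y' W' : Matrix (Fin n) (Fin n) ℂ) (a c : Fin n) :
    Differentiable ℂ fun z : ℂ ↦ ((Y + z • W) * b * (Y' + z • W')) a c := by
  simp only [Matrix.mul_apply, Matrix.add_apply, Matrix.smul_apply, smul_eq_mul]
  fun_prop

/-- Matrices are complex combinations of skew-hermitian ones, so a polynomial identity valid for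
skew-hermitian matrices holds for all matrices. -/
theorem polarization_cayley {P : MvPolynomial (Fin n × Fin n) ℂ}
    (hP : IsInvariantPolynomial P) (X : Matrix (Fin n) (Fin n) ℂ)
    (b : Fin k → Matrix (Fin n) (Fin n) ℂ) :
    polarization P k (fun i ↦ entries ((1 + X) * b i * (1 - X))) =
      polarization P k (fun i ↦ entries ((1 - X) * b i * (1 + X))) := by
  set Y : Matrix (Fin n) (Fin n) ℂ := (2⁻¹ : ℂ) • (X - Xᴴ) with hY
  set W : Matrix (Fin n) (Fin n) ℂ := (-(2⁻¹ : ℂ) * Complex.I) • (X + Xᴴ) with hW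
  have hY' : Yᴴ = -Y := by
    simp only [hY, conjTranspose_smul, conjTranspose_sub, conjTranspose_conjTranspose, ← smul_neg]
    simp
  have hW' : Wᴴ = -W := by
    simp only [hW, conjTranspose_smul, conjTranspose_add, conjTranspose_conjTranspose, ← neg_smul,
      add_comm Xᴴ X]
    simp
  have hX : X = Y + Complex.I • W := by
    have h1 : Complex.I • W = (2⁻¹ : ℂ) • (X + Xᴴ) := by
      rw [hW, smul_smul]
      congr 1
      linear_combination (-2⁻¹ : ℂ) * Complex.I_mul_I
    rw [h1, hY, ← smul_add, sub_add_add_cancel, ← two_smul ℂ X, smul_smul]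
    norm_num
  have key := AnalyticOnNhd.eq_of_frequently_eq (z₀ := (0 : ℂ))
    (f := fun z : ℂ ↦ polarization P k
      (fun i ↦ entries (((1 + Y) + z • W) * b i * ((1 - Y) + z • (-W)))))
    (g := fun z : ℂ ↦ polarization P k
      (fun i ↦ entries (((1 - Y) + z • (-W)) * b i * ((1 + Y) + z • W))))
    (analyticOnNhd_multilinear _ fun i a c ↦ differentiable_affine_mul _ _ _ _ _ a c)
    (analyticOnNhd_multilinear _ fun i a c ↦ differentiable_affine_mul _ _ _ _ _ a c) ?_
  · have := congrFun key Complex.I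
    have e1 : (1 + Y) + Complex.I • W = 1 + X := by rw [hX]; abel
    have e2 : (1 - Y) + Complex.I • (-W) = 1 - X := by rw [hX, smul_neg]; abel
    rwa [e1, e2] at this
  · have hreal : ∀ t : ℝ, polarization P k
        (fun i ↦ entries (((1 + Y) + (t : ℂ) • W) * b i * ((1 - Y) + (t : ℂ) • (-W)))) =
        polarization P k
        (fun i ↦ entries (((1 - Y) + (t : ℂ) • (-W)) * b i * ((1 + Y) + (t : ℂ) • W))) := by
      intro t
      have hsk : (Y + (t : ℂ) • W)ᴴ = -(Y + (t : ℂ) • W) := by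
        simp only [conjTranspose_add, conjTranspose_smul, hY', hW', RCLike.star_def,
          Complex.conj_ofReal, smul_neg]
        abel
      have := polarization_skew (k := k) hP hsk b
      have e1 : (1 + Y) + (t : ℂ) • W = 1 + (Y + (t : ℂ) • W) := by abel
      have e2 : (1 - Y) + (t : ℂ) • (-W) = 1 - (Y + (t : ℂ) • W) := by rw [smul_neg]; abel
      rw [e1, e2, this]
    have hfreq : ∃ᶠ t : ℝ in 𝓝[≠] 0, True := by
      rw [frequently_true_iff_neBot]; infer_instance
    have htend : Tendsto (fun t : ℝ ↦ (t : ℂ)) (𝓝[≠] 0) (𝓝[≠] 0) := by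
      refine tendsto_nhdsWithin_iff.2 ⟨?_, ?_⟩
      · have : Tendsto (fun t : ℝ ↦ (t : ℂ)) (𝓝 0) (𝓝 ((0 : ℝ) : ℂ)) :=
          Complex.continuous_ofReal.continuousAt
        rw [Complex.ofReal_zero] at this
        exact this.mono_left nhdsWithin_le_nhds
      · filter_upwards [self_mem_nhdsWithin] with t ht
        simpa using ht
    exact htend.frequently (hfreq.mono fun t _ ↦ hreal t)

/-- Invariance under `U(n)` implies invariance under all of `GL(n, ℂ)`, even in its inverse-free
form: near `g = 1` the matrix `g` is a Cayley transform up to a factor, and the identity is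
polynomial in `g`. -/
theorem isConjInvariant_polarization {P : MvPolynomial (Fin n × Fin n) ℂ}
    (hP : IsInvariantPolynomial P) (k : ℕ) : IsConjInvariant (polarization P k) := by
  intro b X
  have key := AnalyticOnNhd.eq_of_eventuallyEq (z₀ := (0 : ℂ))
    (f := fun z : ℂ ↦ polarization P k
      (fun i ↦ entries ((1 + z • 0) * b i * (1 + z • (X - 1)))))
    (g := fun z : ℂ ↦ polarization P k
      (fun i ↦ entries ((1 + z • (X - 1)) * b i * (1 + z • 0))))
    (analyticOnNhd_multilinear _ fun i a c ↦ differentiable_affine_mul _ _ _ _ _ a c)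
    (analyticOnNhd_multilinear _ fun i a c ↦ differentiable_affine_mul _ _ _ _ _ a c) ?_
  · simpa using congrFun key 1
  · have hcont : ContinuousAt (fun z : ℂ ↦ ((2 : ℂ) • (1 : Matrix (Fin n) (Fin n) ℂ) +
        z • (X - 1)).det) 0 := by
      refine Continuous.continuousAt (Continuous.matrix_det ?_)
      fun_prop
    have hne : ∀ᶠ z in 𝓝 (0 : ℂ), ((2 : ℂ) • (1 : Matrix (Fin n) (Fin n) ℂ) +
        z • (X - 1)).det ≠ 0 := by
      refine hcont.eventually_ne ?_
      simp
    filter_upwards [hne] with z hz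
    set g := 1 + z • (X - 1) with hg
    have hg2 : (2 : ℂ) • (1 : Matrix (Fin n) (Fin n) ℂ) + z • (X - 1) = 1 + g := by
      rw [hg, two_smul]; abel
    rw [hg2] at hz
    have hu : IsUnit (1 + g).det := isUnit_iff_ne_zero.2 hz
    have hc := polarization_cayley (k := k) hP ((g - 1) * (1 + g)⁻¹)
      (fun i ↦ (4⁻¹ : ℂ) • ((1 + g) * b i * (1 + g)))
    set r := (1 + g)⁻¹ with hr
    have hr1 : (1 + g) * r = 1 := Matrix.mul_nonsing_inv _ hu
    have hr2 : r * (1 + g) = 1 := Matrix.nonsing_inv_mul _ hu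
    have e1 : 1 + (g - 1) * r = (2 : ℂ) • (g * r) := by
      have : (1 + g) * r + (g - 1) * r = (2 : ℂ) • (g * r) := by rw [two_smul]; noncomm_ring
      rwa [hr1] at this
    have e2 : 1 - (g - 1) * r = (2 : ℂ) • r := by
      have : (1 + g) * r - (g - 1) * r = (2 : ℂ) • r := by rw [two_smul]; noncomm_ring
      rwa [hr1] at this
    have hcg : g * r = r * g := by
      have h1 : (1 + g) * r = r * (1 + g) := hr1.trans hr2.symm
      have h2 : r + g * r = r + r * g := by
        calc r + g * r = (1 + g) * r := by noncomm_ring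
          _ = r + r * g := by rw [h1]; noncomm_ring
      exact add_left_cancel h2
    rw [e1, e2] at hc
    simp only [Matrix.smul_mul, Matrix.mul_smul, smul_smul] at hc
    norm_num at hc
    simp only [smul_zero, add_zero, one_mul, mul_one]
    refine Eq.symm ?_
    convert hc using 3 with i i
    · congr 1
      calc g * b i = g * (r * (1 + g)) * b i * ((1 + g) * r) := by rw [hr2, hr1]; simp
        _ = g * r * ((1 + g) * b i * (1 + g)) * r := by noncomm_ring
    · congr 1
      calc b i * g = (r * (1 + g)) * b i * ((1 + g) * r) * g := by rw [hr2, hr1]; simp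
        _ = r * ((1 + g) * b i * (1 + g)) * (r * g) := by noncomm_ring
        _ = _ := by rw [hcg]

/-- Invariance of `Q` under conjugation, for an invertible matrix given with its defining
relation `g b' = b g`. -/
theorem IsConjInvariant.eq_of_mul_eq_mul
    {Q : ContinuousMultilinearMap ℂ (fun _ : Fin k ↦ (Fin n × Fin n → ℂ)) ℂ}
    (hQ : IsConjInvariant Q) {g : Matrix (Fin n) (Fin n) ℂ} (hg : IsUnit g.det)
    {b b' : Fin k → Matrix (Fin n) (Fin n) ℂ} (h : ∀ i, g * b' i = b i * g) :
    Q (fun i ↦ entries (b' i)) = Q (fun i ↦ entries (b i)) := by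
  have := hQ (fun i ↦ g⁻¹ * b i) g
  convert this using 3 with i i
  · congr 1
    rw [mul_assoc, ← h, ← mul_assoc, Matrix.nonsing_inv_mul _ hg, one_mul]
  · congr 1
    rw [← mul_assoc, Matrix.mul_nonsing_inv _ hg, one_mul]

/-- The infinitesimal form of conjugation invariance. -/
theorem IsConjInvariant.sum_commutator
    {Q : ContinuousMultilinearMap ℂ (fun _ : Fin k ↦ (Fin n × Fin n → ℂ)) ℂ}
    (hQ : IsConjInvariant Q) (b : Fin k → Matrix (Fin n) (Fin n) ℂ)
    (X : Matrix (Fin n) (Fin n) ℂ) :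
    ∑ j, Q (Function.update (fun i ↦ entries (b i)) j (entries (X * b j - b j * X))) = 0 := by
  have hd : ∀ c : Fin k → Matrix (Fin n) (Fin n) ℂ,
      HasDerivAt (fun z : ℂ ↦ Q (fun i ↦ entries (b i + z • c i)))
        (∑ j, Q (Function.update (fun i ↦ entries (b i)) j (entries (c j)))) 0 := by
    intro c
    have h1 : HasDerivAt (fun z : ℂ ↦ (fun i ↦ entries (b i + z • c i) : Fin k → _))
        (fun i ↦ entries (c i)) 0 := by
      refine hasDerivAt_pi.2 fun i ↦ hasDerivAt_pi.2 fun ab ↦ ?_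
      simpa [entries] using ((hasDerivAt_id (0 : ℂ)).mul_const (c i ab.1 ab.2)).const_add
        (b i ab.1 ab.2)
    have h2 := (Q.hasFDerivAt (fun i ↦ entries (b i + (0 : ℂ) • c i))).comp_hasDerivAt 0 h1
    simpa [ContinuousMultilinearMap.linearDeriv_apply, Function.comp_def] using h2
  have h1 := hd (fun i ↦ b i * X)
  have h2 := hd (fun i ↦ X * b i)
  have heq : (fun z : ℂ ↦ Q (fun i ↦ entries (b i + z • (b i * X)))) =
      fun z : ℂ ↦ Q (fun i ↦ entries (b i + z • (X * b i))) := by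
    funext z
    have := hQ b (1 + z • X)
    simpa [Matrix.mul_add, Matrix.add_mul] using this
  rw [heq] at h1
  have h3 := h2.unique h1
  have hsub : ∀ j, Q (Function.update (fun i ↦ entries (b i)) j (entries (X * b j - b j * X))) =
      Q (Function.update (fun i ↦ entries (b i)) j (entries (X * b j))) -
      Q (Function.update (fun i ↦ entries (b i)) j (entries (b j * X))) := fun j ↦
    Q.map_update_sub _ j (entries (X * b j)) (entries (b j * X))
  simp only [hsub, Finset.sum_sub_distrib, h3, sub_self]

end Invariance

/-! ### Polynomials in matrices of two-forms -/

section Algebra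

variable {n k : ℕ} {T : Type*} [AddCommGroup T] [Module ℝ T] [TopologicalSpace T]

/-- The matrix of values of a matrix of `2`-forms at a pair of vectors. -/
noncomputable def formMatrix (Ω : Fin n → Fin n → T [⋀^Fin 2]→L[ℝ] ℂ) (v : Fin 2 → T) :
    Matrix (Fin n) (Fin n) ℂ :=
  Matrix.of fun i j ↦ Ω i j v

/-- The numbering of `2k` vectors by `k` pairs used in `polyForm`. -/
def pairEquiv (k : ℕ) : Fin k × Fin 2 ≃ Fin (2 * k) :=
  finProdFinEquiv.trans (finCongr (Nat.mul_comm k 2))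

theorem polyForm_apply (P : MvPolynomial (Fin n × Fin n) ℂ) (k : ℕ)
    (Ω : Fin n → Fin n → T [⋀^Fin 2]→L[ℝ] ℂ) (v : Fin (2 * k) → T) :
    polyForm P k Ω v = ((2 : ℂ) ^ k)⁻¹ * ∑ σ : Equiv.Perm (Fin (2 * k)),
      ((Equiv.Perm.sign σ : ℤ) : ℂ) * polarization P k
        (fun i ↦ entries (formMatrix Ω fun j ↦ v (σ (pairEquiv k (i, j))))) := by
  rw [polyForm, ContinuousAlternatingMap.smul_apply,
    ContinuousMultilinearMap.alternatization_apply_apply, smul_eq_mul]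
  congr 1
  refine Finset.sum_congr rfl fun σ _ ↦ ?_
  rw [Units.smul_def, zsmul_eq_mul]
  rfl

variable {T' : Type*} [AddCommGroup T'] [Module ℝ T'] [TopologicalSpace T']

theorem polyForm_compContinuousLinearMap (P : MvPolynomial (Fin n × Fin n) ℂ) (k : ℕ)
    (Ω : Fin n → Fin n → T [⋀^Fin 2]→L[ℝ] ℂ) (L : T' →L[ℝ] T) :
    (polyForm P k Ω).compContinuousLinearMap L =
      polyForm P k fun i j ↦ (Ω i j).compContinuousLinearMap L := by
  ext v
  rw [ContinuousAlternatingMap.compContinuousLinearMap_apply, polyForm_apply, polyForm_apply]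
  rfl

theorem polyForm_conj {P : MvPolynomial (Fin n × Fin n) ℂ} {k : ℕ}
    (hP : IsConjInvariant (polarization P k)) {Ω Ω' : Fin n → Fin n → T [⋀^Fin 2]→L[ℝ] ℂ}
    {g : Matrix (Fin n) (Fin n) ℂ} (hg : IsUnit g.det)
    (h : ∀ v, g * formMatrix Ω' v = formMatrix Ω v * g) : polyForm P k Ω' = polyForm P k Ω := by
  ext v
  rw [polyForm_apply, polyForm_apply]
  congr 1
  refine Finset.sum_congr rfl fun σ _ ↦ ?_
  rw [hP.eq_of_mul_eq_mul hg fun i ↦ h _]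

theorem oneForm_apply (α : T →L[ℝ] ℂ) (v : Fin 1 → T) : oneForm α v = α (v 0) := rfl

theorem wedge_apply' (α β : T →L[ℝ] ℂ) (v : Fin 2 → T) :
    wedge α β v = α (v 0) * β (v 1) - α (v 1) * β (v 0) := by
  rw [← wedge_apply]
  congr 1
  ext i
  fin_cases i <;> rfl

/-- Alternating a function over all permutations gives zero if its sum over the powers of one
even `3`-cycle vanishes. -/
theorem sum_sign_eq_zero_of_cycle {N : ℕ} {X : Type*} (h : (Fin N → X) → ℂ) (ρ : Equiv.Perm (Fin N))
    (hρ : Equiv.Perm.sign ρ = 1) (hh : ∀ v, h v + h (v ∘ ρ) + h (v ∘ ⇑(ρ * ρ)) = 0)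
    (v : Fin N → X) :
    ∑ τ : Equiv.Perm (Fin N), ((Equiv.Perm.sign τ : ℤ) : ℂ) * h (v ∘ τ) = 0 := by
  have shift : ∀ κ : Equiv.Perm (Fin N), Equiv.Perm.sign κ = 1 →
      ∑ τ : Equiv.Perm (Fin N), ((Equiv.Perm.sign τ : ℤ) : ℂ) * h (v ∘ τ) =
      ∑ τ : Equiv.Perm (Fin N), ((Equiv.Perm.sign τ : ℤ) : ℂ) * h ((v ∘ τ) ∘ κ) := by
    intro κ hκ
    refine (Fintype.sum_equiv (Equiv.mulRight κ) _ _ fun τ ↦ ?_).symm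
    simp [hκ, Function.comp_assoc, Equiv.Perm.coe_mul]
  have h3 : (3 : ℂ) * ∑ τ : Equiv.Perm (Fin N), ((Equiv.Perm.sign τ : ℤ) : ℂ) * h (v ∘ τ) = 0 := by
    calc _ = (∑ τ : Equiv.Perm (Fin N), ((Equiv.Perm.sign τ : ℤ) : ℂ) * h (v ∘ τ)) +
          (∑ τ : Equiv.Perm (Fin N), ((Equiv.Perm.sign τ : ℤ) : ℂ) * h (v ∘ τ)) +
          ∑ τ : Equiv.Perm (Fin N), ((Equiv.Perm.sign τ : ℤ) : ℂ) * h (v ∘ τ) := by ring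
      _ = 0 := by
        nth_rewrite 2 [shift ρ hρ]
        nth_rewrite 2 [shift (ρ * ρ) (by simp [hρ])]
        rw [← Finset.sum_add_distrib, ← Finset.sum_add_distrib]
        refine Finset.sum_eq_zero fun τ _ ↦ ?_
        rw [← mul_add, ← mul_add, hh, mul_zero]
  simpa using h3

end Algebra

section FiniteDim

variable {V : Type*} [NormedAddCommGroup V] [NormedSpace ℝ V] [FiniteDimensional ℝ V] {k : ℕ}
  {E : Type*} [NormedAddCommGroup E] [NormedSpace ℝ E]

variable (V k) in
/-- In finite dimensions an alternating form is recovered from finitely many of its values by a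
continuous linear map, which is why regularity of forms can be tested on values. -/
theorem exists_reconstruct : ∃ (ι : Type) (_ : Fintype ι) (b : ι → Fin k → V)
    (L : (ι → ℂ) →L[ℝ] (V [⋀^Fin k]→L[ℝ] ℂ)), ∀ f, L (fun s ↦ f (b s)) = f := by
  let b := Module.finBasis ℝ V
  let ev : (V [⋀^Fin k]→L[ℝ] ℂ) →ₗ[ℝ] ((Fin k → Fin (Module.finrank ℝ V)) → ℂ) :=
    { toFun := fun f s ↦ f fun i ↦ b (s i)
      map_add' := fun _ _ ↦ rfl
      map_smul' := fun _ _ ↦ rfl }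
  have hinj : LinearMap.ker ev = ⊥ := by
    refine LinearMap.ker_eq_bot.2 fun f g hfg ↦ ?_
    have : f.toMultilinearMap = g.toMultilinearMap :=
      Module.Basis.ext_multilinear (fun _ ↦ b) fun s ↦ congrFun hfg s
    ext v
    exact congrArg (fun F ↦ F v) this
  obtain ⟨L, hL⟩ := ev.exists_leftInverse_of_injective hinj
  exact ⟨Fin k → Fin (Module.finrank ℝ V), inferInstance, fun s i ↦ b (s i),
    LinearMap.toContinuousLinearMap L, fun f ↦ LinearMap.congr_fun hL f⟩

theorem contDiffAt_form_iff {N : WithTop ℕ∞} {f : E → V [⋀^Fin k]→L[ℝ] ℂ} {y : E} :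
    ContDiffAt ℝ N f y ↔ ∀ v, ContDiffAt ℝ N (fun z ↦ f z v) y := by
  constructor
  · intro h v
    exact (ContinuousAlternatingMap.apply ℝ V ℂ v).contDiff.contDiffAt.comp y h
  · intro h
    obtain ⟨ι, _, b, L, hL⟩ := exists_reconstruct V k
    have : f = fun z ↦ L (fun s ↦ f z (b s)) := by funext z; rw [hL]
    rw [this]
    exact L.contDiff.contDiffAt.comp y (contDiffAt_pi.2 fun s ↦ h _)

theorem differentiableAt_form_iff {f : E → V [⋀^Fin k]→L[ℝ] ℂ} {y : E} :
    DifferentiableAt ℝ f y ↔ ∀ v, DifferentiableAt ℝ (fun z ↦ f z v) y := by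
  constructor
  · intro h v
    exact (ContinuousAlternatingMap.apply ℝ V ℂ v).differentiableAt.comp y h
  · intro h
    obtain ⟨ι, _, b, L, hL⟩ := exists_reconstruct V k
    have : f = fun z ↦ L (fun s ↦ f z (b s)) := by funext z; rw [hL]
    rw [this]
    exact L.differentiableAt.comp y (differentiableAt_pi.2 fun s ↦ h _)

theorem continuous_form_iff {X : Type*} [TopologicalSpace X] {f : X → V [⋀^Fin k]→L[ℝ] ℂ} :
    Continuous f ↔ ∀ v, Continuous (fun z ↦ f z v) := by
  constructor
  · intro h v
    exact (ContinuousAlternatingMap.apply ℝ V ℂ v).continuous.comp h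
  · intro h
    obtain ⟨ι, _, b, L, hL⟩ := exists_reconstruct V k
    have : f = fun z ↦ L (fun s ↦ f z (b s)) := by funext z; rw [hL]
    rw [this]
    exact L.continuous.comp (continuous_pi fun s ↦ h _)

/-- The value of a smooth form on smooth vector fields is smooth. -/
theorem ContDiffAt.form_apply {W : Type*} [NormedAddCommGroup W] [NormedSpace ℝ W]
    {N : WithTop ℕ∞} {f : E → W [⋀^Fin k]→L[ℝ] ℂ} {v : E → Fin k → W} {y : E}
    (hf : ContDiffAt ℝ N f y) (hv : ∀ i, ContDiffAt ℝ N (fun z ↦ v z i) y) :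
    ContDiffAt ℝ N (fun z ↦ f z (v z)) y := by
  have hap := (ContinuousLinearMap.analyticOnNhd_uncurry_of_multilinear
    (ContinuousAlternatingMap.toContinuousMultilinearMapCLM ℝ :
      (W [⋀^Fin k]→L[ℝ] ℂ) →L[ℝ] _) (s := Set.univ)).contDiff (n := N)
  exact hap.contDiffAt.comp y (hf.prodMk (contDiffAt_pi.2 hv))

end FiniteDim

/-! ### Connection matrices on a vector space -/

section MatrixCalculus

variable {n : ℕ} {V : Type*} [NormedAddCommGroup V] [NormedSpace ℝ V]

/-- The entrywise derivative of a matrix-valued function in the direction `w`. -/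
noncomputable def dMat (X : V → Matrix (Fin n) (Fin n) ℂ) (y w : V) : Matrix (Fin n) (Fin n) ℂ :=
  Matrix.of fun i j ↦ fderiv ℝ (fun z ↦ X z i j) y w

/-- Entrywise differentiability of a matrix-valued function. -/
def MatDiffAt (X : V → Matrix (Fin n) (Fin n) ℂ) (y : V) : Prop :=
  ∀ i j, DifferentiableAt ℝ (fun z ↦ X z i j) y

theorem MatDiffAt.mul {X Y : V → Matrix (Fin n) (Fin n) ℂ} {y : V} (hX : MatDiffAt X y)
    (hY : MatDiffAt Y y) : MatDiffAt (fun z ↦ X z * Y z) y := fun i j ↦ by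
  simp only [Matrix.mul_apply]
  exact DifferentiableAt.fun_sum fun l _ ↦ (hX i l).mul (hY l j)

theorem MatDiffAt.sub {X Y : V → Matrix (Fin n) (Fin n) ℂ} {y : V} (hX : MatDiffAt X y)
    (hY : MatDiffAt Y y) : MatDiffAt (fun z ↦ X z - Y z) y := fun i j ↦ (hX i j).sub (hY i j)

theorem dMat_mul {X Y : V → Matrix (Fin n) (Fin n) ℂ} {y : V} (hX : MatDiffAt X y)
    (hY : MatDiffAt Y y) (w : V) :
    dMat (fun z ↦ X z * Y z) y w = dMat X y w * Y y + X y * dMat Y y w := by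
  ext i j
  simp only [dMat, Matrix.of_apply, Matrix.mul_apply, Matrix.add_apply]
  have hs := HasFDerivAt.fun_sum (u := Finset.univ) fun l _ ↦
    (hX i l).hasFDerivAt.mul (hY l j).hasFDerivAt
  have e : (∑ l, fderiv ℝ (fun z ↦ X z i l) y w * Y y l j) +
      ∑ l, X y i l * fderiv ℝ (fun z ↦ Y z l j) y w =
      ∑ l, (X y i l * fderiv ℝ (fun z ↦ Y z l j) y w +
        Y y l j * fderiv ℝ (fun z ↦ X z i l) y w) := by
    rw [← Finset.sum_add_distrib]
    exact Finset.sum_congr rfl fun l _ ↦ by ring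
  refine (congrArg (fun L ↦ L w) hs.fderiv).trans (Eq.trans ?_ e.symm)
  simp only [_root_.sum_apply]
  rfl

theorem dMat_add {X Y : V → Matrix (Fin n) (Fin n) ℂ} {y : V} (hX : MatDiffAt X y)
    (hY : MatDiffAt Y y) (w : V) :
    dMat (fun z ↦ X z + Y z) y w = dMat X y w + dMat Y y w := by
  ext i j
  have := fderiv_fun_add (hX i j) (hY i j)
  simp only [dMat, Matrix.of_apply, Matrix.add_apply, this, _root_.add_apply]

theorem dMat_sub {X Y : V → Matrix (Fin n) (Fin n) ℂ} {y : V} (hX : MatDiffAt X y)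
    (hY : MatDiffAt Y y) (w : V) :
    dMat (fun z ↦ X z - Y z) y w = dMat X y w - dMat Y y w := by
  ext i j
  have := fderiv_fun_sub (hX i j) (hY i j)
  simp only [dMat, Matrix.of_apply, Matrix.sub_apply, this, _root_.sub_apply]

theorem dMat_congr {X Y : V → Matrix (Fin n) (Fin n) ℂ} {y : V} (h : X =ᶠ[𝓝 y] Y) (w : V) :
    dMat X y w = dMat Y y w := by
  ext i j
  simp only [dMat, Matrix.of_apply]
  rw [Filter.EventuallyEq.fderiv_eq]
  exact h.mono fun z hz ↦ congrFun (congrFun hz i) j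

theorem fderiv_fderiv_comm {f : V → ℂ} {y : V} (hf : ContDiffAt ℝ 2 f y) (u v : V) :
    fderiv ℝ (fun z ↦ fderiv ℝ f z v) y u = fderiv ℝ (fun z ↦ fderiv ℝ f z u) y v := by
  have hd : DifferentiableAt ℝ (fderiv ℝ f) y :=
    (hf.fderiv_right (m := 1) (by norm_num)).differentiableAt one_ne_zero
  have hs := (hf.isSymmSndFDerivAt (by simp)).eq u v
  have h (w : V) : fderiv ℝ (fun z ↦ fderiv ℝ f z w) y = (fderiv ℝ (fderiv ℝ f) y).flip w := by
    ext x
    rw [fderiv_clm_apply hd (differentiableAt_const w)]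
    simp
  rw [h, h]
  exact hs

/-- Matrix-valued functions all of whose entries are smooth. -/
def MatSmoothAt (X : V → Matrix (Fin n) (Fin n) ℂ) (y : V) : Prop :=
  ∀ i j, ContDiffAt ℝ ∞ (fun z ↦ X z i j) y

theorem MatSmoothAt.matDiffAt {X : V → Matrix (Fin n) (Fin n) ℂ} {y : V} (h : MatSmoothAt X y) :
    MatDiffAt X y := fun i j ↦ (h i j).differentiableAt (by simp)

theorem MatSmoothAt.dMat {X : V → Matrix (Fin n) (Fin n) ℂ} {y : V} (h : MatSmoothAt X y) (w : V) :
    MatSmoothAt (fun z ↦ dMat X z w) y := fun i j ↦ by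
  have := ((h i j).fderiv_right (m := ∞) (by simp)).clm_apply (contDiffAt_const (c := w))
  exact this

theorem dMat_dMat_comm {X : V → Matrix (Fin n) (Fin n) ℂ} {y : V} (h : MatSmoothAt X y) (u v : V) :
    dMat (fun z ↦ dMat X z v) y u = dMat (fun z ↦ dMat X z u) y v := by
  ext i j
  exact fderiv_fderiv_comm ((h i j).of_le ENat.LEInfty.out) u v

end MatrixCalculus

section VectorSpace

variable {n : ℕ} {T : Type*} [AddCommGroup T] [Module ℝ T] [TopologicalSpace T]

/-- The matrix of values of a matrix of covectors at a vector. -/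
noncomputable def covMatrix (a : Fin n → Fin n → T →L[ℝ] ℂ) (v : T) : Matrix (Fin n) (Fin n) ℂ :=
  Matrix.of fun i j ↦ a i j v

variable {V : Type*} [NormedAddCommGroup V] [NormedSpace ℝ V]

/-- The curvature matrix `dθ + θ ∧ θ` of a matrix of `1`-forms on a vector space. -/
noncomputable def curvV (θ : V → Fin n → Fin n → V →L[ℝ] ℂ) (y : V) (i j : Fin n) :
    V [⋀^Fin 2]→L[ℝ] ℂ :=
  extDeriv (fun z ↦ oneForm (θ z i j)) y + ∑ l, wedge (θ y i l) (θ y l j)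

/-- Entrywise smoothness of a matrix of `1`-forms on a vector space. -/
def ConnSmoothAt (θ : V → Fin n → Fin n → V →L[ℝ] ℂ) (y : V) : Prop :=
  ∀ i j, ContDiffAt ℝ ∞ (fun z ↦ θ z i j) y

theorem ConnSmoothAt.matSmoothAt {θ : V → Fin n → Fin n → V →L[ℝ] ℂ} {y : V}
    (h : ConnSmoothAt θ y) (v : V) : MatSmoothAt (fun z ↦ covMatrix (θ z) v) y := fun i j ↦
  (h i j).clm_apply contDiffAt_const

/-- The covector `α` as a `1`-form depends linearly and continuously on `α`. -/
noncomputable def oneFormCLM (V : Type*) [NormedAddCommGroup V] [NormedSpace ℝ V] :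
    (V →L[ℝ] ℂ) →L[ℝ] V [⋀^Fin 1]→L[ℝ] ℂ :=
  ((ContinuousAlternatingMap.ofSubsingletonLIE (𝕜 := ℝ) (E := V) (F := ℂ) (0 : Fin 1)).toContinuousLinearEquiv :
    (V →L[ℝ] ℂ) →L[ℝ] V [⋀^Fin 1]→L[ℝ] ℂ)

theorem extDeriv_oneForm_apply {a : V → V →L[ℝ] ℂ} {y : V} (h : DifferentiableAt ℝ a y)
    (v : Fin 2 → V) :
    extDeriv (fun z ↦ oneForm (a z)) y v =
      fderiv ℝ (fun z ↦ a z (v 1)) y (v 0) - fderiv ℝ (fun z ↦ a z (v 0)) y (v 1) := by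
  have h' : DifferentiableAt ℝ (fun z ↦ oneForm (a z)) y :=
    (oneFormCLM V).differentiableAt.comp y h
  rw [extDeriv_apply h', Fin.sum_univ_two]
  simp [oneForm_apply, Fin.removeNth, Fin.tail, sub_eq_add_neg]

theorem formMatrix_curvV {θ : V → Fin n → Fin n → V →L[ℝ] ℂ} {y : V}
    (h : ∀ i j, DifferentiableAt ℝ (fun z ↦ θ z i j) y) (v : Fin 2 → V) :
    formMatrix (curvV θ y) v = dMat (fun z ↦ covMatrix (θ z) (v 1)) y (v 0) -
      dMat (fun z ↦ covMatrix (θ z) (v 0)) y (v 1) +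
      (covMatrix (θ y) (v 0) * covMatrix (θ y) (v 1) -
        covMatrix (θ y) (v 1) * covMatrix (θ y) (v 0)) := by
  ext i j
  simp only [formMatrix, Matrix.of_apply, curvV, ContinuousAlternatingMap.add_apply,
    ContinuousAlternatingMap.sum_apply, wedge_apply', Matrix.add_apply, Matrix.sub_apply,
    Matrix.mul_apply, dMat, covMatrix, Finset.sum_sub_distrib]
  rw [extDeriv_oneForm_apply (h i j)]

theorem ConnSmoothAt.eventually_differentiableAt {θ : V → Fin n → Fin n → V →L[ℝ] ℂ} {y : V}
    (h : ConnSmoothAt θ y) : ∀ᶠ z in 𝓝 y, ∀ i j, DifferentiableAt ℝ (fun z ↦ θ z i j) z :=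
  eventually_all.2 fun i ↦ eventually_all.2 fun j ↦
    (((h i j).of_le (ENat.LEInfty.out : (1 : WithTop ℕ∞) ≤ ∞)).eventually (by simp)).mono
      fun z hz ↦ hz.differentiableAt one_ne_zero

theorem MatSmoothAt.mul {X Y : V → Matrix (Fin n) (Fin n) ℂ} {y : V} (hX : MatSmoothAt X y)
    (hY : MatSmoothAt Y y) : MatSmoothAt (fun z ↦ X z * Y z) y := fun i j ↦ by
  simp only [Matrix.mul_apply]
  exact ContDiffAt.sum fun l _ ↦ (hX i l).mul (hY l j)

theorem ConnSmoothAt.formMatrix_curvV {θ : V → Fin n → Fin n → V →L[ℝ] ℂ} {y : V}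
    (h : ConnSmoothAt θ y) (v : Fin 2 → V) :
    MatSmoothAt (fun z ↦ formMatrix (curvV θ z) v) y := fun i j ↦ by
  have := (((((h.matSmoothAt (v 1)).dMat (v 0)) i j).sub
    (((h.matSmoothAt (v 0)).dMat (v 1)) i j))).add
    ((((h.matSmoothAt (v 0)).mul (h.matSmoothAt (v 1))) i j).sub
      (((h.matSmoothAt (v 1)).mul (h.matSmoothAt (v 0))) i j))
  refine this.congr_of_eventuallyEq ?_
  filter_upwards [h.eventually_differentiableAt] with z hz
  rw [OddChernWeil.formMatrix_curvV hz]
  rfl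

/-- The differential Bianchi identity, in its alternated form. -/
theorem bianchi {θ : V → Fin n → Fin n → V →L[ℝ] ℂ} {y : V} (h : ConnSmoothAt θ y)
    (D : V → V → V → Matrix (Fin n) (Fin n) ℂ)
    (hD : ∀ u v w, D u v w = dMat (fun z ↦ formMatrix (curvV θ z) ![v, w]) y u +
      (covMatrix (θ y) u * formMatrix (curvV θ y) ![v, w] -
        formMatrix (curvV θ y) ![v, w] * covMatrix (θ y) u)) (u v w : V) :
    D u v w + D v w u + D w u v = 0 := by
  have hd (u v w : V) : dMat (fun z ↦ formMatrix (curvV θ z) ![v, w]) y u =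
      dMat (fun z ↦ dMat (fun z ↦ covMatrix (θ z) w) z v) y u -
      dMat (fun z ↦ dMat (fun z ↦ covMatrix (θ z) v) z w) y u +
      ((dMat (fun z ↦ covMatrix (θ z) v) y u * covMatrix (θ y) w +
        covMatrix (θ y) v * dMat (fun z ↦ covMatrix (θ z) w) y u) -
      (dMat (fun z ↦ covMatrix (θ z) w) y u * covMatrix (θ y) v +
        covMatrix (θ y) w * dMat (fun z ↦ covMatrix (θ z) v) y u)) := by
    have e : (fun z ↦ formMatrix (curvV θ z) ![v, w]) =ᶠ[𝓝 y]
        fun z ↦ dMat (fun z ↦ covMatrix (θ z) w) z v - dMat (fun z ↦ covMatrix (θ z) v) z w +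
        (covMatrix (θ z) v * covMatrix (θ z) w - covMatrix (θ z) w * covMatrix (θ z) v) := by
      filter_upwards [h.eventually_differentiableAt] with z hz
      rw [OddChernWeil.formMatrix_curvV hz]
      rfl
    have hv := (h.matSmoothAt v).matDiffAt
    have hw := (h.matSmoothAt w).matDiffAt
    have hwv := ((h.matSmoothAt w).dMat v).matDiffAt
    have hvw := ((h.matSmoothAt v).dMat w).matDiffAt
    rw [dMat_congr e, dMat_add (hwv.sub hvw) ((hv.mul hw).sub (hw.mul hv)), dMat_sub hwv hvw,
      dMat_sub (hv.mul hw) (hw.mul hv), dMat_mul hv hw, dMat_mul hw hv]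
  simp only [hD, hd]
  rw [dMat_dMat_comm (h.matSmoothAt w) u v, dMat_dMat_comm (h.matSmoothAt v) u w,
    dMat_dMat_comm (h.matSmoothAt u) v w]
  simp only [OddChernWeil.formMatrix_curvV h.eventually_differentiableAt.self_of_nhds,
    Matrix.cons_val_zero, Matrix.cons_val_one]
  noncomm_ring

/-- The curvature is conjugated under a change of frame `g`, for which the connection matrices are
related by `g θ' = θ g + dg`. -/
theorem curvV_gauge {θ θ' : V → Fin n → Fin n → V →L[ℝ] ℂ} {y : V} (h : ConnSmoothAt θ y)
    (h' : ConnSmoothAt θ' y) {g : V → Matrix (Fin n) (Fin n) ℂ} (hg : MatSmoothAt g y)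
    (hrel : ∀ᶠ z in 𝓝 y, ∀ w, g z * covMatrix (θ' z) w = covMatrix (θ z) w * g z + dMat g z w)
    (v : Fin 2 → V) :
    g y * formMatrix (curvV θ' y) v = formMatrix (curvV θ y) v * g y := by
  have hd (v w : V) : dMat g y v * covMatrix (θ' y) w +
      g y * dMat (fun z ↦ covMatrix (θ' z) w) y v =
      dMat (fun z ↦ covMatrix (θ z) w) y v * g y + covMatrix (θ y) w * dMat g y v +
        dMat (fun z ↦ dMat g z w) y v := by
    have hw := (h.matSmoothAt w).matDiffAt
    have hw' := (h'.matSmoothAt w).matDiffAt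
    rw [← dMat_mul hg.matDiffAt hw', ← dMat_mul hw hg.matDiffAt,
      ← dMat_add (hw.mul hg.matDiffAt) (hg.dMat w).matDiffAt]
    exact dMat_congr (hrel.mono fun z hz ↦ hz w) v
  rw [formMatrix_curvV h.eventually_differentiableAt.self_of_nhds,
    formMatrix_curvV h'.eventually_differentiableAt.self_of_nhds]
  have h01 := hd (v 0) (v 1)
  have h10 := hd (v 1) (v 0)
  rw [dMat_dMat_comm hg] at h10
  have r0 := hrel.self_of_nhds (v 0)
  have r1 := hrel.self_of_nhds (v 1)
  set A0 := covMatrix (θ y) (v 0)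
  set A1 := covMatrix (θ y) (v 1)
  set A0' := covMatrix (θ' y) (v 0)
  set A1' := covMatrix (θ' y) (v 1)
  set G := g y
  set B01 := dMat (fun z ↦ covMatrix (θ z) (v 1)) y (v 0)
  set B10 := dMat (fun z ↦ covMatrix (θ z) (v 0)) y (v 1)
  set B01' := dMat (fun z ↦ covMatrix (θ' z) (v 1)) y (v 0)
  set B10' := dMat (fun z ↦ covMatrix (θ' z) (v 0)) y (v 1)
  set G0 := dMat g y (v 0)
  set G1 := dMat g y (v 1)
  have e1 : G * B01' - G * B10' = (B01 - B10) * G + A1 * G0 - A0 * G1 - G0 * A1' + G1 * A0' := by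
    have e01 := eq_sub_of_add_eq' h01
    have e10 := eq_sub_of_add_eq' h10
    rw [e01, e10]
    noncomm_ring
  have e2 : G * (A0' * A1' - A1' * A0') =
      A0 * (A1 * G + G1) - A1 * (A0 * G + G0) + G0 * A1' - G1 * A0' := by
    have e01 : G * A0' * A1' = A0 * (G * A1') + G0 * A1' := by rw [r0]; noncomm_ring
    have e10 : G * A1' * A0' = A1 * (G * A0') + G1 * A0' := by rw [r1]; noncomm_ring
    rw [mul_sub, ← mul_assoc, ← mul_assoc, e01, e10, r0, r1]
    noncomm_ring
  rw [mul_add, mul_sub, e1, e2]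
  noncomm_ring

/-- The derivative of a multilinear expression in matrices depending on a parameter. -/
theorem fderiv_multilinear {k : ℕ}
    (Q : ContinuousMultilinearMap ℂ (fun _ : Fin k ↦ (Fin n × Fin n → ℂ)) ℂ)
    {X : Fin k → V → Matrix (Fin n) (Fin n) ℂ} {y : V} (h : ∀ i, MatDiffAt (X i) y) (w : V) :
    DifferentiableAt ℝ (fun z ↦ Q fun i ↦ entries (X i z)) y ∧
    fderiv ℝ (fun z ↦ Q fun i ↦ entries (X i z)) y w =
      ∑ j, Q (Function.update (fun i ↦ entries (X i y)) j (entries (dMat (X j) y w))) := by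
  have h1 : HasFDerivAt (fun z i ab ↦ X i z ab.1 ab.2 : V → Fin k → Fin n × Fin n → ℂ)
      (ContinuousLinearMap.pi fun i ↦ ContinuousLinearMap.pi fun ab ↦
        fderiv ℝ (fun z ↦ X i z ab.1 ab.2) y) y :=
    hasFDerivAt_pi.2 fun i ↦ hasFDerivAt_pi.2 fun ab ↦ (h i ab.1 ab.2).hasFDerivAt
  have h2 := ((Q.hasFDerivAt (fun i ↦ entries (X i y))).restrictScalars ℝ).comp y h1
  refine ⟨h2.differentiableAt, (congrArg (fun L ↦ L w) h2.fderiv).trans ?_⟩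
  exact ContinuousMultilinearMap.linearDeriv_apply _ _ _

theorem contDiffAt_multilinear {k : ℕ} {N : WithTop ℕ∞}
    (Q : ContinuousMultilinearMap ℂ (fun _ : Fin k ↦ (Fin n × Fin n → ℂ)) ℂ)
    {X : Fin k → V → Matrix (Fin n) (Fin n) ℂ} {y : V}
    (h : ∀ i a b, ContDiffAt ℝ N (fun z ↦ X i z a b) y) :
    ContDiffAt ℝ N (fun z ↦ Q fun i ↦ entries (X i z)) y := by
  have h1 : ContDiffAt ℝ N (fun z i ab ↦ X i z ab.1 ab.2 : V → Fin k → Fin n × Fin n → ℂ) y :=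
    contDiffAt_pi.2 fun i ↦ contDiffAt_pi.2 fun ab ↦ h i ab.1 ab.2
  exact (Q.contDiff.restrict_scalars ℝ).contDiffAt.comp y h1

theorem contDiffAt_polyForm [FiniteDimensional ℝ V] {E : Type*} [NormedAddCommGroup E]
    [NormedSpace ℝ E] (P : MvPolynomial (Fin n × Fin n) ℂ) (k : ℕ) {N : WithTop ℕ∞}
    {Ω : E → Fin n → Fin n → V [⋀^Fin 2]→L[ℝ] ℂ} {y : E}
    (h : ∀ v i j, ContDiffAt ℝ N (fun z ↦ formMatrix (Ω z) v i j) y) :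
    ContDiffAt ℝ N (fun z ↦ polyForm P k (Ω z)) y := by
  refine contDiffAt_form_iff.2 fun v ↦ ?_
  simp only [polyForm_apply]
  exact contDiffAt_const.mul (ContDiffAt.sum fun σ _ ↦ contDiffAt_const.mul
    (contDiffAt_multilinear _ fun i a b ↦ h _ a b))

theorem contDiffAt_polyForm_curvV [FiniteDimensional ℝ V] (P : MvPolynomial (Fin n × Fin n) ℂ)
    (k : ℕ) {θ : V → Fin n → Fin n → V →L[ℝ] ℂ} {y : V} (h : ConnSmoothAt θ y) :
    ContDiffAt ℝ ∞ (fun z ↦ polyForm P k (curvV θ z)) y :=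
  contDiffAt_polyForm P k fun v i j ↦ h.formMatrix_curvV v i j

/-- An alternating form vanishes if it is a combination of functions whose alternation vanishes. -/
theorem alternating_eq_zero {N : ℕ} {ι : Type*} [Fintype ι] {T : Type*} [AddCommGroup T]
    [Module ℝ T] [TopologicalSpace T] (Φ : T [⋀^Fin N]→L[ℝ] ℂ) (c : ι → ℂ)
    (h : ι → (Fin N → T) → ℂ) (hΦ : ∀ v, Φ v = ∑ a, c a * h a v)
    (hh : ∀ a v, ∑ τ : Equiv.Perm (Fin N), ((Equiv.Perm.sign τ : ℤ) : ℂ) * h a (v ∘ τ) = 0) :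
    Φ = 0 := by
  ext v
  have h1 : ∑ τ : Equiv.Perm (Fin N), ((Equiv.Perm.sign τ : ℤ) : ℂ) * Φ (v ∘ τ) =
      (N.factorial : ℂ) * Φ v := by
    have (τ : Equiv.Perm (Fin N)) : ((Equiv.Perm.sign τ : ℤ) : ℂ) * Φ (v ∘ τ) = Φ v := by
      have := Φ.toAlternatingMap.map_perm v τ
      change Φ (v ∘ τ) = _ • Φ v at this
      rw [this, Units.smul_def, zsmul_eq_mul, ← mul_assoc, ← Int.cast_mul, ← Units.val_mul,
        Int.units_mul_self]
      simp
    simp [this, Fintype.card_perm]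
  have h2 : ∑ τ : Equiv.Perm (Fin N), ((Equiv.Perm.sign τ : ℤ) : ℂ) * Φ (v ∘ τ) = 0 := by
    simp only [hΦ, Finset.mul_sum]
    rw [Finset.sum_comm]
    refine Finset.sum_eq_zero fun a _ ↦ ?_
    rw [← mul_zero (c a), ← hh a v, Finset.mul_sum]
    exact Finset.sum_congr rfl fun τ _ ↦ by ring
  rw [h1] at h2
  simpa [Nat.factorial_ne_zero] using h2

/-- Chern-Weil forms are closed: by invariance the derivative may be replaced by the covariant
derivative of the curvature, whose alternation vanishes by the Bianchi identity. -/
theorem extDeriv_polyForm_curvV [FiniteDimensional ℝ V] {P : MvPolynomial (Fin n × Fin n) ℂ}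
    {k : ℕ} (hP : IsConjInvariant (polarization P k)) {θ : V → Fin n → Fin n → V →L[ℝ] ℂ} {y : V}
    (h : ConnSmoothAt θ y) : extDeriv (fun z ↦ polyForm P k (curvV θ z)) y = 0 := by
  set Q := polarization P k with hQ
  let D : V → V → V → Matrix (Fin n) (Fin n) ℂ := fun u v w ↦
    dMat (fun z ↦ formMatrix (curvV θ z) ![v, w]) y u +
      (covMatrix (θ y) u * formMatrix (curvV θ y) ![v, w] -
        formMatrix (curvV θ y) ![v, w] * covMatrix (θ y) u)
  have pair (f : Fin 2 → V) : f = ![f 0, f 1] := by ext i; fin_cases i <;> rfl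
  let s : Fin (2 * k + 1) → Equiv.Perm (Fin (2 * k)) → Fin k → Fin 2 → Fin (2 * k + 1) :=
    fun i σ j l ↦ i.succAbove (σ (pairEquiv k (j, l)))
  let H : (Fin (2 * k + 1) × Equiv.Perm (Fin (2 * k)) × Fin k) → (Fin (2 * k + 1) → V) → ℂ :=
    fun a v ↦ Q (Function.update
      (fun i' ↦ entries (formMatrix (curvV θ y) ![v (s a.1 a.2.1 i' 0), v (s a.1 a.2.1 i' 1)]))
      a.2.2 (entries (D (v a.1) (v (s a.1 a.2.1 a.2.2 0)) (v (s a.1 a.2.1 a.2.2 1)))))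
  have hder (u : Fin (2 * k) → V) (w : V) : fderiv ℝ (fun z ↦ polyForm P k (curvV θ z) u) y w =
      ((2 : ℂ) ^ k)⁻¹ * ∑ σ : Equiv.Perm (Fin (2 * k)), ((Equiv.Perm.sign σ : ℤ) : ℂ) *
        ∑ j, Q (Function.update
          (fun i ↦ entries (formMatrix (curvV θ y)
            ![u (σ (pairEquiv k (i, 0))), u (σ (pairEquiv k (i, 1)))]))
          j (entries (D w (u (σ (pairEquiv k (j, 0)))) (u (σ (pairEquiv k (j, 1))))))) := by
    have hm (σ : Equiv.Perm (Fin (2 * k))) := fderiv_multilinear Q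
      (X := fun i z ↦ formMatrix (curvV θ z)
            ![u (σ (pairEquiv k (i, 0))), u (σ (pairEquiv k (i, 1)))]) (y := y)
      (fun i ↦ (h.formMatrix_curvV _).matDiffAt) w
    have hfun : (fun z ↦ polyForm P k (curvV θ z) u) = fun z ↦ ((2 : ℂ) ^ k)⁻¹ *
        ∑ σ : Equiv.Perm (Fin (2 * k)), ((Equiv.Perm.sign σ : ℤ) : ℂ) *
          Q fun i ↦ entries (formMatrix (curvV θ z)
            ![u (σ (pairEquiv k (i, 0))), u (σ (pairEquiv k (i, 1)))]) := by
      funext z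
      rw [polyForm_apply]
      congr 1
      refine Finset.sum_congr rfl fun σ _ ↦ ?_
      congr 2
      funext i
      rw [pair fun j ↦ u (σ (pairEquiv k (i, j)))]
    have hs := (HasFDerivAt.fun_sum (u := Finset.univ)
      fun σ _ ↦ ((hm σ).1.hasFDerivAt.const_mul ((Equiv.Perm.sign σ : ℤ) : ℂ))).const_mul
        ((2 : ℂ) ^ k)⁻¹
    rw [hfun, hs.fderiv]
    simp only [_root_.smul_apply, _root_.sum_apply, smul_eq_mul]
    congr 1
    refine Finset.sum_congr rfl fun σ _ ↦ ?_
    congr 1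
    rw [(hm σ).2]
    have hc := hP.sum_commutator (fun i ↦ formMatrix (curvV θ y)
            ![u (σ (pairEquiv k (i, 0))), u (σ (pairEquiv k (i, 1)))]) (covMatrix (θ y) w)
    rw [← add_zero (∑ j, _), ← hc, ← Finset.sum_add_distrib]
    refine Finset.sum_congr rfl fun j _ ↦ ?_
    exact (Q.map_update_add _ j _ _).symm
  have hdiff : DifferentiableAt ℝ (fun z ↦ polyForm P k (curvV θ z)) y :=
    (contDiffAt_polyForm_curvV P k h).differentiableAt (by simp)
  refine alternating_eq_zero _
    (fun a ↦ (-1) ^ (a.1 : ℕ) * ((2 : ℂ) ^ k)⁻¹ * ((Equiv.Perm.sign a.2.1 : ℤ) : ℂ)) H ?_ ?_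
  · intro v
    rw [extDeriv_apply hdiff, Fintype.sum_prod_type]
    refine Finset.sum_congr rfl fun i _ ↦ ?_
    rw [hder, Fintype.sum_prod_type, zsmul_eq_mul, ← mul_assoc, Finset.mul_sum]
    refine Finset.sum_congr rfl fun σ _ ↦ ?_
    rw [← mul_assoc, Finset.mul_sum]
    refine Finset.sum_congr rfl fun j _ ↦ ?_
    push_cast
    rfl
  · rintro ⟨i, σ, j⟩ v
    have inj : ∀ a b c d, s i σ a b = s i σ c d → a = c ∧ b = d := fun a b c d e ↦ by
      have := (pairEquiv k).injective (σ.injective (Fin.succAbove_right_injective e))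
      exact Prod.mk.inj this
    have hne : ∀ a b, s i σ a b ≠ i := fun a b ↦ Fin.succAbove_ne i _
    set p := s i σ j 0 with hp
    set q := s i σ j 1 with hq
    have hpi : p ≠ i := hne j 0
    have hqi : q ≠ i := hne j 1
    have hpq : p ≠ q := fun e ↦ by simpa using (inj _ _ _ _ e).2
    -- `ρ` is the cycle `i ↦ p ↦ q ↦ i` of the derivative slot and the slots of the factor `j`;
    -- the Bianchi identity says that the sum over its powers vanishes
    let ρ : Equiv.Perm (Fin (2 * k + 1)) := Equiv.swap i p * Equiv.swap p q
    have r1 : ρ i = p := by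
      simp [ρ, Equiv.swap_apply_of_ne_of_ne hpi.symm hqi.symm]
    have r2 : ρ p = q := by
      simp [ρ, Equiv.swap_apply_of_ne_of_ne hqi hpq.symm]
    have r3 : ρ q = i := by simp [ρ]
    have r4 : ∀ a, a ≠ i → a ≠ p → a ≠ q → ρ a = a := fun a h1 h2 h3 ↦ by
      simp [ρ, Equiv.swap_apply_of_ne_of_ne h2 h3, Equiv.swap_apply_of_ne_of_ne h1 h2]
    refine sum_sign_eq_zero_of_cycle (H (i, σ, j)) ρ ?_ ?_ v
    · simp [ρ, Equiv.Perm.sign_swap hpi.symm, Equiv.Perm.sign_swap hpq]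
    · intro v
      have fixed : ∀ i' l, i' ≠ j → ρ (s i σ i' l) = s i σ i' l := fun i' l hi ↦
        r4 _ (hne _ _) (fun e ↦ hi (inj _ _ _ _ e).1) (fun e ↦ hi (inj _ _ _ _ e).1)
      have hH : ∀ w : Fin (2 * k + 1) → V, (∀ i' l, i' ≠ j → w (s i σ i' l) = v (s i σ i' l)) →
          H (i, σ, j) w = Q (Function.update (fun i' ↦ entries (formMatrix (curvV θ y)
            ![v (s i σ i' 0), v (s i σ i' 1)])) j (entries (D (w i) (w p) (w q)))) := by
        intro w hw
        simp only [H]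
        congr 1
        funext i'
        by_cases hi : i' = j
        · subst hi; simp [hp, hq]
        · rw [Function.update_of_ne hi, Function.update_of_ne hi, hw _ _ hi, hw _ _ hi]
      rw [hH v fun _ _ _ ↦ rfl, hH (v ∘ ρ) fun i' l hi ↦ by simp [fixed i' l hi],
        hH (v ∘ ⇑(ρ * ρ)) fun i' l hi ↦ by simp [fixed i' l hi]]
      simp only [Function.comp_apply, Equiv.Perm.coe_mul, r1, r2, r3]
      rw [← Q.map_update_add, ← Q.map_update_add]
      have hb := bianchi h D (fun _ _ _ ↦ rfl) (v i) (v p) (v q)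
      have : entries (D (v i) (v p) (v q)) + entries (D (v p) (v q) (v i)) +
          entries (D (v q) (v i) (v p)) = 0 := by
        have := congrArg entries hb
        exact this
      rw [this]
      exact Q.toMultilinearMap.map_coord_zero j (by simp)

end VectorSpace

/-! ### Forms on manifolds in charts, pullback and exterior derivative -/

section FormsOnManifolds

variable {V : Type*} [NormedAddCommGroup V] [NormedSpace ℝ V]
  {H : Type*} [TopologicalSpace H] {I : ModelWithCorners ℝ V H}
  {M : Type*} [TopologicalSpace M] [ChartedSpace H M]
  {V' : Type*} [NormedAddCommGroup V'] [NormedSpace ℝ V']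
  {H' : Type*} [TopologicalSpace H'] {I' : ModelWithCorners ℝ V' H'}
  {M' : Type*} [TopologicalSpace M'] [ChartedSpace H' M']
  {V'' : Type*} [NormedAddCommGroup V''] [NormedSpace ℝ V'']
  {H'' : Type*} [TopologicalSpace H''] {I'' : ModelWithCorners ℝ V'' H''}
  {M'' : Type*} [TopologicalSpace M''] [ChartedSpace H'' M'']
  {k : ℕ}

theorem formPullback_congr {f g : M' → M} {x : M'} (h : f =ᶠ[𝓝 x] g) (α : DiffForm I M k) :
    formPullback I' f α x = formPullback I' g α x := by
  have h1 : f x = g x := h.self_of_nhds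
  have h2 : (mfderiv I' I f x : V' →L[ℝ] V) = mfderiv I' I g x := h.mfderiv_eq
  have h3 : (α (f x) : V [⋀^Fin k]→L[ℝ] ℂ) = α (g x) :=
    @congrArg M (V [⋀^Fin k]→L[ℝ] ℂ) (f x) (g x) (fun p ↦ α p) h1
  exact congrArg₂ (fun (A : V [⋀^Fin k]→L[ℝ] ℂ) (L : V' →L[ℝ] V) ↦
    A.compContinuousLinearMap L) h3 h2

theorem formPullback_comp {f : M' → M} {g : M'' → M'} {x : M''}
    (hf : MDifferentiableAt I' I f (g x)) (hg : MDifferentiableAt I'' I' g x)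
    (α : DiffForm I M k) :
    formPullback I'' (f ∘ g) α x = formPullback I'' g (formPullback I' f α) x := by
  ext v
  simp only [formPullback, mfderiv_comp x hf hg]
  rfl

variable [I.Boundaryless] [I'.Boundaryless]

theorem inChart_eq_formPullback (α : DiffForm I M k) (x₀ : M) :
    inChart α x₀ = formPullback 𝓘(ℝ, V) (extChartAt I x₀).symm α := by
  funext y
  simp only [inChart, formPullback, I.range_eq_univ, mfderivWithin_univ]
  rfl

theorem extD_eq (α : DiffForm I M k) (x : M) :
    extD α x = (extDeriv (inChart α x) (extChartAt I x x)).compContinuousLinearMap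
      (mfderiv I 𝓘(ℝ, V) (extChartAt I x) x) := by
  simp only [extD, I.range_eq_univ, extDerivWithin_univ]

theorem inChart_vectorSpace (α : DiffForm 𝓘(ℝ, V) V k) (y : V) : inChart α y = α := by
  funext z
  rw [inChart_eq_formPullback]
  have : ((extChartAt 𝓘(ℝ, V) y).symm : V → V) = id := by simp; rfl
  rw [this]
  simp only [formPullback, id, mfderiv_id]
  ext v
  rfl

theorem extD_vectorSpace (α : DiffForm 𝓘(ℝ, V) V k) (y : V) : extD α y = extDeriv α y := by
  rw [extD_eq, inChart_vectorSpace]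
  have : (extChartAt 𝓘(ℝ, V) y : V → V) = id := by simp; rfl
  rw [this, mfderiv_id]
  ext v
  rfl

/-- Smoothness of a form at a point, tested in the preferred chart there. -/
def SmoothFormAt (α : DiffForm I M k) (x : M) : Prop :=
  ContDiffAt ℝ ∞ (inChart α x) (extChartAt I x x)

theorem extD_congr {α β : DiffForm I M k} {x : M} (h : ∀ᶠ y in 𝓝 x, α y = β y) :
    extD α x = extD β x := by
  rw [extD_eq, extD_eq, Filter.EventuallyEq.extDeriv_eq]
  have := (continuousAt_extChartAt_symm (I := I) x).eventually
    (by rwa [extChartAt_to_inv] : ∀ᶠ y in 𝓝 _, α y = β y)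
  filter_upwards [this] with y hy
  simp only [inChart, hy]

omit [I.Boundaryless] in
theorem SmoothFormAt.congr {α β : DiffForm I M k} {x : M} (h : ∀ᶠ y in 𝓝 x, α y = β y)
    (hβ : SmoothFormAt β x) : SmoothFormAt α x := by
  refine ContDiffAt.congr_of_eventuallyEq hβ ?_
  have := (continuousAt_extChartAt_symm (I := I) x).eventually
    (by rwa [extChartAt_to_inv] : ∀ᶠ y in 𝓝 _, α y = β y)
  filter_upwards [this] with y hy
  simp only [inChart, hy]

theorem smoothFormAt_vectorSpace {α : V → V [⋀^Fin k]→L[ℝ] ℂ} {y : V} :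
    SmoothFormAt (I := 𝓘(ℝ, V)) (M := V) α y ↔ ContDiffAt ℝ ∞ α y := by
  have h : extChartAt 𝓘(ℝ, V) y y = y := by simp; rfl
  exact iff_of_eq (congrArg₂ (fun (F : V → V [⋀^Fin k]→L[ℝ] ℂ) p ↦ ContDiffAt ℝ ∞ F p)
    (inChart_vectorSpace (V := V) α y) h)

variable [IsManifold I ∞ M] [IsManifold I' ∞ M']

omit [I.Boundaryless] in
theorem extChartAt_contMDiffAt {x₀ x : M} (hx : x ∈ (extChartAt I x₀).source) :
    ContMDiffAt I 𝓘(ℝ, V) ∞ (extChartAt I x₀) x :=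
  contMDiffAt_extChartAt' (by rwa [extChartAt_source] at hx)

theorem extChartAt_symm_contMDiffAt {x₀ : M} {y : V} (hy : y ∈ (extChartAt I x₀).target) :
    ContMDiffAt 𝓘(ℝ, V) I ∞ (extChartAt I x₀).symm y :=
  (contMDiffOn_extChartAt_symm x₀).contMDiffAt ((isOpen_extChartAt_target x₀).mem_nhds hy)

omit [I.Boundaryless] [I'.Boundaryless] in
theorem ContMDiffAt.eventually_mdifferentiableAt {f : M' → M} {x : M'}
    (hf : ContMDiffAt I' I ∞ f x) : ∀ᶠ y in 𝓝 x, MDifferentiableAt I' I f y := by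
  have h1 : ContMDiffAt I' I 1 f x := hf.of_le ENat.LEInfty.out
  exact ((contMDiffAt_iff_contMDiffAt_nhds (by simp)).1 h1).mono fun y hy ↦ hy.mdifferentiableAt one_ne_zero

omit [I.Boundaryless] [IsManifold I ∞ M] [IsManifold I' ∞ M'] in
theorem contDiffAt_writtenInExtChartAt {f : M' → M} {x : M'} (hf : ContMDiffAt I' I ∞ f x) :
    ContDiffAt ℝ ∞ (writtenInExtChartAt I' I x f) (extChartAt I' x x) := by
  have := (contMDiffAt_iff.1 hf).2
  rwa [I'.range_eq_univ, contDiffWithinAt_univ] at this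

/-- The chart expression of a pulled back form is the pullback of the chart expression. -/
theorem inChart_formPullback {f : M' → M} {x : M'} (hf : ContMDiffAt I' I ∞ f x)
    (α : DiffForm I M k) : ∀ᶠ y in 𝓝 (extChartAt I' x x),
      inChart (formPullback I' f α) x y =
        (inChart α (f x) (writtenInExtChartAt I' I x f y)).compContinuousLinearMap
          (fderiv ℝ (writtenInExtChartAt I' I x f) y) := by
  have hc : ContinuousAt (extChartAt I' x).symm (extChartAt I' x x) :=
    continuousAt_extChartAt_symm x
  have e : (extChartAt I' x).symm (extChartAt I' x x) = x := extChartAt_to_inv x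
  have h1 : ∀ᶠ y in 𝓝 (extChartAt I' x x), MDifferentiableAt I' I f ((extChartAt I' x).symm y) :=
    hc.eventually (by rw [e]; exact ContMDiffAt.eventually_mdifferentiableAt hf)
  have h2 : ∀ᶠ y in 𝓝 (extChartAt I' x x), y ∈ (extChartAt I' x).target :=
    extChartAt_target_mem_nhds x
  have h3 : ∀ᶠ y in 𝓝 (extChartAt I' x x),
      f ((extChartAt I' x).symm y) ∈ (extChartAt I (f x)).source := by
    have : ContinuousAt (f ∘ (extChartAt I' x).symm) (extChartAt I' x x) :=
      ContinuousAt.comp (by rw [e]; exact hf.continuousAt) hc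
    refine this.eventually_mem ?_
    simp only [Function.comp_apply, e]
    exact extChartAt_source_mem_nhds (f x)
  filter_upwards [h1, h2, h3.eventually_nhds, h3] with y hy1 hy2 hy3 hy4
  rw [inChart_eq_formPullback, inChart_eq_formPullback]
  have d1 : MDifferentiableAt 𝓘(ℝ, V') I' (extChartAt I' x).symm y :=
    (extChartAt_symm_contMDiffAt hy2).mdifferentiableAt (by simp)
  rw [← formPullback_comp hy1 d1]
  have hφ : MDifferentiableAt 𝓘(ℝ, V') 𝓘(ℝ, V) (writtenInExtChartAt I' I x f) y := by
    have := ((extChartAt_contMDiffAt (I := I) hy4).mdifferentiableAt (by simp)).comp y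
      (hy1.comp y d1)
    exact this
  have hs : MDifferentiableAt 𝓘(ℝ, V) I (extChartAt I (f x)).symm
      (writtenInExtChartAt I' I x f y) :=
    (extChartAt_symm_contMDiffAt ((extChartAt I (f x)).map_source hy4)).mdifferentiableAt (by simp)
  have key := formPullback_comp hs hφ α
  rw [← mfderiv_eq_fderiv]
  refine Eq.trans ?_ key
  refine formPullback_congr ?_ α
  filter_upwards [hy3] with z hz
  simp only [Function.comp_apply, writtenInExtChartAt]
  exact ((extChartAt I (f x)).left_inv hz).symm

theorem SmoothFormAt.formPullback [FiniteDimensional ℝ V'] {f : M' → M} {x : M'}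
    (hf : ContMDiffAt I' I ∞ f x) {α : DiffForm I M k} (hα : SmoothFormAt α (f x)) :
    SmoothFormAt (formPullback I' f α) x := by
  refine ContDiffAt.congr_of_eventuallyEq ?_ (inChart_formPullback hf α)
  refine (contDiffAt_form_iff (V := V')).2 fun v ↦ ?_
  have hw := contDiffAt_writtenInExtChartAt hf
  have hp : writtenInExtChartAt I' I x f (extChartAt I' x x) = extChartAt I (f x) (f x) := by
    simp [writtenInExtChartAt]
  have h1 : ContDiffAt ℝ ∞ (fun y ↦ inChart α (f x) (writtenInExtChartAt I' I x f y))
      (extChartAt I' x x) :=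
    ContDiffAt.comp (F := V) (g := inChart α (f x)) (extChartAt I' x x) (by rw [hp]; exact hα) hw
  have h2 (i : Fin k) : ContDiffAt ℝ ∞
      (fun y ↦ fderiv ℝ (writtenInExtChartAt I' I x f) y (v i : V')) (extChartAt I' x x) :=
    (hw.fderiv_right (m := ∞) (by simp)).clm_apply contDiffAt_const
  exact h1.form_apply h2

/-- The exterior derivative commutes with pullback, by the corresponding statement for the
expressions in charts. -/
theorem extD_formPullback {f : M' → M} {x : M'}
    (hf : ContMDiffAt I' I ∞ f x) {α : DiffForm I M k} (hα : SmoothFormAt α (f x)) :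
    extD (formPullback I' f α) x = formPullback I' f (extD α) x := by
  have hw := contDiffAt_writtenInExtChartAt hf
  have hp : writtenInExtChartAt I' I x f (extChartAt I' x x) = extChartAt I (f x) (f x) := by
    simp [writtenInExtChartAt]
  have hpull : extDeriv (fun z ↦ (inChart α (f x) (writtenInExtChartAt I' I x f z)
      ).compContinuousLinearMap (fderiv ℝ (writtenInExtChartAt I' I x f) z)) (extChartAt I' x x) =
      _ := extDeriv_pullback (r := ∞)
    (by rw [hp]; exact ContDiffAt.differentiableAt hα (by simp)) hw
      (by rw [minSmoothness_of_isRCLikeNormedField]; exact ENat.LEInfty.out)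
  rw [extD_eq, Filter.EventuallyEq.extDeriv_eq (inChart_formPullback hf α), hpull, hp]
  have hfd : MDifferentiableAt I' I f x := hf.mdifferentiableAt (by simp)
  have hc : mfderiv I' 𝓘(ℝ, V) (extChartAt I (f x) ∘ f) x =
      (mfderiv I 𝓘(ℝ, V) (extChartAt I (f x)) (f x)).comp (mfderiv I' I f x) :=
    mfderiv_comp x ((contMDiffAt_extChartAt (n := ∞)).mdifferentiableAt (by simp)) hfd
  have hc' : mfderiv I' 𝓘(ℝ, V) (writtenInExtChartAt I' I x f ∘ extChartAt I' x) x =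
      (fderiv ℝ (writtenInExtChartAt I' I x f) (extChartAt I' x x)).comp
        (mfderiv I' 𝓘(ℝ, V') (extChartAt I' x) x) := by
    rw [← mfderiv_eq_fderiv]
    exact mfderiv_comp x (hw.contMDiffAt.mdifferentiableAt (by simp))
      ((contMDiffAt_extChartAt (n := ∞)).mdifferentiableAt (by simp))
  have heq : extChartAt I (f x) ∘ f =ᶠ[𝓝 x] writtenInExtChartAt I' I x f ∘ extChartAt I' x := by
    filter_upwards [extChartAt_source_mem_nhds (I := I') x] with z hz
    simp only [Function.comp_apply, writtenInExtChartAt, (extChartAt I' x).left_inv hz]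
  have hm := heq.mfderiv_eq (I := I') (I' := 𝓘(ℝ, V))
  have hm' : (fderiv ℝ (writtenInExtChartAt I' I x f) (extChartAt I' x x)).comp
        (mfderiv I' 𝓘(ℝ, V') (extChartAt I' x) x : V' →L[ℝ] V') =
      ((mfderiv I 𝓘(ℝ, V) (extChartAt I (f x)) (f x)).comp (mfderiv I' I f x) : V' →L[ℝ] V) :=
    hc'.symm.trans (hm.symm.trans hc)
  rw [formPullback, extD_eq]
  exact congrArg (fun L : V' →L[ℝ] V ↦
    (extDeriv (inChart α (f x)) (extChartAt I (f x) (f x))).compContinuousLinearMap L) hm'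

theorem SmoothFormAt.contDiffAt_inChart [FiniteDimensional ℝ V] {α : DiffForm I M k} {x₀ : M}
    {y : V} (hy : y ∈ (extChartAt I x₀).target) (hα : SmoothFormAt α ((extChartAt I x₀).symm y)) :
    ContDiffAt ℝ ∞ (inChart α x₀) y := by
  rw [inChart_eq_formPullback]
  exact smoothFormAt_vectorSpace.1 (SmoothFormAt.formPullback (extChartAt_symm_contMDiffAt hy) hα)

theorem isSmoothForm_of_smoothFormAt [FiniteDimensional ℝ V] {α : DiffForm I M k}
    (h : ∀ x, SmoothFormAt α x) : IsSmoothForm α := fun _ _ hy ↦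
  ((h _).contDiffAt_inChart hy).contDiffWithinAt

theorem inChart_extD {α : DiffForm I M k} {x₀ : M} {y : V}
    (hy : y ∈ (extChartAt I x₀).target) (hα : SmoothFormAt α ((extChartAt I x₀).symm y)) :
    inChart (extD α) x₀ y = extDeriv (inChart α x₀) y := by
  rw [inChart_eq_formPullback, ← extD_formPullback (extChartAt_symm_contMDiffAt hy) hα,
    extD_vectorSpace, inChart_eq_formPullback]

end FormsOnManifolds

/-! ### Chern-Weil forms of connection matrices on a manifold -/

section LocalCurvature

variable {V : Type*} [NormedAddCommGroup V] [NormedSpace ℝ V]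
  {H : Type*} [TopologicalSpace H] {I : ModelWithCorners ℝ V H}
  {M : Type*} [TopologicalSpace M] [ChartedSpace H M]
  {V' : Type*} [NormedAddCommGroup V'] [NormedSpace ℝ V']
  {H' : Type*} [TopologicalSpace H'] {I' : ModelWithCorners ℝ V' H'}
  {M' : Type*} [TopologicalSpace M'] [ChartedSpace H' M']
  {n : ℕ}

variable (I M n) in
/-- A matrix of complex-valued covector fields on `M`: the connection matrix of a connection in a
local frame, with junk values outside of the domain of the frame. -/
abbrev MatCov : Type _ := ∀ x : M, Fin n → Fin n → TangentSpace I x →L[ℝ] ℂ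

/-- The curvature matrix `da + a ∧ a`. -/
noncomputable def curvForm (a : MatCov I M n) (x : M) (i j : Fin n) :
    TangentSpace I x [⋀^Fin 2]→L[ℝ] ℂ :=
  extD (fun y ↦ oneForm (a y i j)) x + ∑ l, wedge (a x i l) (a x l j)

/-- The pullback of a matrix of covector fields. -/
noncomputable def covPullback (I' : ModelWithCorners ℝ V' H') (f : M' → M) (a : MatCov I M n) :
    MatCov I' M' n := fun x i j ↦ (a (f x) i j).comp (mfderiv I' I f x)

/-- Smoothness of the entries of a matrix of covector fields at a point. -/
def SmoothCovAt (a : MatCov I M n) (x : M) : Prop :=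
  ∀ i j, SmoothFormAt (fun y ↦ oneForm (a y i j)) x

/-- The invariant polynomial of degree `k` in the curvature of a matrix of covector fields. -/
noncomputable def cwForm (P : MvPolynomial (Fin n × Fin n) ℂ) (k : ℕ) (a : MatCov I M n) :
    DiffForm I M (2 * k) := fun x ↦ polyForm P k (curvForm a x)

theorem oneForm_covPullback (f : M' → M) (a : MatCov I M n) (i j : Fin n) :
    (fun x ↦ oneForm (covPullback I' f a x i j)) =
      formPullback I' f (fun y ↦ oneForm (a y i j)) := rfl

theorem curvForm_congr {a b : MatCov I M n} {x : M} [I.Boundaryless]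
    (h : ∀ᶠ y in 𝓝 x, a y = b y) : curvForm a x = curvForm b x := by
  funext i j
  rw [curvForm, curvForm, extD_congr (h.mono fun y hy ↦ by rw [hy]), h.self_of_nhds]

theorem cwForm_congr {a b : MatCov I M n} {x : M} [I.Boundaryless]
    (P : MvPolynomial (Fin n × Fin n) ℂ) (k : ℕ)
    (h : ∀ᶠ y in 𝓝 x, a y = b y) : cwForm P k a x = cwForm P k b x := by
  rw [cwForm, cwForm, curvForm_congr h]

theorem SmoothCovAt.congr {a b : MatCov I M n} {x : M}
    (h : ∀ᶠ y in 𝓝 x, a y = b y) (hb : SmoothCovAt b x) : SmoothCovAt a x := fun i j ↦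
  (hb i j).congr (h.mono fun y hy ↦ by rw [hy])

variable [I.Boundaryless] [I'.Boundaryless]

theorem curvForm_vectorSpace (a : MatCov 𝓘(ℝ, V) V n) (y : V) :
    curvForm a y = curvV a y := by
  funext i j
  rw [curvForm, extD_vectorSpace]
  rfl

theorem smoothCovAt_vectorSpace {a : V → Fin n → Fin n → V →L[ℝ] ℂ} {y : V} :
    SmoothCovAt (I := 𝓘(ℝ, V)) (M := V) a y ↔ ConnSmoothAt a y := by
  refine forall_congr' fun i ↦ forall_congr' fun j ↦ ?_
  refine Iff.trans (smoothFormAt_vectorSpace (α := fun y ↦ oneForm (a y i j))) ?_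
  constructor
  · intro h
    exact ((ContinuousAlternatingMap.ofSubsingletonLIE (𝕜 := ℝ) (E := V) (F := ℂ)
      (0 : Fin 1)).symm.toContinuousLinearEquiv.contDiff.contDiffAt.comp y h)
  · intro h
    exact (oneFormCLM V).contDiff.contDiffAt.comp y h

variable [IsManifold I ∞ M] [IsManifold I' ∞ M']

theorem SmoothCovAt.covPullback [FiniteDimensional ℝ V'] {f : M' → M} {x : M'}
    (hf : ContMDiffAt I' I ∞ f x) {a : MatCov I M n} (ha : SmoothCovAt a (f x)) :
    SmoothCovAt (covPullback I' f a) x := fun i j ↦ (ha i j).formPullback hf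

theorem curvForm_covPullback {f : M' → M} {x : M'}
    (hf : ContMDiffAt I' I ∞ f x) {a : MatCov I M n} (ha : SmoothCovAt a (f x)) (i j : Fin n) :
    curvForm (covPullback I' f a) x i j =
      (curvForm a (f x) i j).compContinuousLinearMap (mfderiv I' I f x) := by
  ext v
  rw [curvForm, curvForm, oneForm_covPullback, extD_formPullback hf (ha i j)]
  simp only [ContinuousAlternatingMap.add_apply, ContinuousAlternatingMap.sum_apply, wedge_apply',
    ContinuousAlternatingMap.compContinuousLinearMap_apply]
  rfl

theorem cwForm_covPullback (P : MvPolynomial (Fin n × Fin n) ℂ) (k : ℕ) {f : M' → M} {x : M'}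
    (hf : ContMDiffAt I' I ∞ f x) {a : MatCov I M n} (ha : SmoothCovAt a (f x)) :
    cwForm P k (covPullback I' f a) x = formPullback I' f (cwForm P k a) x := by
  rw [formPullback, cwForm, cwForm, polyForm_compContinuousLinearMap]
  congr 1
  funext i j
  exact curvForm_covPullback hf ha i j

variable [FiniteDimensional ℝ V]

omit [IsManifold I ∞ M] [FiniteDimensional ℝ V] in
theorem eventually_symm {p : M → Prop} {x : M} (h : ∀ᶠ z in 𝓝 x, p z) :
    ∀ᶠ y in 𝓝 (extChartAt I x x), y ∈ (extChartAt I x).target ∧ p ((extChartAt I x).symm y) := by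
  have hc : ContinuousAt (extChartAt I x).symm (extChartAt I x x) :=
    continuousAt_extChartAt_symm x
  have e : (extChartAt I x).symm (extChartAt I x x) = x := extChartAt_to_inv x
  exact (show ∀ᶠ y in 𝓝 (extChartAt I x x), y ∈ (extChartAt I x).target from
    extChartAt_target_mem_nhds x).and (hc.eventually (by rwa [e]))

omit [FiniteDimensional ℝ V] in
/-- In a chart, Chern-Weil forms are given by the connection matrix in this chart. -/
theorem inChart_cwForm (P : MvPolynomial (Fin n × Fin n) ℂ) (k : ℕ) {a : MatCov I M n} {x : M}
    (ha : ∀ᶠ z in 𝓝 x, SmoothCovAt a z) :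
    ∀ᶠ y in 𝓝 (extChartAt I x x), inChart (cwForm P k a) x y =
      polyForm P k (curvV (covPullback 𝓘(ℝ, V) (extChartAt I x).symm a) y) := by
  filter_upwards [eventually_symm (I := I) ha] with y hy
  rw [inChart_eq_formPullback, ← cwForm_covPullback P k (extChartAt_symm_contMDiffAt hy.1) hy.2,
    cwForm, curvForm_vectorSpace]
  rfl

omit [IsManifold I ∞ M] [FiniteDimensional ℝ V] [I.Boundaryless] in
theorem symm_extChartAt_self (x : M) : (extChartAt I x).symm (extChartAt I x x) = x :=
  extChartAt_to_inv x

theorem connSmoothAt_chart {a : MatCov I M n} {x : M} (ha : SmoothCovAt a x) :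
    ConnSmoothAt (covPullback 𝓘(ℝ, V) (extChartAt I x).symm a) (extChartAt I x x) :=
  smoothCovAt_vectorSpace.1 (SmoothCovAt.covPullback
    (extChartAt_symm_contMDiffAt (mem_extChartAt_target x))
    (by rwa [symm_extChartAt_self]))

theorem smoothFormAt_cwForm (P : MvPolynomial (Fin n × Fin n) ℂ) (k : ℕ) {a : MatCov I M n}
    {x : M} (ha : ∀ᶠ z in 𝓝 x, SmoothCovAt a z) : SmoothFormAt (cwForm P k a) x :=
  (contDiffAt_polyForm_curvV P k (connSmoothAt_chart ha.self_of_nhds)).congr_of_eventuallyEq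
    (inChart_cwForm P k ha)

theorem extD_cwForm {P : MvPolynomial (Fin n × Fin n) ℂ} {k : ℕ}
    (hP : IsConjInvariant (polarization P k)) {a : MatCov I M n}
    {x : M} (ha : ∀ᶠ z in 𝓝 x, SmoothCovAt a z) : extD (cwForm P k a) x = 0 := by
  rw [extD_eq, Filter.EventuallyEq.extDeriv_eq (inChart_cwForm P k ha),
    extDeriv_polyForm_curvV hP (connSmoothAt_chart ha.self_of_nhds)]
  rfl

/-- The entrywise differential of a matrix-valued function on a manifold. -/
noncomputable def dMatM (I : ModelWithCorners ℝ V H) {M : Type*} [TopologicalSpace M]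
    [ChartedSpace H M] (g : M → Matrix (Fin n) (Fin n) ℂ) (x : M) (w : TangentSpace I x) :
    Matrix (Fin n) (Fin n) ℂ :=
  Matrix.of fun i j ↦ mvfderiv I (fun z ↦ g z i j) x w

/-- Entrywise smoothness of a matrix-valued function on a manifold. -/
def MatSmoothAtM (I : ModelWithCorners ℝ V H) {M : Type*} [TopologicalSpace M]
    [ChartedSpace H M] (g : M → Matrix (Fin n) (Fin n) ℂ) (x : M) : Prop :=
  ∀ i j, ContMDiffAt I 𝓘(ℝ, ℂ) ∞ (fun z ↦ g z i j) x

/-- `a` and `a'` are the connection matrices of one connection in two frames at `x`, with change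
of frame `g`: `g a' = a g + dg`. -/
def GaugeRelAt (g : M → Matrix (Fin n) (Fin n) ℂ) (a a' : MatCov I M n) (x : M) : Prop :=
  ∀ w, g x * covMatrix (a' x) w = covMatrix (a x) w * g x + dMatM I g x w

omit [IsManifold I ∞ M] [IsManifold I' ∞ M'] [FiniteDimensional ℝ V] [I.Boundaryless]
  [I'.Boundaryless] in
theorem dMatM_comp {f : M' → M} {x : M'} (hf : MDifferentiableAt I' I f x)
    {g : M → Matrix (Fin n) (Fin n) ℂ} (hg : MatSmoothAtM I g (f x)) (w : TangentSpace I' x) :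
    dMatM I' (g ∘ f) x w = dMatM I g (f x) (mfderiv I' I f x w) := by
  ext i j
  simp only [dMatM, Matrix.of_apply]
  have hgd : MDifferentiableAt I 𝓘(ℝ, ℂ) (fun z ↦ g z i j) (f x) :=
    (hg i j).mdifferentiableAt (by simp)
  exact mfderiv_comp_apply x hgd hf w

omit [IsManifold I ∞ M] [IsManifold I' ∞ M'] [FiniteDimensional ℝ V] [I.Boundaryless]
  [I'.Boundaryless] in
theorem GaugeRelAt.comp {f : M' → M} {x : M'} (hf : MDifferentiableAt I' I f x)
    {g : M → Matrix (Fin n) (Fin n) ℂ} (hg : MatSmoothAtM I g (f x)) {a a' : MatCov I M n}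
    (h : GaugeRelAt g a a' (f x)) :
    GaugeRelAt (g ∘ f) (covPullback I' f a) (covPullback I' f a') x := by
  intro w
  rw [dMatM_comp hf hg]
  exact h _

omit [IsManifold I ∞ M] [IsManifold I' ∞ M'] [FiniteDimensional ℝ V] [I.Boundaryless]
  [I'.Boundaryless] in
theorem MatSmoothAtM.comp {f : M' → M} {x : M'} (hf : ContMDiffAt I' I ∞ f x)
    {g : M → Matrix (Fin n) (Fin n) ℂ} (hg : MatSmoothAtM I g (f x)) :
    MatSmoothAtM I' (g ∘ f) x := fun i j ↦ (hg i j).comp x hf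

omit [FiniteDimensional ℝ V] in
theorem mfderiv_symm_mfderiv (x : M) (w : V) :
    (mfderiv 𝓘(ℝ, V) I (extChartAt I x).symm (extChartAt I x x) : V →L[ℝ] V)
      ((mfderiv I 𝓘(ℝ, V) (extChartAt I x) x : V →L[ℝ] V) w) = w := by
  have hsym : ContMDiffAt 𝓘(ℝ, V) I ∞ (extChartAt I x).symm (extChartAt I x x) :=
    extChartAt_symm_contMDiffAt (mem_extChartAt_target x)
  have h1 : MDifferentiableAt I 𝓘(ℝ, V) (extChartAt I x) x :=
    (contMDiffAt_extChartAt (n := ∞)).mdifferentiableAt (by simp)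
  have h2 := mfderiv_comp x (hsym.mdifferentiableAt (by simp)) h1
  have h3 : (extChartAt I x).symm ∘ extChartAt I x =ᶠ[𝓝 x] id := by
    filter_upwards [extChartAt_source_mem_nhds (I := I) x] with z hz
    exact (extChartAt I x).left_inv hz
  have h4 := h3.mfderiv_eq (I := I) (I' := I)
  rw [mfderiv_id] at h4
  exact congrArg (fun L : V →L[ℝ] V ↦ L w) (h2.symm.trans h4)

/-- Curvature is conjugated by `g` under a gauge transformation; written without `g⁻¹`, so that `g`
need not be invertible. -/
theorem curvForm_gauge {g : M → Matrix (Fin n) (Fin n) ℂ} {a a' : MatCov I M n} {x : M}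
    (ha : SmoothCovAt a x) (ha' : SmoothCovAt a' x)
    (hg : ∀ᶠ z in 𝓝 x, MatSmoothAtM I g z) (h : ∀ᶠ z in 𝓝 x, GaugeRelAt g a a' z)
    (v : Fin 2 → TangentSpace I x) :
    g x * formMatrix (curvForm a' x) v = formMatrix (curvForm a x) v * g x := by
  have hsym : ContMDiffAt 𝓘(ℝ, V) I ∞ (extChartAt I x).symm (extChartAt I x x) :=
    extChartAt_symm_contMDiffAt (mem_extChartAt_target x)
  have e := symm_extChartAt_self (I := I) x
  have hgc : MatSmoothAt (g ∘ (extChartAt I x).symm) (extChartAt I x x) := by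
    have := MatSmoothAtM.comp hsym (g := g) (by rw [e]; exact hg.self_of_nhds)
    exact fun i j ↦ (this i j).contDiffAt
  have key := curvV_gauge (connSmoothAt_chart ha) (connSmoothAt_chart ha') hgc ?_
    (fun i ↦ (mfderiv I 𝓘(ℝ, V) (extChartAt I x) x (v i) : V))
  · have hc (b : MatCov I M n) (hb : SmoothCovAt b x) :
        formMatrix (curvV (covPullback 𝓘(ℝ, V) (extChartAt I x).symm b) (extChartAt I x x))
          (fun i ↦ (mfderiv I 𝓘(ℝ, V) (extChartAt I x) x (v i) : V)) =
        formMatrix (curvForm b x) v := by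
      ext i j
      simp only [formMatrix, Matrix.of_apply]
      rw [← curvForm_vectorSpace, curvForm_covPullback hsym (by rwa [e])]
      have h6 : (curvForm b ((extChartAt I x).symm (extChartAt I x x)) i j : V [⋀^Fin 2]→L[ℝ] ℂ) =
          curvForm b x i j :=
        @congrArg M (V [⋀^Fin 2]→L[ℝ] ℂ) _ _ (fun p ↦ curvForm b p i j) e
      refine (congrArg (fun F : V [⋀^Fin 2]→L[ℝ] ℂ ↦ F _) h6).trans ?_
      refine congrArg (curvForm b x i j : V [⋀^Fin 2]→L[ℝ] ℂ) ?_
      funext l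
      exact mfderiv_symm_mfderiv (V := V) (I := I) x (v l : V)
    rw [hc a ha, hc a' ha', Function.comp_apply, e] at key
    exact key
  · filter_upwards [eventually_symm (I := I) (hg.and h)] with y hy w
    have hs := extChartAt_symm_contMDiffAt hy.1
    have := (hy.2.2.comp (hs.mdifferentiableAt (by simp)) hy.2.1) w
    refine this.trans ?_
    congr 1
    ext i j
    simp only [dMatM, dMat, Matrix.of_apply, mvfderiv, mfderiv_eq_fderiv]
    rfl

theorem cwForm_gauge {P : MvPolynomial (Fin n × Fin n) ℂ} {k : ℕ}
    (hP : IsConjInvariant (polarization P k)) {g : M → Matrix (Fin n) (Fin n) ℂ}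
    {a a' : MatCov I M n} {x : M} (ha : SmoothCovAt a x) (ha' : SmoothCovAt a' x)
    (hg : ∀ᶠ z in 𝓝 x, MatSmoothAtM I g z) (hu : IsUnit (g x).det)
    (h : ∀ᶠ z in 𝓝 x, GaugeRelAt g a a' z) :
    cwForm P k a' x = cwForm P k a x :=
  polyForm_conj hP hu fun v ↦ curvForm_gauge ha ha' hg h v

end LocalCurvature

/-! ### Integration along the fibre and the homotopy formula -/

section ParametricIntegral

open MeasureTheory

variable {V : Type*} [NormedAddCommGroup V] [NormedSpace ℝ V] [FiniteDimensional ℝ V]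

/-- Differentiation under the integral sign over `[0, 1]`, for a smooth integrand. -/
theorem hasFDerivAt_parametric {f : ℝ × V → ℂ} {T : Set V} (hT : IsOpen T)
    (hf : ∀ t, ∀ y ∈ T, ContDiffAt ℝ ∞ f (t, y)) {y : V} (hy : y ∈ T) :
    HasFDerivAt (fun y ↦ ∫ t in (0 : ℝ)..1, f (t, y))
      (∫ t in (0 : ℝ)..1, (fderiv ℝ f (t, y)).comp (ContinuousLinearMap.inr ℝ ℝ V)) y := by
  have : ProperSpace V := FiniteDimensional.proper ℝ V
  obtain ⟨r, hr, hrT⟩ := Metric.nhds_basis_closedBall.mem_iff.1 (hT.mem_nhds hy)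
  have hcont : ∀ z ∈ T, Continuous fun t ↦ f (t, z) := fun z hz ↦
    continuous_iff_continuousAt.2 fun t ↦ ContinuousAt.comp (f := fun t : ℝ ↦ (t, z))
      (hf t z hz).continuousAt (by fun_prop)
  have hfd : ∀ t, ∀ z ∈ T, ContinuousAt (fderiv ℝ f) (t, z) := fun t z hz ↦
    ((hf t z hz).fderiv_right (m := ∞) (by simp)).continuousAt
  have hcont' : ∀ z ∈ T, Continuous fun t ↦
      (fderiv ℝ f (t, z)).comp (ContinuousLinearMap.inr ℝ ℝ V) := fun z hz ↦ by
    have : Continuous fun t ↦ fderiv ℝ f (t, z) :=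
      continuous_iff_continuousAt.2 fun t ↦ ContinuousAt.comp (f := fun t : ℝ ↦ (t, z))
        (hfd t z hz) (by fun_prop)
    exact this.clm_comp continuous_const
  obtain ⟨C, hC⟩ := ((isCompact_Icc (a := (0 : ℝ)) (b := 1)).prod
    (isCompact_closedBall y r)).exists_bound_of_continuousOn
      (f := fun p ↦ (fderiv ℝ f p).comp (ContinuousLinearMap.inr ℝ ℝ V)) (by
        rintro ⟨t, z⟩ ⟨_, hz⟩
        exact ((hfd t z (hrT hz)).clm_comp continuousAt_const).continuousWithinAt)
  refine intervalIntegral.hasFDerivAt_integral_of_dominated_of_fderiv_le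
    (F := fun y t ↦ f (t, y))
    (F' := fun y t ↦ (fderiv ℝ f (t, y)).comp (ContinuousLinearMap.inr ℝ ℝ V))
    (bound := fun _ ↦ C) (s := Metric.closedBall y r) (Metric.closedBall_mem_nhds y hr) ?_ ?_ ?_ ?_
    ?_ ?_
  · filter_upwards [hT.mem_nhds hy] with z hz
    exact (hcont z hz).aestronglyMeasurable
  · exact (hcont y hy).intervalIntegrable _ _
  · exact (hcont' y hy).aestronglyMeasurable
  · refine Eventually.of_forall fun t ht z hz ↦ hC (t, z) ⟨?_, hz⟩
    rw [Set.uIoc_of_le zero_le_one] at ht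
    exact ⟨ht.1.le, ht.2⟩
  · exact intervalIntegrable_const
  · refine Eventually.of_forall fun t _ z hz ↦ ?_
    have h1 : HasFDerivAt (fun z : V ↦ (t, z)) (ContinuousLinearMap.inr ℝ ℝ V) z :=
      hasFDerivAt_prodMk_right t z
    exact ((hf t z (hrT hz)).differentiableAt (by simp)).hasFDerivAt.comp z h1

theorem fderiv_parametric {f : ℝ × V → ℂ} {T : Set V} (hT : IsOpen T)
    (hf : ∀ t, ∀ y ∈ T, ContDiffAt ℝ ∞ f (t, y)) {y : V} (hy : y ∈ T) (v : V) :
    fderiv ℝ (fun y ↦ ∫ t in (0 : ℝ)..1, f (t, y)) y v =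
      ∫ t in (0 : ℝ)..1, fderiv ℝ f (t, y) (0, v) := by
  rw [(hasFDerivAt_parametric hT hf hy).fderiv]
  have hc : Continuous fun t ↦ (fderiv ℝ f (t, y)).comp (ContinuousLinearMap.inr ℝ ℝ V) := by
    have : Continuous fun t ↦ fderiv ℝ f (t, y) :=
      continuous_iff_continuousAt.2 fun t ↦ ContinuousAt.comp (f := fun t : ℝ ↦ (t, y))
        ((hf t y hy).fderiv_right (m := ∞) (by simp)).continuousAt (by fun_prop)
    exact this.clm_comp continuous_const
  rw [ContinuousLinearMap.intervalIntegral_apply (hc.intervalIntegrable _ _)]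
  rfl

theorem contDiffOn_parametric {T : Set V} (hT : IsOpen T) (N : ℕ) : ∀ {f : ℝ × V → ℂ},
    (∀ t, ∀ y ∈ T, ContDiffAt ℝ ∞ f (t, y)) →
    ContDiffOn ℝ N (fun y ↦ ∫ t in (0 : ℝ)..1, f (t, y)) T := by
  induction N with
  | zero =>
    intro f hf
    exact contDiffOn_zero.2 fun y hy ↦
      (hasFDerivAt_parametric hT hf hy).continuousAt.continuousWithinAt
  | succ N ih =>
    intro f hf
    refine (contDiffOn_succ_iff_fderiv_of_isOpen (n := (N : WithTop ℕ∞)) hT).2 ⟨?_, by simp, ?_⟩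
    · exact fun y hy ↦
        (hasFDerivAt_parametric hT hf hy).differentiableAt.differentiableWithinAt
    · refine contDiffOn_clm_apply.2 fun v ↦ ?_
      refine (ih (f := fun p ↦ fderiv ℝ f p (0, v)) fun t y hy ↦ ?_).congr fun y hy ↦ ?_
      · exact ((hf t y hy).fderiv_right (m := ∞) (by simp)).clm_apply contDiffAt_const
      · exact fderiv_parametric hT hf hy v

theorem contDiffAt_parametric {f : ℝ × V → ℂ} {T : Set V} (hT : IsOpen T)
    (hf : ∀ t, ∀ y ∈ T, ContDiffAt ℝ ∞ f (t, y)) {y : V} (hy : y ∈ T) :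
    ContDiffAt ℝ ∞ (fun y ↦ ∫ t in (0 : ℝ)..1, f (t, y)) y :=
  contDiffAt_infty.2 fun N ↦ (contDiffOn_parametric hT N hf).contDiffAt (hT.mem_nhds hy)

/-- The local homotopy formula: fibre integration of a closed form `G` on `ℝ × T` yields a form `K`
with `dK = G|_{t = 1} - G|_{t = 0}`. -/
theorem extDeriv_fibreIntegral {k : ℕ} {T : Set V} (hT : IsOpen T)
    {G : ℝ × V → (ℝ × V) [⋀^Fin (k + 1)]→L[ℝ] ℂ}
    (hG : ∀ t, ∀ y ∈ T, ContDiffAt ℝ ∞ G (t, y)) (hcl : ∀ t, ∀ y ∈ T, extDeriv G (t, y) = 0)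
    {K : V → V [⋀^Fin k]→L[ℝ] ℂ}
    (hK : ∀ y ∈ T, ∀ v, K y v = ∫ t in (0 : ℝ)..1,
      G (t, y) (Fin.cons ((1 : ℝ), (0 : V)) fun i ↦ ((0 : ℝ), v i)))
    {y : V} (hy : y ∈ T) (v : Fin (k + 1) → V) :
    extDeriv K y v = G (1, y) (fun i ↦ (0, v i)) - G (0, y) fun i ↦ (0, v i) := by
  have hGv : ∀ u, ∀ t, ∀ y ∈ T, ContDiffAt ℝ ∞ (fun p ↦ G p u) (t, y) := fun u t y hy ↦
    contDiffAt_form_iff.1 (hG t y hy) u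
  have hKe (v : Fin k → V) : (fun y ↦ K y v) =ᶠ[𝓝 y] fun y ↦ ∫ t in (0 : ℝ)..1,
      G (t, y) (Fin.cons ((1 : ℝ), (0 : V)) fun i ↦ ((0 : ℝ), v i)) := by
    filter_upwards [hT.mem_nhds hy] with z hz using hK z hz v
  have hKd : DifferentiableAt ℝ K y := differentiableAt_form_iff.2 fun v ↦
    (hasFDerivAt_parametric hT (hGv _) hy).differentiableAt.congr_of_eventuallyEq (hKe v)
  have hcont (u : Fin (k + 1) → ℝ × V) (w : ℝ × V) :
      Continuous fun t ↦ fderiv ℝ (fun p ↦ G p u) (t, y) w := by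
    have : Continuous fun t ↦ fderiv ℝ (fun p ↦ G p u) (t, y) :=
      continuous_iff_continuousAt.2 fun t ↦ ContinuousAt.comp (f := fun t : ℝ ↦ (t, y))
        ((hGv u t y hy).fderiv_right (m := ∞) (by simp)).continuousAt (by fun_prop)
    exact this.clm_apply continuous_const
  rw [extDeriv_apply hKd]
  have hterm (i : Fin (k + 1)) : fderiv ℝ (fun y ↦ K y (i.removeNth v)) y (v i) =
      ∫ t in (0 : ℝ)..1, fderiv ℝ (fun p ↦ G p (Fin.cons ((1 : ℝ), (0 : V))
        fun j ↦ ((0 : ℝ), i.removeNth v j))) (t, y) (0, v i) := by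
    rw [(hKe _).fderiv_eq]
    exact fderiv_parametric hT (hGv _) hy (v i)
  simp only [hterm]
  have hsum : (∑ i : Fin (k + 1), (-1 : ℤ) ^ (i : ℕ) • ∫ t in (0 : ℝ)..1,
      fderiv ℝ (fun p ↦ G p (Fin.cons ((1 : ℝ), (0 : V))
        fun j ↦ ((0 : ℝ), i.removeNth v j))) (t, y) (0, v i)) =
      ∫ t in (0 : ℝ)..1, fderiv ℝ (fun p ↦ G p fun i ↦ ((0 : ℝ), v i)) (t, y) (1, 0) := by
    have hs (i : Fin (k + 1)) : ((-1 : ℤ) ^ (i : ℕ) • ∫ t in (0 : ℝ)..1,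
        fderiv ℝ (fun p ↦ G p (Fin.cons ((1 : ℝ), (0 : V))
          fun j ↦ ((0 : ℝ), i.removeNth v j))) (t, y) (0, v i)) =
        ∫ t in (0 : ℝ)..1, (((-1 : ℤ) ^ (i : ℕ) : ℤ) : ℂ) *
          fderiv ℝ (fun p ↦ G p (Fin.cons ((1 : ℝ), (0 : V))
          fun j ↦ ((0 : ℝ), i.removeNth v j))) (t, y) (0, v i) := by
      rw [intervalIntegral.integral_const_mul, zsmul_eq_mul]
    simp only [hs]
    rw [← intervalIntegral.integral_finsetSum fun i _ ↦
      ((hcont _ _).const_mul _).intervalIntegrable _ _]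
    refine intervalIntegral.integral_congr fun t _ ↦ ?_
    have h0 := congrArg (fun F ↦ F (Fin.cons ((1 : ℝ), (0 : V)) fun i ↦ ((0 : ℝ), v i)))
      (hcl t y hy)
    beta_reduce at h0
    rw [show (0 : (ℝ × V) [⋀^Fin (k + 2)]→L[ℝ] ℂ)
      (Fin.cons ((1 : ℝ), (0 : V)) fun i ↦ ((0 : ℝ), v i)) = 0 from rfl] at h0
    rw [extDeriv_apply ((hG t y hy).differentiableAt (by simp)), Fin.sum_univ_succ] at h0
    have hrem (i : Fin (k + 1)) : (i.succ.removeNth (α := fun _ ↦ ℝ × V)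
        (Fin.cons ((1 : ℝ), (0 : V)) fun i ↦ ((0 : ℝ), v i)) : Fin (k + 1) → ℝ × V) =
        Fin.cons ((1 : ℝ), (0 : V)) fun j ↦ ((0 : ℝ), i.removeNth v j) := by
      funext j
      refine Fin.cases ?_ (fun j ↦ ?_) j
      · simp [Fin.removeNth]
      · simp [Fin.removeNth]
    have hrem0 : ((0 : Fin (k + 2)).removeNth (α := fun _ ↦ ℝ × V)
        (Fin.cons ((1 : ℝ), (0 : V)) fun i ↦ ((0 : ℝ), v i)) : Fin (k + 1) → ℝ × V) =
        fun i ↦ ((0 : ℝ), v i) := by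
      funext j
      simp [Fin.removeNth]
    simp only [hrem, hrem0, Fin.cons_zero, Fin.cons_succ, Fin.val_zero, pow_zero, one_smul,
      Fin.val_succ] at h0
    rw [eq_neg_of_add_eq_zero_left h0, ← Finset.sum_neg_distrib]
    refine Finset.sum_congr rfl fun i _ ↦ ?_
    rw [pow_succ, zsmul_eq_mul]
    push_cast
    ring
  rw [hsum]
  have hder (t : ℝ) : HasDerivAt (fun t ↦ G (t, y) fun i ↦ ((0 : ℝ), v i))
      (fderiv ℝ (fun p ↦ G p fun i ↦ ((0 : ℝ), v i)) (t, y) (1, 0)) t := by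
    have h1 : HasDerivAt (fun t : ℝ ↦ (t, y)) ((1 : ℝ), (0 : V)) t :=
      (hasDerivAt_id t).prodMk (hasDerivAt_const t y)
    exact (((hGv (fun i ↦ ((0 : ℝ), v i)) t y hy).differentiableAt
      (by simp)).hasFDerivAt).comp_hasDerivAt t h1
  exact intervalIntegral.integral_eq_sub_of_hasDerivAt (fun t _ ↦ hder t)
    ((hcont _ _).intervalIntegrable _ _)

end ParametricIntegral

section FibreIntegral

variable {V : Type*} [NormedAddCommGroup V] [NormedSpace ℝ V]
  {H : Type*} [TopologicalSpace H] {I : ModelWithCorners ℝ V H} [I.Boundaryless]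
  {M : Type*} [TopologicalSpace M] [ChartedSpace H M] [IsManifold I ∞ M] {k : ℕ}
  {V' : Type*} [NormedAddCommGroup V'] [NormedSpace ℝ V']
  {H' : Type*} [TopologicalSpace H'] {I' : ModelWithCorners ℝ V' H'} [I'.Boundaryless]
  {M' : Type*} [TopologicalSpace M'] [ChartedSpace H' M'] [IsManifold I' ∞ M']

omit [I.Boundaryless] [IsManifold I ∞ M] [I'.Boundaryless] [IsManifold I' ∞ M'] in
theorem mfderiv_pair {f : M' → ℝ} {g : M' → M} {x : M'}
    (hf : MDifferentiableAt I' 𝓘(ℝ, ℝ) f x) (hg : MDifferentiableAt I' I g x)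
    (w : TangentSpace I' x) :
    (mfderiv I' (𝓘(ℝ, ℝ).prod I) (fun z ↦ (f z, g z)) x w : ℝ × V) =
      ((mfderiv I' 𝓘(ℝ, ℝ) f x w : ℝ), (mfderiv I' I g x w : V)) :=
  congrArg (fun L : V' →L[ℝ] ℝ × V ↦ L w) (mfderiv_prodMk hf hg)

omit [I.Boundaryless] [IsManifold I ∞ M] in
theorem extChartAt_real_prod_symm (t₀ : ℝ) (x₀ : M) (q : ℝ × V) :
    (extChartAt (𝓘(ℝ, ℝ).prod I) (t₀, x₀)).symm q = (q.1, (extChartAt I x₀).symm q.2) := by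
  simp only [extChartAt_prod]
  rfl

omit [I.Boundaryless] [IsManifold I ∞ M] in
theorem mem_extChartAt_real_prod_target (t₀ : ℝ) (x₀ : M) (q : ℝ × V) :
    q ∈ (extChartAt (𝓘(ℝ, ℝ).prod I) (t₀, x₀)).target ↔ q.2 ∈ (extChartAt I x₀).target := by
  simp only [extChartAt_prod, PartialEquiv.prod_target, Set.mem_prod]
  simp [chartAt_self_eq]

theorem inChart_real_prod (α : DiffForm (𝓘(ℝ, ℝ).prod I) (ℝ × M) k) (t₀ : ℝ) (x₀ : M)
    {q : ℝ × V} (hq : q.2 ∈ (extChartAt I x₀).target) (u : Fin k → ℝ × V) :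
    inChart α (t₀, x₀) q u = α (q.1, (extChartAt I x₀).symm q.2)
      fun i ↦ ((u i).1, (mfderiv 𝓘(ℝ, V) I (extChartAt I x₀).symm q.2 (u i).2 : V)) := by
  rw [inChart_eq_formPullback]
  have h1 : ((extChartAt (𝓘(ℝ, ℝ).prod I) (t₀, x₀)).symm : ℝ × V → ℝ × M) =
      fun q ↦ (q.1, (extChartAt I x₀).symm q.2) := funext (extChartAt_real_prod_symm t₀ x₀)
  rw [h1]
  have hs : MDifferentiableAt 𝓘(ℝ, V) I (extChartAt I x₀).symm q.2 :=
    (extChartAt_symm_contMDiffAt hq).mdifferentiableAt (by simp)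
  have hsnd : MDifferentiableAt 𝓘(ℝ, ℝ × V) 𝓘(ℝ, V) (Prod.snd : ℝ × V → V) q :=
    differentiableAt_snd.mdifferentiableAt
  have hfst : MDifferentiableAt 𝓘(ℝ, ℝ × V) 𝓘(ℝ, ℝ) (Prod.fst : ℝ × V → ℝ) q :=
    differentiableAt_fst.mdifferentiableAt
  have hpair (w : ℝ × V) := mfderiv_pair hfst (hs.comp q hsnd) w
  refine congrArg (α (q.1, (extChartAt I x₀).symm q.2) : (ℝ × V) [⋀^Fin k]→L[ℝ] ℂ) ?_
  funext i
  refine (hpair (u i)).trans ?_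
  rw [mfderiv_comp q hs hsnd]
  simp only [mfderiv_eq_fderiv, fderiv_fst, fderiv_snd]
  rfl

variable [FiniteDimensional ℝ V] [FiniteDimensional ℝ V']

/-- Smooth forms on `ℝ × M` depend continuously on the first variable. -/
theorem continuous_real_prod {α : DiffForm (𝓘(ℝ, ℝ).prod I) (ℝ × M) k}
    (hα : ∀ p, SmoothFormAt α p) (x : M) (u : Fin k → ℝ × V) :
    Continuous fun t ↦ α (t, x) u := by
  have hx : extChartAt I x x ∈ (extChartAt I x).target := mem_extChartAt_target x
  have hG : ∀ t : ℝ, ContinuousAt (inChart α (0, x)) (t, extChartAt I x x) := fun t ↦ by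
    have hm : (t, extChartAt I x x) ∈ (extChartAt (𝓘(ℝ, ℝ).prod I) ((0 : ℝ), x)).target :=
      (mem_extChartAt_real_prod_target 0 x _).2 hx
    exact ((hα _).contDiffAt_inChart hm).continuousAt
  have hGu : Continuous fun t ↦ inChart α (0, x) (t, extChartAt I x x)
      (fun i ↦ ((u i).1, (mfderiv I 𝓘(ℝ, V) (extChartAt I x) x (u i).2 : V))) := by
    refine continuous_iff_continuousAt.2 fun t ↦ ?_
    exact (ContinuousAlternatingMap.apply ℝ (ℝ × V) ℂ _).continuous.continuousAt.comp
      (ContinuousAt.comp (f := fun t : ℝ ↦ (t, extChartAt I x x)) (hG t) (by fun_prop))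
  convert hGu using 2 with t
  rw [inChart_real_prod α 0 x hx]
  have h1 : (α (t, (extChartAt I x).symm (extChartAt I x x)) : (ℝ × V) [⋀^Fin k]→L[ℝ] ℂ) =
      α (t, x) := @congrArg M ((ℝ × V) [⋀^Fin k]→L[ℝ] ℂ) _ _ (fun p ↦ α (t, p))
        (extChartAt_to_inv x)
  refine Eq.trans ?_ (congrArg (fun F : (ℝ × V) [⋀^Fin k]→L[ℝ] ℂ ↦ F _) h1.symm)
  refine congrArg (α (t, x) : (ℝ × V) [⋀^Fin k]→L[ℝ] ℂ) ?_
  funext i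
  exact Prod.ext rfl (mfderiv_symm_mfderiv x (u i).2).symm

theorem fibreIntegral_apply {α : DiffForm (𝓘(ℝ, ℝ).prod I) (ℝ × M) (k + 1)}
    (hα : ∀ p, SmoothFormAt α p) (x : M) (v : Fin k → TangentSpace I x) :
    fibreIntegral α x v = ∫ t in (0 : ℝ)..1,
      α (t, x) (Fin.cons ((1 : ℝ), (0 : V)) fun i ↦ ((0 : ℝ), (v i : V)) : Fin (k + 1) → ℝ × V) := by
  let β : ℝ → V [⋀^Fin k]→L[ℝ] ℂ := fun t ↦
    ((show (ℝ × V) [⋀^Fin (k + 1)]→L[ℝ] ℂ from α (t, x)).curryLeft (1, 0)).compContinuousLinearMap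
      (ContinuousLinearMap.inr ℝ ℝ V)
  have hβ : Continuous β := continuous_form_iff.2 fun v ↦ continuous_real_prod hα x _
  exact ((ContinuousAlternatingMap.apply ℝ V ℂ (v : Fin k → V)).intervalIntegral_comp_comm
    (hβ.intervalIntegrable 0 1)).symm

theorem inChart_fibreIntegral {α : DiffForm (𝓘(ℝ, ℝ).prod I) (ℝ × M) (k + 1)}
    (hα : ∀ p, SmoothFormAt α p) (x₀ : M) {y : V} (hy : y ∈ (extChartAt I x₀).target)
    (v : Fin k → V) :
    inChart (fibreIntegral α) x₀ y v = ∫ t in (0 : ℝ)..1, inChart α ((0 : ℝ), x₀) (t, y)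
      (Fin.cons ((1 : ℝ), (0 : V)) fun i ↦ ((0 : ℝ), v i)) := by
  rw [inChart_eq_formPullback]
  refine (fibreIntegral_apply hα _ _).trans ?_
  refine intervalIntegral.integral_congr fun t _ ↦ ?_
  simp only
  rw [inChart_real_prod α 0 x₀ (q := (t, y)) hy]
  refine congrArg (α (t, (extChartAt I x₀).symm y) : (ℝ × V) [⋀^Fin (k + 1)]→L[ℝ] ℂ) ?_
  funext i
  refine Fin.cases ?_ (fun i ↦ ?_) i
  · exact Prod.ext rfl (map_zero (mfderiv 𝓘(ℝ, V) I (extChartAt I x₀).symm y)).symm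
  · rfl

theorem contDiffAt_inChart_real_prod {α : DiffForm (𝓘(ℝ, ℝ).prod I) (ℝ × M) k}
    (hα : ∀ p, SmoothFormAt α p) (x₀ : M) (t : ℝ) {y : V} (hy : y ∈ (extChartAt I x₀).target) :
    ContDiffAt ℝ ∞ (inChart α ((0 : ℝ), x₀) : ℝ × V → (ℝ × V) [⋀^Fin k]→L[ℝ] ℂ) (t, y) :=
  SmoothFormAt.contDiffAt_inChart (V := ℝ × V)
    ((mem_extChartAt_real_prod_target (0 : ℝ) x₀ (t, y)).2 hy) (hα _)

theorem smoothFormAt_fibreIntegral {α : DiffForm (𝓘(ℝ, ℝ).prod I) (ℝ × M) (k + 1)}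
    (hα : ∀ p, SmoothFormAt α p) (x : M) : SmoothFormAt (fibreIntegral α) x := by
  refine (contDiffAt_form_iff (V := V)).2 fun v ↦ ?_
  have ho := isOpen_extChartAt_target (I := I) x
  refine ContDiffAt.congr_of_eventuallyEq (contDiffAt_parametric ho
    (f := fun p ↦ inChart α ((0 : ℝ), x) p (Fin.cons ((1 : ℝ), (0 : V)) fun i ↦ ((0 : ℝ), v i)))
    (fun t y hy ↦ contDiffAt_form_iff.1 (contDiffAt_inChart_real_prod hα x t hy) _)
    (mem_extChartAt_target x)) ?_
  filter_upwards [ho.mem_nhds (mem_extChartAt_target x)] with y hy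
  exact inChart_fibreIntegral hα x hy v

omit [I.Boundaryless] [IsManifold I ∞ M] [FiniteDimensional ℝ V] in
theorem contMDiff_slice (s : ℝ) : ContMDiff I (𝓘(ℝ, ℝ).prod I) ∞ fun x : M ↦ (s, x) :=
  contMDiff_const.prodMk contMDiff_id

omit [I.Boundaryless] [IsManifold I ∞ M] [FiniteDimensional ℝ V] in
theorem mfderiv_slice (s : ℝ) (x : M) (w : TangentSpace I x) :
    (mfderiv I (𝓘(ℝ, ℝ).prod I) (fun x : M ↦ (s, x)) x w : ℝ × V) = ((0 : ℝ), (w : V)) := by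
  refine (mfderiv_pair mdifferentiableAt_const mdifferentiableAt_id w).trans ?_
  rw [mfderiv_const, mfderiv_id]
  rfl

/-- The homotopy formula: fibre integration of a closed form on `ℝ × M` exhibits the difference of
its restrictions to `t = 1` and `t = 0` as exact. -/
theorem extD_fibreIntegral {α : DiffForm (𝓘(ℝ, ℝ).prod I) (ℝ × M) (k + 1)}
    (hα : ∀ p, SmoothFormAt α p) (hcl : extD α = 0) :
    extD (fibreIntegral α) = formPullback I (fun x : M ↦ ((1 : ℝ), x)) α -
      formPullback I (fun x : M ↦ ((0 : ℝ), x)) α := by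
  funext x
  ext v
  rw [extD_eq]
  have hx : extChartAt I x x ∈ (extChartAt I x).target := mem_extChartAt_target x
  have key := extDeriv_fibreIntegral (isOpen_extChartAt_target (I := I) x)
    (G := inChart α ((0 : ℝ), x)) (fun t y hy ↦ contDiffAt_inChart_real_prod hα x t hy)
    (fun t y hy ↦ by
      rw [← inChart_extD (V := ℝ × V) ((mem_extChartAt_real_prod_target (0 : ℝ) x (t, y)).2 hy)
        (hα _), hcl]
      rfl)
    (K := inChart (fibreIntegral α) x) (fun y hy v ↦ inChart_fibreIntegral hα x hy v) hx
    (fun i ↦ (mfderiv I 𝓘(ℝ, V) (extChartAt I x) x (v i) : V))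
  refine key.trans ?_
  have hs (s : ℝ) : inChart α ((0 : ℝ), x) (s, extChartAt I x x)
      (fun i ↦ ((0 : ℝ), (mfderiv I 𝓘(ℝ, V) (extChartAt I x) x (v i) : V))) =
      formPullback I (fun x : M ↦ (s, x)) α x v := by
    rw [inChart_real_prod α 0 x (q := (s, extChartAt I x x)) hx]
    have h1 : (α (s, (extChartAt I x).symm (extChartAt I x x)) : (ℝ × V) [⋀^Fin (k + 1)]→L[ℝ] ℂ) =
        α (s, x) := @congrArg M ((ℝ × V) [⋀^Fin (k + 1)]→L[ℝ] ℂ) _ _ (fun p ↦ α (s, p))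
          (extChartAt_to_inv x)
    refine (congrArg (fun F : (ℝ × V) [⋀^Fin (k + 1)]→L[ℝ] ℂ ↦ F _) h1).trans ?_
    refine congrArg (α (s, x) : (ℝ × V) [⋀^Fin (k + 1)]→L[ℝ] ℂ) ?_
    funext i
    have h2 : (((0 : ℝ), (mfderiv 𝓘(ℝ, V) I (extChartAt I x).symm (extChartAt I x x) : V →L[ℝ] V)
        ((mfderiv I 𝓘(ℝ, V) (extChartAt I x) x : V →L[ℝ] V) (v i))) : ℝ × V) = (0, (v i : V)) :=
      Prod.ext rfl (mfderiv_symm_mfderiv (V := V) (I := I) x (v i : V))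
    exact h2.trans (mfderiv_slice s x (v i)).symm
  rw [hs, hs]
  rfl

/-- Fibre integration commutes with pullbacks. -/
theorem formPullback_fibreIntegral {α : DiffForm (𝓘(ℝ, ℝ).prod I) (ℝ × M) (k + 1)}
    (hα : ∀ p, SmoothFormAt α p) {φ : M' → M} (hφ : ContMDiff I' I ∞ φ) :
    formPullback I' φ (fibreIntegral α) =
      fibreIntegral (formPullback (𝓘(ℝ, ℝ).prod I') (fun p : ℝ × M' ↦ (p.1, φ p.2)) α) := by
  have hΦ : ContMDiff (𝓘(ℝ, ℝ).prod I') (𝓘(ℝ, ℝ).prod I) ∞ fun p : ℝ × M' ↦ (p.1, φ p.2) :=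
    contMDiff_fst.prodMk (hφ.comp contMDiff_snd)
  funext x
  ext v
  refine (fibreIntegral_apply hα _ _).trans (Eq.trans ?_
    (fibreIntegral_apply (fun p ↦ (hα _).formPullback hΦ.contMDiffAt) x v).symm)
  refine intervalIntegral.integral_congr fun t _ ↦ ?_
  refine congrArg (α (t, φ x) : (ℝ × V) [⋀^Fin (k + 1)]→L[ℝ] ℂ) ?_
  have hd (w : ℝ × V') : (mfderiv (𝓘(ℝ, ℝ).prod I') (𝓘(ℝ, ℝ).prod I)
      (fun p : ℝ × M' ↦ (p.1, φ p.2)) (t, x) w : ℝ × V) = (w.1, (mfderiv I' I φ x w.2 : V)) := by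
    have hφx : MDifferentiableAt I' I φ x := hφ.mdifferentiableAt (by simp)
    refine (mfderiv_pair (I' := 𝓘(ℝ, ℝ).prod I') (x := (t, x)) mdifferentiableAt_fst
      (MDifferentiableAt.comp (t, x) hφx mdifferentiableAt_snd) w).trans ?_
    have hc := mfderiv_comp (I := 𝓘(ℝ, ℝ).prod I') (t, x) hφx mdifferentiableAt_snd
    rw [mfderiv_fst]
    refine Prod.ext rfl ?_
    refine (congrArg (fun L : ℝ × V' →L[ℝ] V ↦ L w) hc).trans ?_
    rw [mfderiv_snd]
    rfl
  funext i
  refine Fin.cases ?_ (fun i ↦ ?_) i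
  · refine Eq.trans ?_ (hd ((1 : ℝ), (0 : V'))).symm
    exact Prod.ext rfl (map_zero (mfderiv I' I φ x)).symm
  · exact (hd ((0 : ℝ), (v i : V'))).symm

end FibreIntegral

/-! ### Smoothness of operations on covector fields and matrices -/

section SmoothOperations

variable {V : Type*} [NormedAddCommGroup V] [NormedSpace ℝ V]
  {H : Type*} [TopologicalSpace H] {I : ModelWithCorners ℝ V H}
  {M : Type*} [TopologicalSpace M] [ChartedSpace H M] {n : ℕ}
  [I.Boundaryless] [IsManifold I ∞ M] [FiniteDimensional ℝ V]

omit [I.Boundaryless] [IsManifold I ∞ M] in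
theorem smoothFormAt_oneForm_iff {a : ∀ x : M, TangentSpace I x →L[ℝ] ℂ} {x : M} :
    SmoothFormAt (fun y ↦ oneForm (a y)) x ↔ ∀ v : V, ContDiffAt ℝ ∞ (fun y : V ↦
      a ((extChartAt I x).symm y) (mfderivWithin 𝓘(ℝ, V) I (extChartAt I x).symm (Set.range I) y v))
      (extChartAt I x x) :=
  (contDiffAt_form_iff (V := V)).trans
    ⟨fun h v ↦ h fun _ ↦ v, fun h v ↦ h (v 0)⟩

omit [IsManifold I ∞ M] [FiniteDimensional ℝ V] in
theorem contDiffAt_comp_extChartAt_symm {f : M → ℂ} {x : M} (hf : ContMDiffAt I 𝓘(ℝ, ℂ) ∞ f x) :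
    ContDiffAt ℝ ∞ (f ∘ (extChartAt I x).symm) (extChartAt I x x) := by
  have := (contMDiffAt_iff.1 hf).2
  rw [I.range_eq_univ, contDiffWithinAt_univ] at this
  exact this

omit [I.Boundaryless] [IsManifold I ∞ M] in
theorem smoothFormAt_oneForm_add {a b : ∀ x : M, TangentSpace I x →L[ℝ] ℂ} {x : M}
    (ha : SmoothFormAt (fun y ↦ oneForm (a y)) x) (hb : SmoothFormAt (fun y ↦ oneForm (b y)) x) :
    SmoothFormAt (fun y ↦ oneForm (a y + b y)) x :=
  smoothFormAt_oneForm_iff.2 fun v ↦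
    (smoothFormAt_oneForm_iff.1 ha v).add (smoothFormAt_oneForm_iff.1 hb v)

omit [IsManifold I ∞ M] in
theorem smoothFormAt_oneForm_smul {f : M → ℂ} {a : ∀ x : M, TangentSpace I x →L[ℝ] ℂ} {x : M}
    (hf : ContMDiffAt I 𝓘(ℝ, ℂ) ∞ f x) (ha : SmoothFormAt (fun y ↦ oneForm (a y)) x) :
    SmoothFormAt (fun y ↦ oneForm (f y • a y)) x :=
  smoothFormAt_oneForm_iff.2 fun v ↦
    (contDiffAt_comp_extChartAt_symm hf).mul (smoothFormAt_oneForm_iff.1 ha v)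

omit [I.Boundaryless] [IsManifold I ∞ M] in
theorem smoothFormAt_oneForm_sum {a : Fin n → ∀ x : M, TangentSpace I x →L[ℝ] ℂ} {x : M}
    (ha : ∀ l, SmoothFormAt (fun y ↦ oneForm (a l y)) x) :
    SmoothFormAt (fun y ↦ oneForm (∑ l, a l y)) x := by
  refine smoothFormAt_oneForm_iff.2 fun v ↦ ?_
  have := ContDiffAt.sum (s := Finset.univ) fun l _ ↦ smoothFormAt_oneForm_iff.1 (ha l) v
  refine this.congr_of_eventuallyEq (Eventually.of_forall fun y ↦ ?_)
  simp only [_root_.sum_apply]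

theorem smoothFormAt_oneForm_mvfderiv {f : M → ℂ} {x : M} (hf : ContMDiffAt I 𝓘(ℝ, ℂ) ∞ f x) :
    SmoothFormAt (fun y ↦ oneForm (mvfderiv I f y)) x := by
  refine smoothFormAt_oneForm_iff.2 fun v ↦ ?_
  have h := (contDiffAt_comp_extChartAt_symm hf).fderiv_right (m := ∞) (by simp)
  refine (h.clm_apply contDiffAt_const (g := fun _ ↦ v)).congr_of_eventuallyEq ?_
  filter_upwards [eventually_symm (I := I)
    (ContMDiffAt.eventually_mdifferentiableAt hf)] with y hy
  rw [I.range_eq_univ, mfderivWithin_univ]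
  have hs := (extChartAt_symm_contMDiffAt hy.1).mdifferentiableAt (by simp)
  refine (mfderiv_comp_apply y hy.2 hs v).symm.trans ?_
  rw [mfderiv_eq_fderiv]
  rfl

theorem contDiff_det : ContDiff ℝ ∞ fun X : Fin n → Fin n → ℂ ↦ (Matrix.of X).det := by
  simp only [Matrix.det_apply]
  refine ContDiff.sum fun s _ ↦ ContDiff.const_smul _ (contDiff_prod fun i _ ↦ ?_)
  exact contDiff_apply_apply ..

theorem contDiffAt_matrix_inv {X : Fin n → Fin n → ℂ} (hX : IsUnit (Matrix.of X).det)
    (i j : Fin n) : ContDiffAt ℝ ∞ (fun X : Fin n → Fin n → ℂ ↦ (Matrix.of X)⁻¹ i j) X := by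
  simp only [Matrix.inv_def, Matrix.smul_apply, Ring.inverse_eq_inv', smul_eq_mul,
    Matrix.adjugate_apply]
  refine (contDiff_det.contDiffAt.inv hX.ne_zero).mul (ContDiff.contDiffAt ?_)
  have hu : ContDiff ℝ ∞ fun X : Fin n → Fin n → ℂ ↦
      fun p q ↦ (Matrix.of X).updateRow j (Pi.single i 1) p q := by
    refine contDiff_pi.2 fun p ↦ contDiff_pi.2 fun q ↦ ?_
    simp only [Matrix.updateRow_apply]
    split_ifs
    · exact contDiff_const
    · exact contDiff_apply_apply ..
  exact contDiff_det.comp hu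

omit [I.Boundaryless] [IsManifold I ∞ M] [FiniteDimensional ℝ V]

theorem MatSmoothAtM.inv {u : M → Matrix (Fin n) (Fin n) ℂ} {x : M} (hu : MatSmoothAtM I u x)
    (hd : IsUnit (u x).det) : MatSmoothAtM I (fun y ↦ (u y)⁻¹) x := fun i j ↦ by
  have h : ContMDiffAt I 𝓘(ℝ, Fin n → Fin n → ℂ) ∞ (M' := Fin n → Fin n → ℂ) u x :=
    contMDiffAt_pi_space.2 fun i ↦ contMDiffAt_pi_space.2 fun j ↦ hu i j
  exact ContMDiffAt.comp (M' := Fin n → Fin n → ℂ) (g := fun X : Fin n → Fin n → ℂ ↦ (Matrix.of X)⁻¹ i j) x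
    (contDiffAt_matrix_inv (X := fun i j ↦ u x i j) hd i j).contMDiffAt h

end SmoothOperations

/-! ### Frame atlases, connections and transgression forms -/

section LocalData

variable {V : Type*} [NormedAddCommGroup V] [NormedSpace ℝ V]
  {H : Type*} [TopologicalSpace H] {I : ModelWithCorners ℝ V H}
  {M : Type*} [TopologicalSpace M] [ChartedSpace H M] {n : ℕ} {ι : Type*}
  {V' : Type*} [NormedAddCommGroup V'] [NormedSpace ℝ V']
  {H' : Type*} [TopologicalSpace H'] {I' : ModelWithCorners ℝ V' H'}
  {M' : Type*} [TopologicalSpace M'] [ChartedSpace H' M']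

variable (I M n ι) in
/-- The cocycle of a complex vector bundle of rank `n`: open sets `dom i`, a choice of one of them
around every point, and smooth invertible transition matrices. -/
structure FrameAtlas where
  dom : ι → Set M
  isOpen_dom : ∀ i, IsOpen (dom i)
  ind : M → ι
  mem_dom : ∀ x, x ∈ dom (ind x)
  trans : ι → ι → M → Matrix (Fin n) (Fin n) ℂ
  smooth_trans : ∀ {i j x}, x ∈ dom i → x ∈ dom j → MatSmoothAtM I (trans i j) x
  isUnit_trans : ∀ {i j x}, x ∈ dom i → x ∈ dom j → IsUnit (trans i j x).det

namespace FrameAtlas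

variable (T : FrameAtlas I M n ι)

theorem dom_mem_nhds {i : ι} {x : M} (h : x ∈ T.dom i) : T.dom i ∈ 𝓝 x :=
  (T.isOpen_dom i).mem_nhds h

/-- Connection matrices in the frames of an atlas, related by the transition matrices. -/
structure IsConn (a : ι → MatCov I M n) : Prop where
  smooth : ∀ {i x}, x ∈ T.dom i → SmoothCovAt (a i) x
  gauge : ∀ {i j x}, x ∈ T.dom i → x ∈ T.dom j → GaugeRelAt (T.trans i j) (a i) (a j) x

/-- The matrices of a smooth automorphism of the bundle in the frames of an atlas. -/
structure IsAut (u : ι → M → Matrix (Fin n) (Fin n) ℂ) : Prop where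
  smooth : ∀ {i x}, x ∈ T.dom i → MatSmoothAtM I (u i) x
  isUnit : ∀ {i x}, x ∈ T.dom i → IsUnit (u i x).det
  trans_mul : ∀ {i j x}, x ∈ T.dom i → x ∈ T.dom j → T.trans i j x * u j x = u i x * T.trans i j x

/-- The Chern-Weil form of a connection given by its connection matrices. -/
noncomputable def cw (P : MvPolynomial (Fin n × Fin n) ℂ) (k : ℕ) (a : ι → MatCov I M n) :
    DiffForm I M (2 * k) := fun x ↦ cwForm P k (a (T.ind x)) x

/-- The atlas of the pullback bundle. -/
@[simps]
def pull {f : M' → M} (hf : ContMDiff I' I ∞ f) : FrameAtlas I' M' n ι where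
  dom i := f ⁻¹' T.dom i
  isOpen_dom i := (T.isOpen_dom i).preimage hf.continuous
  ind := T.ind ∘ f
  mem_dom x := T.mem_dom (f x)
  trans i j := T.trans i j ∘ f
  smooth_trans hi hj := (T.smooth_trans hi hj).comp hf.contMDiffAt
  isUnit_trans hi hj := T.isUnit_trans hi hj

/-- The atlas of the pullback of the bundle to `ℝ × M`. -/
noncomputable abbrev cyl : FrameAtlas (𝓘(ℝ, ℝ).prod I) (ℝ × M) n ι :=
  T.pull (contMDiff_snd : ContMDiff (𝓘(ℝ, ℝ).prod I) I ∞ (Prod.snd : ℝ × M → M))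

/-- The connection matrix of `d/dt + (1 - t) ∇₀ + t ∇₁` on `ℝ × M`. -/
noncomputable def _root_.OddChernWeil.pathCov (a b : MatCov I M n) :
    MatCov (𝓘(ℝ, ℝ).prod I) (ℝ × M) n := fun p i j ↦
  ((1 - p.1 : ℝ) : ℂ) • covPullback (𝓘(ℝ, ℝ).prod I) Prod.snd a p i j +
    ((p.1 : ℝ) : ℂ) • covPullback (𝓘(ℝ, ℝ).prod I) Prod.snd b p i j

/-- The transgression form of two connections given by their connection matrices. -/
noncomputable def tp (P : MvPolynomial (Fin n × Fin n) ℂ) (k : ℕ) (a b : ι → MatCov I M n) :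
    DiffForm I M (2 * k + 1) :=
  fibreIntegral (T.cyl.cw P (k + 1) fun i ↦ pathCov (a i) (b i))

variable {T} {a b a' b' : ι → MatCov I M n} {P : MvPolynomial (Fin n × Fin n) ℂ} {k : ℕ}
  {u : ι → M → Matrix (Fin n) (Fin n) ℂ}

theorem cw_congr [I.Boundaryless] (h : ∀ {i x}, x ∈ T.dom i → a i x = b i x) :
    T.cw P k a = T.cw P k b := by
  funext x
  refine cwForm_congr P k ?_
  filter_upwards [T.dom_mem_nhds (T.mem_dom x)] with y hy using h hy

theorem tp_congr [I.Boundaryless] (h : ∀ {i x}, x ∈ T.dom i → a i x = b i x)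
    (h' : ∀ {i x}, x ∈ T.dom i → a' i x = b' i x) : T.tp P k a a' = T.tp P k b b' := by
  unfold tp
  rw [cw_congr]
  intro i x hx
  funext p q
  simp only [pathCov, covPullback]
  rw [h hx, h' hx]

theorem _root_.OddChernWeil.GaugeRelAt.eq {g : M → Matrix (Fin n) (Fin n) ℂ}
    {a a' a'' : MatCov I M n} {x : M} (h : GaugeRelAt g a a' x) (h' : GaugeRelAt g a a'' x)
    (hg : IsUnit (g x).det) : a' x = a'' x := by
  funext i j
  ext w
  have e := (h w).trans (h' w).symm
  have e2 := congrArg (fun X ↦ ((g x)⁻¹ * X) i j) e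
  simp only [← Matrix.mul_assoc, Matrix.nonsing_inv_mul _ hg, Matrix.one_mul] at e2
  exact e2

theorem _root_.OddChernWeil.GaugeRelAt.affine {g : M → Matrix (Fin n) (Fin n) ℂ}
    {a b c a' b' c' : MatCov I M n} {x : M} (h : GaugeRelAt g a a' x) (h' : GaugeRelAt g b b' x)
    {r s : ℂ} (hrs : r + s = 1) (hc : ∀ i j, c x i j = r • a x i j + s • b x i j)
    (hc' : ∀ i j, c' x i j = r • a' x i j + s • b' x i j) : GaugeRelAt g c c' x := by
  intro w
  have e : covMatrix (c x) w = r • covMatrix (a x) w + s • covMatrix (b x) w := by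
    ext i j
    exact congrArg (fun L ↦ L w) (hc i j)
  have e' : covMatrix (c' x) w = r • covMatrix (a' x) w + s • covMatrix (b' x) w := by
    ext i j
    exact congrArg (fun L ↦ L w) (hc' i j)
  have hd : dMatM I g x w = r • dMatM I g x w + s • dMatM I g x w := by
    rw [← add_smul, hrs, one_smul]
  rw [e, e', hd, Matrix.mul_add, Matrix.mul_smul, Matrix.mul_smul, h w, h' w, Matrix.add_mul,
    Matrix.smul_mul, Matrix.smul_mul, smul_add, smul_add]
  abel

variable [I.Boundaryless] [IsManifold I ∞ M] [I'.Boundaryless] [IsManifold I' ∞ M']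
  [FiniteDimensional ℝ V] [FiniteDimensional ℝ V']

omit [FiniteDimensional ℝ V] in
theorem IsConn.pull {f : M' → M} (hf : ContMDiff I' I ∞ f) (ha : T.IsConn a) :
    (T.pull hf).IsConn fun i ↦ covPullback I' f (a i) where
  smooth hi := (ha.smooth hi).covPullback hf.contMDiffAt
  gauge hi hj := (ha.gauge hi hj).comp (hf.mdifferentiableAt (by simp)) (T.smooth_trans hi hj)

omit [FiniteDimensional ℝ V] [FiniteDimensional ℝ V'] in
theorem cw_pull {f : M' → M} (hf : ContMDiff I' I ∞ f) (ha : T.IsConn a) :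
    formPullback I' f (T.cw P k a) = (T.pull hf).cw P k fun i ↦ covPullback I' f (a i) := by
  funext x
  have h1 : formPullback I' f (T.cw P k a) x =
      formPullback I' f (cwForm P k (a (T.ind (f x)))) x := by
    simp only [formPullback, cw]
  have h2 : (T.pull hf).cw P k (fun i ↦ covPullback I' f (a i)) x =
      cwForm P k (covPullback I' f (a (T.ind (f x)))) x := by
    simp only [cw, pull_ind, Function.comp_apply]
  rw [h1, h2, cwForm_covPullback P k hf.contMDiffAt (ha.smooth (T.mem_dom (f x)))]

theorem IsConn.cw_eq (hP : IsConjInvariant (polarization P k)) (ha : T.IsConn a) {i : ι} {x : M}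
    (hx : x ∈ T.dom i) : T.cw P k a x = cwForm P k (a i) x := by
  have hx' := T.mem_dom x
  refine cwForm_gauge hP (ha.smooth hx) (ha.smooth hx') (g := T.trans i (T.ind x)) ?_
    (T.isUnit_trans hx hx') ?_
  · filter_upwards [T.dom_mem_nhds hx, T.dom_mem_nhds hx'] with y hy hy' using T.smooth_trans hy hy'
  · filter_upwards [T.dom_mem_nhds hx, T.dom_mem_nhds hx'] with y hy hy' using ha.gauge hy hy'

theorem IsConn.smooth_cw (hP : IsConjInvariant (polarization P k)) (ha : T.IsConn a) (x : M) :
    SmoothFormAt (T.cw P k a) x := by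
  have hx := T.dom_mem_nhds (T.mem_dom x)
  refine SmoothFormAt.congr (β := cwForm P k (a (T.ind x))) ?_ (smoothFormAt_cwForm P k ?_)
  · filter_upwards [hx] with y hy using ha.cw_eq hP hy
  · filter_upwards [hx] with y hy using ha.smooth hy

theorem IsConn.extD_cw (hP : IsConjInvariant (polarization P k)) (ha : T.IsConn a) :
    extD (T.cw P k a) = 0 := by
  funext x
  have hx := T.dom_mem_nhds (T.mem_dom x)
  rw [extD_congr (β := cwForm P k (a (T.ind x)))]
  · refine extD_cwForm hP ?_
    filter_upwards [hx] with y hy using ha.smooth hy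
  · filter_upwards [hx] with y hy using ha.cw_eq hP hy

/-- Gauge equivalent connections have the same Chern-Weil forms. -/
theorem IsConn.cw_gauge (hP : IsConjInvariant (polarization P k)) (ha : T.IsConn a)
    (hb : T.IsConn b) (hu : T.IsAut u)
    (h : ∀ {i x}, x ∈ T.dom i → GaugeRelAt (u i) (a i) (b i) x) : T.cw P k b = T.cw P k a := by
  funext x
  have hx := T.mem_dom x
  refine cwForm_gauge hP (ha.smooth hx) (hb.smooth hx) (g := u (T.ind x)) ?_ (hu.isUnit hx) ?_
  · filter_upwards [T.dom_mem_nhds hx] with y hy using hu.smooth hy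
  · filter_upwards [T.dom_mem_nhds hx] with y hy using h hy

theorem IsConn.path (ha : T.IsConn a) (hb : T.IsConn b) :
    T.cyl.IsConn fun i ↦ pathCov (a i) (b i) where
  smooth {i p} hi p' q' := by
    have hf : ContMDiffAt (𝓘(ℝ, ℝ).prod I) 𝓘(ℝ, ℂ) ∞ (fun p : ℝ × M ↦ ((p.1 : ℝ) : ℂ)) p :=
      ((Complex.ofRealCLM.contDiff (n := ∞)).contMDiff.comp contMDiff_fst).contMDiffAt
    have hg : ContMDiffAt (𝓘(ℝ, ℝ).prod I) 𝓘(ℝ, ℂ) ∞ (fun p : ℝ × M ↦ ((1 - p.1 : ℝ) : ℂ)) p :=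
      (((Complex.ofRealCLM.contDiff (n := ∞)).comp
        (contDiff_const.sub contDiff_id (f := fun _ ↦ (1 : ℝ)))).contMDiff.comp
          contMDiff_fst).contMDiffAt
    exact smoothFormAt_oneForm_add
      (smoothFormAt_oneForm_smul hg ((ha.pull contMDiff_snd).smooth hi p' q'))
      (smoothFormAt_oneForm_smul hf ((hb.pull contMDiff_snd).smooth hi p' q'))
  gauge {i j p} hi hj := ((ha.pull contMDiff_snd).gauge hi hj).affine
    ((hb.pull contMDiff_snd).gauge hi hj) (by push_cast; ring) (fun _ _ ↦ rfl) fun _ _ ↦ rfl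

omit [I.Boundaryless] [IsManifold I ∞ M] [FiniteDimensional ℝ V] in
theorem _root_.OddChernWeil.covPullback_slice_snd (s : ℝ) (a : MatCov I M n) (x : M) (i j : Fin n) :
    (covPullback (𝓘(ℝ, ℝ).prod I) Prod.snd a (s, x) i j).comp
      (mfderiv I (𝓘(ℝ, ℝ).prod I) (fun x : M ↦ (s, x)) x) = a x i j := by
  ext w
  refine congrArg (a x i j) ?_
  rw [mfderiv_snd]
  exact congrArg Prod.snd (mfderiv_slice s x w)

omit [I.Boundaryless] [IsManifold I ∞ M] [FiniteDimensional ℝ V] in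
theorem _root_.OddChernWeil.covPullback_slice_pathCov (s : ℝ) (a b : MatCov I M n) (x : M)
    (i j : Fin n) : covPullback I (fun x : M ↦ (s, x)) (pathCov a b) x i j =
      ((1 - s : ℝ) : ℂ) • a x i j + (s : ℂ) • b x i j := by
  rw [← covPullback_slice_snd s a x i j, ← covPullback_slice_snd s b x i j]
  rfl

omit [I.Boundaryless] [IsManifold I ∞ M] [FiniteDimensional ℝ V] in
theorem _root_.OddChernWeil.covPullback_zero_pathCov (a b : MatCov I M n) :
    covPullback I (fun x : M ↦ ((0 : ℝ), x)) (pathCov a b) = a := by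
  funext x i j
  rw [covPullback_slice_pathCov]
  ext w
  simp

omit [I.Boundaryless] [IsManifold I ∞ M] [FiniteDimensional ℝ V] in
theorem _root_.OddChernWeil.covPullback_one_pathCov (a b : MatCov I M n) :
    covPullback I (fun x : M ↦ ((1 : ℝ), x)) (pathCov a b) = b := by
  funext x i j
  rw [covPullback_slice_pathCov]
  ext w
  simp

theorem IsConn.smooth_tp (hP : IsConjInvariant (polarization P (k + 1))) (ha : T.IsConn a)
    (hb : T.IsConn b) (x : M) : SmoothFormAt (T.tp P k a b) x :=
  smoothFormAt_fibreIntegral ((ha.path hb).smooth_cw hP) x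

theorem IsConn.extD_tp (hP : IsConjInvariant (polarization P (k + 1))) (ha : T.IsConn a)
    (hb : T.IsConn b) : extD (T.tp P k a b) = T.cw P (k + 1) b - T.cw P (k + 1) a := by
  refine (extD_fibreIntegral ((ha.path hb).smooth_cw hP) ((ha.path hb).extD_cw hP)).trans ?_
  have h1 := cw_pull (P := P) (k := k + 1) (contMDiff_slice (I := I) (M := M) 1) (ha.path hb)
  have h0 := cw_pull (P := P) (k := k + 1) (contMDiff_slice (I := I) (M := M) 0) (ha.path hb)
  simp only [covPullback_zero_pathCov] at h0
  simp only [covPullback_one_pathCov] at h1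
  exact congrArg₂ (· - ·) h1 h0

/-- Transgression forms are natural: pullback by `f` corresponds to pullback of the path of
connections by `id × f`. -/
theorem IsConn.tp_pull (hP : IsConjInvariant (polarization P (k + 1))) (ha : T.IsConn a)
    (hb : T.IsConn b) {f : M' → M} (hf : ContMDiff I' I ∞ f) :
    formPullback I' f (T.tp P k a b) =
      (T.pull hf).tp P k (fun i ↦ covPullback I' f (a i)) fun i ↦ covPullback I' f (b i) := by
  have hF : ContMDiff (𝓘(ℝ, ℝ).prod I') (𝓘(ℝ, ℝ).prod I) ∞ fun p : ℝ × M' ↦ (p.1, f p.2) :=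
    contMDiff_fst.prodMk (hf.comp contMDiff_snd)
  refine (formPullback_fibreIntegral ((ha.path hb).smooth_cw hP) hf).trans ?_
  refine congrArg fibreIntegral ((cw_pull hF (ha.path hb)).trans ?_)
  have hs (c : MatCov I M n) (p : ℝ × M') (q r : Fin n) :
      covPullback (𝓘(ℝ, ℝ).prod I') (fun p : ℝ × M' ↦ (p.1, f p.2))
        (covPullback (𝓘(ℝ, ℝ).prod I) Prod.snd c) p q r =
      covPullback (𝓘(ℝ, ℝ).prod I') Prod.snd (covPullback I' f c) p q r := by
    have h1 := mfderiv_comp (I'' := I) p (mdifferentiableAt_snd (I := 𝓘(ℝ, ℝ)) (I' := I))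
      (hF.mdifferentiableAt (x := p) (by simp))
    have h2 := mfderiv_comp (I' := I') (I'' := I) p (hf.mdifferentiableAt (x := p.2) (by simp))
      (mdifferentiableAt_snd (I := 𝓘(ℝ, ℝ)) (I' := I') (x := p))
    ext w
    exact congrArg (fun L : ℝ × V' →L[ℝ] V ↦ (c (f p.2) q r : V →L[ℝ] ℂ) (L w)) (h1.symm.trans h2)
  refine congrArg (FrameAtlas.cw _ P (k + 1)) ?_
  funext i p q r
  refine Eq.trans ?_ (congrArg₂ (fun X Y : ℝ × V' →L[ℝ] ℂ ↦
    ((1 - p.1 : ℝ) : ℂ) • X + ((p.1 : ℝ) : ℂ) • Y) (hs (a i) p q r) (hs (b i) p q r))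
  rfl

end FrameAtlas
end LocalData

/-! ### Gauge transformations of connection matrices -/

section GaugeAction

variable {V : Type*} [NormedAddCommGroup V] [NormedSpace ℝ V]
  {H : Type*} [TopologicalSpace H] {I : ModelWithCorners ℝ V H}
  {M : Type*} [TopologicalSpace M] [ChartedSpace H M] {n : ℕ} {ι : Type*}

theorem MatSmoothAtM.mdifferentiableAt {g : M → Matrix (Fin n) (Fin n) ℂ} {x : M}
    (hg : MatSmoothAtM I g x) (i j : Fin n) : MDifferentiableAt I 𝓘(ℝ, ℂ) (fun z ↦ g z i j) x :=
  (hg i j).mdifferentiableAt (by simp)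

theorem dMatM_mul {g h : M → Matrix (Fin n) (Fin n) ℂ} {x : M}
    (hg : ∀ i j, MDifferentiableAt I 𝓘(ℝ, ℂ) (fun z ↦ g z i j) x)
    (hh : ∀ i j, MDifferentiableAt I 𝓘(ℝ, ℂ) (fun z ↦ h z i j) x) (w : TangentSpace I x) :
    dMatM I (fun z ↦ g z * h z) x w = dMatM I g x w * h x + g x * dMatM I h x w := by
  ext i j
  simp only [dMatM, Matrix.of_apply, Matrix.mul_apply, Matrix.add_apply]
  rw [← Finset.sum_add_distrib]
  have hp (l : Fin n) : HasMFDerivAt I 𝓘(ℝ, ℂ) (fun z ↦ g z i l * h z l j) x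
      (g x i l • mvfderiv I (fun z ↦ h z l j) x + h x l j • mvfderiv I (fun z ↦ g z i l) x) :=
    (hg i l).hasMFDerivAt.mul (hh l j).hasMFDerivAt
  have hs : HasMFDerivAt I 𝓘(ℝ, ℂ) (fun z ↦ ∑ l, g z i l * h z l j) x
      (∑ l, (g x i l • mvfderiv I (fun z ↦ h z l j) x +
        h x l j • mvfderiv I (fun z ↦ g z i l) x)) :=
    (HasMFDerivAt.sum fun l (_ : l ∈ Finset.univ) ↦ hp l).congr_of_eventuallyEq
      (Eventually.of_forall fun z ↦ by rw [Finset.sum_apply])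
  refine (congrArg (fun L : V →L[ℝ] ℂ ↦ L w) hs.mfderiv).trans ?_
  refine (_root_.sum_apply (F := V →L[ℝ] ℂ) ..).trans (Finset.sum_congr rfl fun l _ ↦ ?_)
  exact (add_comm _ _).trans (congrArg (· + _) (mul_comm _ _))

theorem dMatM_congr {g h : M → Matrix (Fin n) (Fin n) ℂ} {x : M} (e : ∀ᶠ z in 𝓝 x, g z = h z)
    (w : TangentSpace I x) : dMatM I g x w = dMatM I h x w := by
  ext i j
  simp only [dMatM, Matrix.of_apply, mvfderiv]
  have e' : (fun z ↦ g z i j) =ᶠ[𝓝 x] fun z ↦ h z i j := e.mono fun z hz ↦ congrFun (congrFun hz i) j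
  exact congrArg (fun L : V →L[ℝ] ℂ ↦ L w) e'.mfderiv_eq

/-- The connection matrix `u⁻¹ a u + u⁻¹ du`. -/
noncomputable def gaugeCov (u : M → Matrix (Fin n) (Fin n) ℂ) (a : MatCov I M n) : MatCov I M n :=
  fun x i j ↦ ∑ l, (u x)⁻¹ i l • ((∑ q, u x q j • a x l q) + mvfderiv I (fun z ↦ u z l j) x)

theorem gaugeRelAt_gaugeCov {u : M → Matrix (Fin n) (Fin n) ℂ} {x : M} (hu : IsUnit (u x).det)
    (a : MatCov I M n) : GaugeRelAt u a (gaugeCov u a) x := by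
  intro w
  have e : covMatrix (gaugeCov u a x) w =
      (u x)⁻¹ * (covMatrix (a x) w * u x + dMatM I u x w) := by
    ext i j
    simp only [Matrix.mul_apply, Matrix.add_apply, covMatrix, gaugeCov, dMatM, Matrix.of_apply]
    refine (_root_.sum_apply ..).trans (Finset.sum_congr rfl fun l _ ↦
      congrArg ((u x)⁻¹ i l * ·) ?_)
    refine congrArg (· + mvfderiv I (fun z ↦ u z l j) x w)
      ((_root_.sum_apply (F := V →L[ℝ] ℂ) ..).trans (Finset.sum_congr rfl fun q _ ↦ ?_))
    exact mul_comm _ _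
  rw [e, Matrix.mul_nonsing_inv_cancel_left _ _ hu]

variable [I.Boundaryless] [IsManifold I ∞ M] [FiniteDimensional ℝ V]

theorem SmoothCovAt.gaugeCov {u : M → Matrix (Fin n) (Fin n) ℂ} {a : MatCov I M n} {x : M}
    (ha : SmoothCovAt a x) (hu : MatSmoothAtM I u x) (hd : IsUnit (u x).det) :
    SmoothCovAt (gaugeCov u a) x := fun i j ↦
  smoothFormAt_oneForm_sum fun l ↦ smoothFormAt_oneForm_smul (hu.inv hd i l) <|
    smoothFormAt_oneForm_add
      (smoothFormAt_oneForm_sum fun q ↦ smoothFormAt_oneForm_smul (hu q j) (ha l q))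
      (smoothFormAt_oneForm_mvfderiv (hu l j))

namespace FrameAtlas

variable {T : FrameAtlas I M n ι} {a b a' b' : ι → MatCov I M n}
  {P : MvPolynomial (Fin n × Fin n) ℂ} {k : ℕ} {u : ι → M → Matrix (Fin n) (Fin n) ℂ}

/-- A gauge transform of a connection is again compatible with the change of frames. -/
theorem IsConn.gaugeCov (ha : T.IsConn a) (hu : T.IsAut u) :
    T.IsConn fun i ↦ gaugeCov (u i) (a i) where
  smooth hi := (ha.smooth hi).gaugeCov (hu.smooth hi) (hu.isUnit hi)
  gauge {i j x} hi hj w := by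
    have hg := T.smooth_trans hi hj
    have h1 := gaugeRelAt_gaugeCov (hu.isUnit hi) (a i) w
    have h2 := gaugeRelAt_gaugeCov (hu.isUnit hj) (a j) w
    have h3 := ha.gauge hi hj w
    have h4 := hu.trans_mul hi hj
    have h5 : dMatM I (T.trans i j) x w * u j x + T.trans i j x * dMatM I (u j) x w =
        dMatM I (u i) x w * T.trans i j x + u i x * dMatM I (T.trans i j) x w := by
      rw [← dMatM_mul hg.mdifferentiableAt (hu.smooth hj).mdifferentiableAt,
        ← dMatM_mul (hu.smooth hi).mdifferentiableAt hg.mdifferentiableAt]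
      refine dMatM_congr ?_ w
      filter_upwards [T.dom_mem_nhds hi, T.dom_mem_nhds hj] with y hy hy' using hu.trans_mul hy hy'
    -- the relation holds after multiplication by the invertible matrix `u i x`
    have key : u i x * (T.trans i j x * covMatrix (OddChernWeil.gaugeCov (u j) (a j) x) w) =
        u i x * (covMatrix (OddChernWeil.gaugeCov (u i) (a i) x) w * T.trans i j x +
          dMatM I (T.trans i j) x w) := by
      rw [← Matrix.mul_assoc, ← h4, Matrix.mul_assoc, h2, Matrix.mul_add, ← Matrix.mul_assoc, h3,
        Matrix.mul_add, ← Matrix.mul_assoc (u i x), h1, Matrix.add_mul, Matrix.add_mul,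
        Matrix.mul_assoc _ _ (u j x), h4, ← Matrix.mul_assoc, add_assoc, h5, add_assoc]
    have := congrArg ((u i x)⁻¹ * ·) key
    simpa only [Matrix.nonsing_inv_mul_cancel_left _ _ (hu.isUnit hi)] using this

/-- The transgression form between gauge equivalent connections is closed. -/
theorem IsConn.extD_tp_gauge (hP : IsConjInvariant (polarization P (k + 1))) (ha : T.IsConn a)
    (hb : T.IsConn b) (hu : T.IsAut u)
    (h : ∀ {i x}, x ∈ T.dom i → GaugeRelAt (u i) (a i) (b i) x) : extD (T.tp P k a b) = 0 := by
  rw [ha.extD_tp hP hb, ha.cw_gauge hP hb hu h, sub_self]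

/-- For gauge equivalent connections on `ℝ × M`, the transgression forms of the restrictions to
`t = 0` and `t = 1` are cohomologous. -/
theorem isExactForm_tp_slice (hP : IsConjInvariant (polarization P (k + 1)))
    {a b : ι → MatCov (𝓘(ℝ, ℝ).prod I) (ℝ × M) n} (ha : T.cyl.IsConn a) (hb : T.cyl.IsConn b)
    {u : ι → ℝ × M → Matrix (Fin n) (Fin n) ℂ} (hu : T.cyl.IsAut u)
    (h : ∀ {i x}, x ∈ T.cyl.dom i → GaugeRelAt (u i) (a i) (b i) x) :
    IsExactForm (T.tp P k (fun i ↦ covPullback I (fun x : M ↦ ((1 : ℝ), x)) (a i))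
        (fun i ↦ covPullback I (fun x : M ↦ ((1 : ℝ), x)) (b i)) -
      T.tp P k (fun i ↦ covPullback I (fun x : M ↦ ((0 : ℝ), x)) (a i))
        (fun i ↦ covPullback I (fun x : M ↦ ((0 : ℝ), x)) (b i))) := by
  refine ⟨fibreIntegral (T.cyl.tp P k a b), isSmoothForm_of_smoothFormAt
    (smoothFormAt_fibreIntegral (ha.smooth_tp hP hb)), ?_⟩
  rw [extD_fibreIntegral (ha.smooth_tp hP hb) (ha.extD_tp_gauge hP hb hu h),
    ha.tp_pull hP hb (contMDiff_slice 1), ha.tp_pull hP hb (contMDiff_slice 0)]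
  rfl

/-- The class of the transgression form between `∇` and its transform under a fixed automorphism
does not depend on `∇`. -/
theorem isExactForm_tp_sub_tp (hP : IsConjInvariant (polarization P (k + 1))) (ha : T.IsConn a)
    (hb : T.IsConn b) (ha' : T.IsConn a') (hb' : T.IsConn b') (hu : T.IsAut u)
    (h : ∀ {i x}, x ∈ T.dom i → GaugeRelAt (u i) (a i) (b i) x)
    (h' : ∀ {i x}, x ∈ T.dom i → GaugeRelAt (u i) (a' i) (b' i) x) :
    IsExactForm (T.tp P k a b - T.tp P k a' b') := by
  have hs : ContMDiff (𝓘(ℝ, ℝ).prod I) I ∞ (Prod.snd : ℝ × M → M) := contMDiff_snd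
  have := isExactForm_tp_slice (u := fun i ↦ u i ∘ Prod.snd) hP (ha'.path ha) (hb'.path hb)
    ⟨fun hi ↦ (hu.smooth hi).comp hs.contMDiffAt, fun hi ↦ hu.isUnit hi,
      fun hi hj ↦ hu.trans_mul hi hj⟩
    fun {i x} hi ↦ ((h' hi).comp (hs.mdifferentiableAt (by simp)) (hu.smooth hi)).affine
      ((h hi).comp (hs.mdifferentiableAt (by simp)) (hu.smooth hi))
      (r := ((1 - x.1 : ℝ) : ℂ)) (s := ((x.1 : ℝ) : ℂ))
      (by push_cast; ring) (fun _ _ ↦ rfl) fun _ _ ↦ rfl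
  simpa only [covPullback_zero_pathCov, covPullback_one_pathCov] using this

/-- The class of the transgression form is invariant under smooth homotopies of the automorphism:
`u` is an automorphism of the pullback bundle on `ℝ × M`. -/
theorem isExactForm_tp_homotopy (hP : IsConjInvariant (polarization P (k + 1))) (ha : T.IsConn a)
    {u : ι → ℝ × M → Matrix (Fin n) (Fin n) ℂ} (hu : T.cyl.IsAut u)
    {b₀ b₁ : ι → MatCov I M n}
    (h₀ : ∀ {i x}, x ∈ T.dom i → GaugeRelAt (fun x ↦ u i (0, x)) (a i) (b₀ i) x)
    (h₁ : ∀ {i x}, x ∈ T.dom i → GaugeRelAt (fun x ↦ u i (1, x)) (a i) (b₁ i) x) :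
    IsExactForm (T.tp P k a b₁ - T.tp P k a b₀) := by
  have hs : ContMDiff (𝓘(ℝ, ℝ).prod I) I ∞ (Prod.snd : ℝ × M → M) := contMDiff_snd
  have ha' : T.cyl.IsConn fun i ↦ covPullback (𝓘(ℝ, ℝ).prod I) Prod.snd (a i) := ha.pull hs
  have hrel {i : ι} {p : ℝ × M} (hi : p ∈ T.cyl.dom i) :=
    gaugeRelAt_gaugeCov (hu.isUnit hi) (covPullback (𝓘(ℝ, ℝ).prod I) Prod.snd (a i))
  have := isExactForm_tp_slice hP ha' (ha'.gaugeCov hu) hu hrel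
  have hsl (s : ℝ) (i : ι) : covPullback I (fun x : M ↦ (s, x))
      (covPullback (𝓘(ℝ, ℝ).prod I) Prod.snd (a i)) = a i := by
    funext x p q
    exact covPullback_slice_snd s (a i) x p q
  have hb (s : ℝ) {b : ι → MatCov I M n}
      (h : ∀ {i x}, x ∈ T.dom i → GaugeRelAt (fun x ↦ u i (s, x)) (a i) (b i) x) {i : ι} {x : M}
      (hx : x ∈ T.dom i) : covPullback I (fun x : M ↦ (s, x)) (OddChernWeil.gaugeCov (u i)
        (covPullback (𝓘(ℝ, ℝ).prod I) Prod.snd (a i))) x = b i x := by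
    have h1 := (hrel (p := (s, x)) hx).comp ((contMDiff_slice s).mdifferentiableAt (by simp))
      (hu.smooth (x := (s, x)) hx)
    rw [hsl] at h1
    exact h1.eq (h hx) (hu.isUnit (x := (s, x)) hx)
  simp only [hsl] at this
  rwa [tp_congr (a := a) (a' := fun i ↦ covPullback I (fun x : M ↦ ((1 : ℝ), x)) _)
      (fun _ ↦ rfl) (hb 1 h₁),
    tp_congr (a := a) (a' := fun i ↦ covPullback I (fun x : M ↦ ((0 : ℝ), x)) _)
      (fun _ ↦ rfl) (hb 0 h₀)] at this

end FrameAtlas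
end GaugeAction

/-! ### Local frames of a bundle -/

section Frames

variable {V : Type*} [NormedAddCommGroup V] [NormedSpace ℝ V]
  {H : Type*} [TopologicalSpace H] {I : ModelWithCorners ℝ V H}
  {M : Type*} [TopologicalSpace M] [ChartedSpace H M]
  {n : ℕ} {E : M → Type*} [TopologicalSpace (TotalSpace (Fib n) E)]
  [∀ x, NormedAddCommGroup (E x)] [FiberBundle (Fib n) E]

variable (n E) in
/-- The domain of the preferred frame at `x₀`. -/
noncomputable abbrev frameDom (x₀ : M) : Set M := (trivializationAt (Fib n) E x₀).baseSet

theorem isOpen_frameDom (x₀ : M) : IsOpen (frameDom n E x₀ : Set M) :=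
  (trivializationAt (Fib n) E x₀).open_baseSet

theorem frameDom_mem_nhds {x₀ y : M} (hy : y ∈ frameDom n E x₀) : frameDom n E x₀ ∈ 𝓝 y :=
  (isOpen_frameDom x₀).mem_nhds hy

variable [∀ x, InnerProductSpace ℂ (E x)] [VectorBundle ℂ (Fib n) E]

theorem frameCoord_eq {x₀ y : M} (hy : y ∈ frameDom n E x₀) (i : Fin n) (v : E y) :
    frameCoord E x₀ i y v = (trivializationAt (Fib n) E x₀ ⟨y, v⟩).2 i := by
  simp only [frameCoord, ContinuousLinearMap.comp_apply]
  rw [Trivialization.continuousLinearMapAt_apply_of_mem ℂ _ hy]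
  rfl

theorem frameCoord_symmL {x₀ y : M} (hy : y ∈ frameDom n E x₀) (i : Fin n) (w : Fib n) :
    frameCoord E x₀ i y ((trivializationAt (Fib n) E x₀).symmL ℂ y w) = w i := by
  simp only [frameCoord, ContinuousLinearMap.comp_apply]
  rw [Trivialization.continuousLinearMapAt_symmL _ hy]
  rfl

theorem frameCoord_frame {x₀ y : M} (hy : y ∈ frameDom n E x₀) (i j : Fin n) :
    frameCoord E x₀ i y (frame E x₀ j y) = (1 : Matrix (Fin n) (Fin n) ℂ) i j := by
  rw [frame, frameCoord_symmL hy]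
  simp [Matrix.one_apply]

theorem sum_frameCoord_smul_frame {x₀ y : M} (hy : y ∈ frameDom n E x₀) (v : E y) :
    ∑ i : Fin n, frameCoord E x₀ i y v • frame E x₀ i y = v := by
  have h : ∀ w : Fib n, ∑ i, w i • EuclideanSpace.single i (1 : ℂ) = w := fun w ↦ by
    ext j
    simp [Pi.single_apply]
  rw [← Trivialization.symmL_continuousLinearMapAt (R := ℂ) (trivializationAt (Fib n) E x₀) hy v]
  conv_rhs => rw [← h ((trivializationAt (Fib n) E x₀).continuousLinearMapAt ℂ y v), map_sum]
  refine Finset.sum_congr rfl fun i _ ↦ ?_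
  rw [Trivialization.symmL_continuousLinearMapAt _ hy, map_smul]
  rfl

theorem ext_frameCoord {x₀ y : M} (hy : y ∈ frameDom n E x₀) {v w : E y}
    (h : ∀ i : Fin n, frameCoord E x₀ i y v = frameCoord E x₀ i y w) : v = w := by
  rw [← sum_frameCoord_smul_frame hy v, ← sum_frameCoord_smul_frame hy w]
  simp only [h]

variable (n E) in
/-- The transition matrix between two preferred frames: `e_j = ∑ i, g_{ij} e'_i`. -/
noncomputable def transMat (x₀ x₁ y : M) : Matrix (Fin n) (Fin n) ℂ :=
  Matrix.of fun i j ↦ frameCoord E x₀ i y (frame E x₁ j y)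

theorem transMat_self {x₀ y : M} (hy : y ∈ frameDom n E x₀) : transMat n E x₀ x₀ y = 1 := by
  ext i j
  exact frameCoord_frame hy i j

theorem transMat_mul {x₁ y : M} (hy : y ∈ frameDom n E x₁) (x₀ x₂ : M) :
    transMat n E x₀ x₁ y * transMat n E x₁ x₂ y = transMat n E x₀ x₂ y := by
  ext i j
  simp only [Matrix.mul_apply, transMat, Matrix.of_apply]
  conv_rhs => rw [← sum_frameCoord_smul_frame hy (frame E x₂ j y)]
  rw [map_sum]
  refine Finset.sum_congr rfl fun l _ ↦ ?_
  rw [map_smul, smul_eq_mul, mul_comm]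

theorem isUnit_det_transMat {x₀ x₁ y : M} (h₀ : y ∈ frameDom n E x₀) (h₁ : y ∈ frameDom n E x₁) :
    IsUnit (transMat n E x₀ x₁ y).det :=
  (Matrix.isUnit_iff_isUnit_det _).1 <| IsUnit.of_mul_eq_one (transMat n E x₁ x₀ y)
    (by rw [transMat_mul h₁, transMat_self h₀])

theorem frameCoord_eq_sum {x₁ x : M} (hx : x ∈ frameDom n E x₁) (x₀ : M) (i : Fin n) (v : E x) :
    frameCoord E x₀ i x v = ∑ j, transMat n E x₀ x₁ x i j * frameCoord E x₁ j x v := by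
  conv_lhs => rw [← sum_frameCoord_smul_frame hx v, map_sum]
  refine Finset.sum_congr rfl fun j _ ↦ ?_
  rw [map_smul, smul_eq_mul, mul_comm]
  rfl

section Smooth

omit [VectorBundle ℂ (Fib n) E] in
theorem contMDiffAt_euclidean_iff {f : M → Fib n} {y : M} : ContMDiffAt I 𝓘(ℝ, Fib n) ∞ f y ↔
    ∀ i, ContMDiffAt I 𝓘(ℝ, ℂ) ∞ (fun z ↦ f z i) y := by
  let L : Fib n ≃L[ℝ] (Fin n → ℂ) := PiLp.continuousLinearEquiv 2 ℝ fun _ : Fin n ↦ ℂ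
  rw [← contMDiffAt_pi_space]
  refine ⟨fun h ↦ (L.contDiff (n := ∞)).contMDiff.contMDiffAt.comp y h, fun h ↦ ?_⟩
  exact (L.symm.contDiff (n := ∞)).contMDiff.contMDiffAt.comp y h

variable [VectorBundle ℝ (Fib n) E] [ContMDiffVectorBundle ∞ (Fib n) E I]

theorem contMDiffAt_section_iff_frameCoord {σ : ∀ x, E x} {x₀ y : M} (hy : y ∈ frameDom n E x₀) :
    ContMDiffAt I (I.prod 𝓘(ℝ, Fib n)) ∞ (fun z ↦ TotalSpace.mk' (Fib n) z (σ z)) y ↔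
      ∀ i : Fin n, ContMDiffAt I 𝓘(ℝ, ℂ) ∞ (fun z ↦ frameCoord E x₀ i z (σ z)) y := by
  rw [Trivialization.contMDiffAt_section_iff (trivializationAt (Fib n) E x₀) hy,
    contMDiffAt_euclidean_iff]
  refine forall_congr' fun i ↦ EventuallyEq.contMDiffAt_iff ?_
  filter_upwards [frameDom_mem_nhds hy] with z hz using (frameCoord_eq hz i (σ z)).symm

theorem contMDiffAt_frame {x₀ y : M} (hy : y ∈ frameDom n E x₀) (j : Fin n) :
    ContMDiffAt I (I.prod 𝓘(ℝ, Fib n)) ∞ (fun z ↦ TotalSpace.mk' (Fib n) z (frame E x₀ j z)) y := by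
  refine (contMDiffAt_section_iff_frameCoord hy).2 fun i ↦ ?_
  refine contMDiffAt_const (c := (1 : Matrix (Fin n) (Fin n) ℂ) i j) |>.congr_of_eventuallyEq ?_
  filter_upwards [frameDom_mem_nhds hy] with z hz using frameCoord_frame hz i j

theorem isDiffSectionAt_frame {x₀ y : M} (hy : y ∈ frameDom n E x₀) (j : Fin n) :
    IsDiffSectionAt I n (frame E x₀ j) y :=
  (contMDiffAt_frame hy j).mdifferentiableAt (by simp)

theorem matSmoothAtM_transMat {x₀ x₁ y : M} (h₀ : y ∈ frameDom n E x₀) (h₁ : y ∈ frameDom n E x₁) :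
    MatSmoothAtM I (transMat n E x₀ x₁) y := fun i j ↦
  (contMDiffAt_section_iff_frameCoord h₀).1 (contMDiffAt_frame h₁ j) i

variable (I n E) in
/-- The cocycle of a vector bundle given by its preferred frames. -/
@[simps]
noncomputable def frameAtlas : FrameAtlas I M n M where
  dom := frameDom n E
  isOpen_dom := isOpen_frameDom
  ind := id
  mem_dom := mem_baseSet_trivializationAt (Fib n) E
  trans := transMat n E
  smooth_trans := matSmoothAtM_transMat
  isUnit_trans := isUnit_det_transMat

end Smooth

end Frames

/-! ### Connections in local frames -/

section Connections

variable {V : Type*} [NormedAddCommGroup V] [NormedSpace ℝ V]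
  {H : Type*} [TopologicalSpace H] {I : ModelWithCorners ℝ V H}
  {M : Type*} [TopologicalSpace M] [ChartedSpace H M]
  {n : ℕ} {E : M → Type*} [TopologicalSpace (TotalSpace (Fib n) E)]
  [∀ x, NormedAddCommGroup (E x)] [∀ x, InnerProductSpace ℂ (E x)]
  [FiberBundle (Fib n) E] [VectorBundle ℂ (Fib n) E] [VectorBundle ℝ (Fib n) E]
  [ContMDiffVectorBundle ∞ (Fib n) E I]

theorem mdifferentiableAt_euclidean_iff {f : M → Fib n} {y : M} :
    MDifferentiableAt I 𝓘(ℝ, Fib n) f y ↔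
      ∀ i, MDifferentiableAt I 𝓘(ℝ, ℂ) (fun z ↦ f z i) y := by
  let L : Fib n ≃L[ℝ] (Fin n → ℂ) := PiLp.continuousLinearEquiv 2 ℝ fun _ : Fin n ↦ ℂ
  have hp (g : M → Fin n → ℂ) : MDifferentiableAt I 𝓘(ℝ, Fin n → ℂ) g y ↔
      ∀ i, MDifferentiableAt I 𝓘(ℝ, ℂ) (fun z ↦ g z i) y := by
    simp only [mdifferentiableAt_iff, continuousAt_pi, differentiableWithinAt_pi, forall_and]
    exact Iff.rfl
  refine Iff.trans ?_ (hp fun z ↦ L (f z))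
  refine ⟨fun h ↦ L.differentiableAt.mdifferentiableAt.comp y h, fun h ↦ ?_⟩
  exact MDifferentiableAt.comp (g := L.symm) y L.symm.differentiableAt.mdifferentiableAt h

theorem isDiffSectionAt_iff_frameCoord {σ : ∀ x, E x} {x₀ y : M} (hy : y ∈ frameDom n E x₀) :
    IsDiffSectionAt I n σ y ↔
      ∀ i : Fin n, MDifferentiableAt I 𝓘(ℝ, ℂ) (fun z ↦ frameCoord E x₀ i z (σ z)) y := by
  have : ContMDiffVectorBundle 1 (Fib n) E I := ContMDiffVectorBundle.of_le ENat.LEInfty.out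
  refine ((trivializationAt (Fib n) E x₀).mdifferentiableAt_section_iff I σ hy).trans
    (mdifferentiableAt_euclidean_iff.trans ?_)
  refine forall_congr' fun i ↦ EventuallyEq.mdifferentiableAt_iff ?_
  filter_upwards [frameDom_mem_nhds hy] with z hz using (frameCoord_eq hz i (σ z)).symm

theorem IsDiffSectionAt.complex_smul {σ : ∀ x, E x} {y : M} (hσ : IsDiffSectionAt I n σ y)
    {f : M → ℂ} (hf : MDifferentiableAt I 𝓘(ℝ, ℂ) f y) :
    IsDiffSectionAt I n (fun z ↦ f z • σ z) y := by
  have hy := mem_baseSet_trivializationAt (Fib n) E y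
  refine (isDiffSectionAt_iff_frameCoord hy).2 fun i ↦ ?_
  simp only [map_smul, smul_eq_mul]
  exact hf.mul ((isDiffSectionAt_iff_frameCoord hy).1 hσ i)

theorem IsDiffSectionAt.sum {κ : Type} (s : Finset κ) {σ : κ → ∀ x, E x} {y : M}
    (hσ : ∀ j ∈ s, IsDiffSectionAt I n (σ j) y) :
    IsDiffSectionAt I n (fun z ↦ ∑ j ∈ s, σ j z) y := by
  have hy := mem_baseSet_trivializationAt (Fib n) E y
  refine (isDiffSectionAt_iff_frameCoord hy).2 fun i ↦ ?_
  simp only [map_sum]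
  have hm : ∀ j ∈ s, MDifferentiableAt I 𝓘(ℝ, ℂ) (fun z ↦ frameCoord E y i z (σ j z)) y :=
    fun j hj ↦ (isDiffSectionAt_iff_frameCoord hy).1 (hσ j hj) i
  have := MDifferentiableAt.sum hm
  refine this.congr_of_eventuallyEq (Eventually.of_forall fun z ↦ ?_)
  rw [Finset.sum_apply]

section FrameFormula

variable [IsManifold I 1 M]

/-- The Leibniz rule for complex functions, from the one for real functions and complex
linearity. -/
theorem IsHermitianConnection.leibniz_complex {cov : Operator I E}
    (h : IsHermitianConnection n cov) {σ : ∀ x, E x} {x : M} (hσ : IsDiffSectionAt I n σ x)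
    {f : M → ℂ} (hf : MDifferentiableAt I 𝓘(ℝ, ℂ) f x) (v : TangentSpace I x) :
    cov (fun y ↦ f y • σ y) x v = f x • cov σ x v + (mvfderiv I f x v : ℂ) • σ x := by
  have hd (L : ℂ →L[ℝ] ℝ) : HasMFDerivAt I 𝓘(ℝ, ℝ) (fun y ↦ L (f y)) x
      (L.comp (mvfderiv I f x)) :=
    HasMFDerivAt.comp x (L.hasFDerivAt.hasMFDerivAt) hf.hasMFDerivAt
  have hi : IsDiffSectionAt I n (fun y ↦ Complex.I • σ y) x :=
    hσ.complex_smul mdifferentiableAt_const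
  have e : (fun y ↦ f y • σ y) = (fun y ↦ Complex.reCLM (f y)) • σ +
      (fun y ↦ Complex.imCLM (f y)) • fun y ↦ Complex.I • σ y := by
    funext y
    change f y • σ y = (f y).re • σ y + (f y).im • Complex.I • σ y
    conv_lhs => rw [← Complex.re_add_im (f y)]
    rw [add_smul, mul_smul, Complex.coe_smul, Complex.coe_smul]
  have h1 : IsDiffSectionAt I n ((fun y ↦ Complex.reCLM (f y)) • σ) x :=
    (hd Complex.reCLM).mdifferentiableAt.smul_section hσ
  have h2 : IsDiffSectionAt I n ((fun y ↦ Complex.imCLM (f y)) • fun y ↦ Complex.I • σ y) x :=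
    (hd Complex.imCLM).mdifferentiableAt.smul_section hi
  rw [e, h.isCovariantDerivative.add h1 h2,
    h.isCovariantDerivative.leibniz hσ (hd Complex.reCLM).mdifferentiableAt,
    h.isCovariantDerivative.leibniz hi (hd Complex.imCLM).mdifferentiableAt]
  have e1 : mvfderiv I (fun y ↦ Complex.reCLM (f y)) x v = (mvfderiv I f x v).re :=
    congrArg (fun L : V →L[ℝ] ℝ ↦ L v) (hd Complex.reCLM).mfderiv
  have e2 : mvfderiv I (fun y ↦ Complex.imCLM (f y)) x v = (mvfderiv I f x v).im :=
    congrArg (fun L : V →L[ℝ] ℝ ↦ L v) (hd Complex.imCLM).mfderiv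
  change ((f x).re • cov σ x v + mvfderiv I (fun y ↦ Complex.reCLM (f y)) x v • σ x) +
    ((f x).im • cov (fun y ↦ Complex.I • σ y) x v +
      mvfderiv I (fun y ↦ Complex.imCLM (f y)) x v • Complex.I • σ x) = _
  rw [e1, e2, h.complex_linear _ _ _ hσ]
  conv_rhs => rw [← Complex.re_add_im (f x), ← Complex.re_add_im (mvfderiv I f x v)]
  simp only [add_smul, mul_smul, Complex.coe_smul]
  abel

theorem IsHermitianConnection.cov_sum {cov : Operator I E}
    (h : IsHermitianConnection n cov) {κ : Type} (s : Finset κ) {σ : κ → ∀ x, E x} {x : M}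
    (hσ : ∀ j ∈ s, IsDiffSectionAt I n (σ j) x) (v : TangentSpace I x) :
    cov (fun y ↦ ∑ j ∈ s, σ j y) x v = ∑ j ∈ s, cov (σ j) x v := by
  classical
  induction s using Finset.induction_on with
  | empty =>
    have := h.isCovariantDerivative.zero (x := x)
    simp only [Finset.sum_empty]
    exact (congrArg (fun L : TangentSpace I x →L[ℝ] E x ↦ L v) this)
  | insert a s ha ih =>
    have hs : ∀ j ∈ s, IsDiffSectionAt I n (σ j) x := fun j hj ↦ hσ j (Finset.mem_insert_of_mem hj)
    rw [Finset.sum_insert ha, ← ih hs]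
    have e : (fun y ↦ ∑ j ∈ insert a s, σ j y) = σ a + fun y ↦ ∑ j ∈ s, σ j y := by
      funext y
      rw [Finset.sum_insert ha]
      rfl
    rw [e, h.isCovariantDerivative.add (hσ a (Finset.mem_insert_self a s)) (IsDiffSectionAt.sum s hs)]
    rfl

/-- A connection in a local frame: `∇ = d + ω` on coordinate vectors. -/
theorem IsHermitianConnection.frameCoord_cov {cov : Operator I E}
    (h : IsHermitianConnection n cov) {σ : ∀ x, E x} {x₀ x : M} (hx : x ∈ frameDom n E x₀)
    (hσ : IsDiffSectionAt I n σ x) (i : Fin n) (v : TangentSpace I x) :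
    frameCoord E x₀ i x (cov σ x v) = mvfderiv I (fun y ↦ frameCoord E x₀ i y (σ y)) x v +
      ∑ j, connForm cov x₀ i j x v * frameCoord E x₀ j x (σ x) := by
  have hc (j : Fin n) := (isDiffSectionAt_iff_frameCoord hx).1 hσ j
  have hd (j : Fin n) : IsDiffSectionAt I n
      (fun y ↦ frameCoord E x₀ j y (σ y) • frame E x₀ j y) x :=
    (isDiffSectionAt_frame hx j).complex_smul (hc j)
  have e : cov σ x = cov (fun y ↦ ∑ j : Fin n, frameCoord E x₀ j y (σ y) • frame E x₀ j y) x := by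
    refine h.isCovariantDerivative.congr_of_eventuallyEq hσ (IsDiffSectionAt.sum _ fun j _ ↦ hd j)
      univ_mem ?_
    filter_upwards [frameDom_mem_nhds hx] with y hy using (sum_frameCoord_smul_frame hy _).symm
  rw [e, h.cov_sum _ (fun j _ ↦ hd j), map_sum]
  simp only [fun j ↦ h.leibniz_complex (isDiffSectionAt_frame hx j) (hc j) v, map_add, map_smul,
    Finset.sum_add_distrib, frameCoord_frame hx, smul_eq_mul]
  rw [add_comm]
  congr 1
  · simp [Matrix.one_apply]
  · refine Finset.sum_congr rfl fun j _ ↦ mul_comm _ _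

theorem IsHermitianConnection.gaugeRelAt_connForm {cov : Operator I E}
    (h : IsHermitianConnection n cov) {x₀ x₁ x : M} (h₀ : x ∈ frameDom n E x₀)
    (h₁ : x ∈ frameDom n E x₁) : GaugeRelAt (transMat n E x₀ x₁)
      (fun y i j ↦ connForm cov x₀ i j y) (fun y i j ↦ connForm cov x₁ i j y) x := by
  intro w
  ext i j
  have := h.frameCoord_cov h₀ (isDiffSectionAt_frame h₁ j) i w
  rw [frameCoord_eq_sum h₁ x₀] at this
  rw [Matrix.add_apply, add_comm]
  exact this

end FrameFormula

section SmoothConnForm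

variable [IsManifold I ∞ M] [I.Boundaryless] [FiniteDimensional ℝ V] [T2Space M]

omit [∀ x, InnerProductSpace ℂ (E x)] [VectorBundle ℂ (Fib n) E] [VectorBundle ℝ (Fib n) E]
  [ContMDiffVectorBundle ∞ (Fib n) E I] [I.Boundaryless] in
/-- Every point of a frame domain has a cutoff function supported in this domain. -/
theorem exists_cutoff {x₀ x : M} (hx : x ∈ frameDom n E x₀) :
    ∃ ψ : M → ℝ, ContMDiff I 𝓘(ℝ, ℝ) ∞ ψ ∧ tsupport ψ ⊆ frameDom n E x₀ ∧ ∀ᶠ y in 𝓝 x, ψ y = 1 := by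
  obtain ⟨ψ, -, hψ⟩ := (SmoothBumpFunction.nhds_basis_tsupport (I := I) x).mem_iff.1
    (frameDom_mem_nhds hx)
  exact ⟨ψ, ψ.contMDiff, hψ, ψ.eventuallyEq_one⟩

omit [I.Boundaryless] in
theorem exists_global_section {x₀ x : M} (hx : x ∈ frameDom n E x₀)
    (j : Fin n) : ∃ σ : ∀ x, E x,
      ContMDiff I (I.prod 𝓘(ℝ, Fib n)) ∞ (fun z ↦ TotalSpace.mk' (Fib n) z (σ z)) ∧
      ∀ᶠ y in 𝓝 x, σ y = frame E x₀ j y := by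
  obtain ⟨ψ, hψ, hs, h1⟩ := exists_cutoff (I := I) hx
  refine ⟨fun y ↦ ψ y • frame E x₀ j y, ?_, ?_⟩
  · exact ContMDiffOn.smul_section_of_tsupport hψ.contMDiffOn (isOpen_frameDom x₀) hs
      fun y hy ↦ (contMDiffAt_frame hy j).contMDiffWithinAt
  · filter_upwards [h1] with y hy
    rw [hy, one_smul]

theorem IsHermitianConnection.smoothCovAt_connForm {cov : Operator I E}
    (h : IsHermitianConnection n cov) {x₀ x : M} (hx : x ∈ frameDom n E x₀) :
    SmoothCovAt (fun y (i j : Fin n) ↦ connForm cov x₀ i j y) x := by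
  intro i j
  obtain ⟨σ, hσ, he⟩ := exists_global_section (I := I) hx j
  have hI : IsManifold I (∞ + 1) M := ‹IsManifold I ∞ M›
  have hT : ContMDiffVectorBundle ∞ V (TangentSpace I : M → Type _) I := inferInstance
  have h1 := (h.smooth.contMDiff (σ := σ) (contMDiffOn_univ.2 hσ)).contMDiffAt univ_mem (x := x)
  rw [Trivialization.contMDiffAt_section_iff
    ((trivializationAt V (TangentSpace I) x).continuousLinearMap (RingHom.id ℝ)
      (trivializationAt (Fib n) E x₀))
    ⟨mem_baseSet_trivializationAt V (TangentSpace I) x, hx⟩] at h1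
  have h2 := (contMDiffAt_iff.1 h1).2
  rw [I.range_eq_univ, contDiffWithinAt_univ] at h2
  refine smoothFormAt_oneForm_iff.2 fun v ↦ ?_
  have h3 : ContDiffAt ℝ ∞ (fun y ↦ ((trivializationAt V (TangentSpace I) x).continuousLinearMap
      (RingHom.id ℝ) (trivializationAt (Fib n) E x₀)
        ⟨(extChartAt I x).symm y, cov σ ((extChartAt I x).symm y)⟩).2 v i) (extChartAt I x x) :=
    (((EuclideanSpace.proj i : Fib n →L[ℂ] ℂ).restrictScalars ℝ).contDiff.contDiffAt).comp _
      (h2.clm_apply contDiffAt_const)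
  refine h3.congr_of_eventuallyEq ?_
  filter_upwards [eventually_symm (I := I) (he.eventually_nhds.and (frameDom_mem_nhds hx))]
    with y hy
  have hcov : cov σ ((extChartAt I x).symm y) = cov (frame E x₀ j) ((extChartAt I x).symm y) :=
    h.isCovariantDerivative.congr_of_eventuallyEq (hσ.contMDiffAt.mdifferentiableAt (by simp))
      (isDiffSectionAt_frame hy.2.2 j) univ_mem hy.2.1
  rw [hcov, Trivialization.continuousLinearMap_apply, connForm]
  have ht := TangentBundle.symmL_trivializationAt (I := I) (x₀ := x)
    (x := (extChartAt I x).symm y) (by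
      rw [← extChartAt_source I]; exact (extChartAt I x).map_target hy.1)
  rw [(extChartAt I x).right_inv hy.1] at ht
  simp only [ContinuousLinearMap.comp_apply]
  rw [ht, Trivialization.continuousLinearMapAt_apply_of_mem ℝ _ hy.2.2]
  exact frameCoord_eq hy.2.2 i _

/-- The connection matrices of a connection in the preferred frames. -/
theorem IsHermitianConnection.isConn {cov : Operator I E} (h : IsHermitianConnection n cov) :
    (frameAtlas I n E).IsConn fun x₀ y (i j : Fin n) ↦ connForm cov x₀ i j y where
  smooth hi := h.smoothCovAt_connForm hi
  gauge hi hj := h.gaugeRelAt_connForm hi hj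

end SmoothConnForm

end Connections

/-! ### Chern-Weil forms of a bundle in local frames -/

section BundleForms

variable {V : Type*} [NormedAddCommGroup V] [NormedSpace ℝ V]
  {H : Type*} [TopologicalSpace H] {I : ModelWithCorners ℝ V H}
  {M : Type*} [TopologicalSpace M] [ChartedSpace H M]
  {n : ℕ} {E : M → Type*} [TopologicalSpace (TotalSpace (Fib n) E)]
  [∀ x, NormedAddCommGroup (E x)] [∀ x, InnerProductSpace ℂ (E x)]
  [FiberBundle (Fib n) E] [VectorBundle ℂ (Fib n) E]

theorem isUnit_det_basisChange (x : M) : IsUnit (basisChange (n := n) E x).det := by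
  refine (Matrix.isUnit_iff_isUnit_det _).1 <| IsUnit.of_mul_eq_one
    (Matrix.of fun l j ↦ (fibreBasis (n := n) E x).repr (frame E x j x) l) ?_
  ext i j
  rw [← frameCoord_frame (mem_baseSet_trivializationAt (Fib n) E x) i j]
  conv_rhs => rw [← (fibreBasis (n := n) E x).sum_repr (frame E x j x), map_sum]
  simp only [Matrix.mul_apply, basisChange, Matrix.of_apply]
  refine Finset.sum_congr rfl fun l _ ↦ ?_
  rw [map_smul, smul_eq_mul, mul_comm]

/-- By invariance of the polynomial, the Chern-Weil form may be computed with the connection matrix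
in any frame instead of an orthonormal basis. -/
theorem chernWeil_apply {P : MvPolynomial (Fin n × Fin n) ℂ} {k : ℕ}
    (hP : IsConjInvariant (polarization P k)) (cov : Operator I E) (x : M) :
    chernWeil P k cov x = cwForm P k (fun y i j ↦ connForm cov x i j y) x := by
  have hb := isUnit_det_basisChange (n := n) (E := E) x
  refine polyForm_conj hP hb fun v ↦ ?_
  have e : formMatrix (unitaryCurvature cov x) v = (basisChange E x)⁻¹ *
      (formMatrix (curvForm (fun y (i j : Fin n) ↦ connForm cov x i j y) x) v) *
        basisChange E x := by
    ext i j
    simp only [formMatrix, Matrix.of_apply, Matrix.mul_apply, unitaryCurvature, Finset.sum_mul]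
    rw [Finset.sum_comm]
    simp only [ContinuousAlternatingMap.sum_apply, ContinuousAlternatingMap.smul_apply]
    refine Finset.sum_congr rfl fun l _ ↦ Finset.sum_congr rfl fun q _ ↦ ?_
    rw [smul_eq_mul, mul_right_comm]
    rfl
  rw [e, Matrix.mul_assoc, Matrix.mul_nonsing_inv_cancel_left _ _ hb]

section Pullback

variable {M' : Type*} [TopologicalSpace M'] {K : Type*} [FunLike K M' M]
  [ContinuousMapClass K M' M] (f : K)

theorem symmL_pull (x₀ y : M') (w : Fib n) :
    (trivializationAt (Fib n) (Pull f E) x₀).symmL ℂ y w =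
      (trivializationAt (Fib n) E (f x₀)).symmL ℂ (f y) w := by
  by_cases hy : f y ∈ frameDom n E (f x₀)
  · have hy' : y ∈ frameDom n (Pull f E) x₀ := hy
    exact ext_frameCoord (E := E) hy fun i ↦
      (frameCoord_symmL (E := Pull f E) hy' i w).trans (frameCoord_symmL hy i w).symm
  · have hy' : y ∉ frameDom n (Pull f E) x₀ := hy
    rw [Trivialization.symmL_apply_of_notMem _ hy, Trivialization.symmL_apply_of_notMem _ hy']
    rfl

theorem frame_pull (x₀ : M') (j : Fin n) (y : M') :
    frame (Pull f E) x₀ j y = frame E (f x₀) j (f y) :=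
  symmL_pull f x₀ y _

end Pullback

section PathConnection

/-- In the frames pulled back from `M`, the connection `d/dt + (1 - t) ∇₀ + t ∇₁` has the matrix
`(1 - t) ω₀ + t ω₁` without `dt`-component, as these frames do not depend on `t`. -/
theorem connForm_pathConnection (cov₀ cov₁ : Operator I E) (p q : ℝ × M) (i j : Fin n) :
    connForm (E := Pull (ContMDiffMap.snd : C^∞⟮𝓘(ℝ, ℝ).prod I, ℝ × M; I, M⟯) E)
      (pathConnection cov₀ cov₁) p i j q =
      pathCov (fun y i j ↦ connForm cov₀ p.2 i j y) (fun y i j ↦ connForm cov₁ p.2 i j y) q i j := by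
  have hs (t : ℝ) : (fun x : M ↦ frame (Pull (ContMDiffMap.snd :
      C^∞⟮𝓘(ℝ, ℝ).prod I, ℝ × M; I, M⟯) E) p j (t, x)) = frame E p.2 j := by
    funext x
    exact frame_pull _ p j (t, x)
  have hd : deriv (F := E q.2) (fun t : ℝ ↦ (frame (Pull (ContMDiffMap.snd :
      C^∞⟮𝓘(ℝ, ℝ).prod I, ℝ × M; I, M⟯) E) p j (t, q.2) : E q.2)) q.1 = 0 := by
    have : (fun t : ℝ ↦ (frame (Pull (ContMDiffMap.snd :
        C^∞⟮𝓘(ℝ, ℝ).prod I, ℝ × M; I, M⟯) E) p j (t, q.2) : E q.2)) =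
        fun _ ↦ frame E p.2 j q.2 := by
      funext t
      exact frame_pull _ p j (t, q.2)
    rw [this, deriv_const]
  have hsnd (w : ℝ × V) : (mfderiv (𝓘(ℝ, ℝ).prod I) I (Prod.snd : ℝ × M → M) q w : V) = w.2 := by
    rw [mfderiv_snd]
    rfl
  ext w
  have e : pathConnection cov₀ cov₁ (frame (Pull (ContMDiffMap.snd :
      C^∞⟮𝓘(ℝ, ℝ).prod I, ℝ × M; I, M⟯) E) p j) q w = w.1 • (0 : E q.2) +
        ((1 - q.1) • cov₀ (frame E p.2 j) q.2 w.2 + q.1 • cov₁ (frame E p.2 j) q.2 w.2) := by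
    rw [← hd, ← hs q.1]
    rfl
  refine (congrArg (frameCoord E p.2 i q.2) e).trans ?_
  rw [smul_zero, zero_add, map_add, ← Complex.coe_smul, ← Complex.coe_smul, map_smul, map_smul]
  exact congrArg₂ (fun X Y : V ↦ ((1 - q.1 : ℝ) : ℂ) • connForm cov₀ p.2 i j q.2 X +
    ((q.1 : ℝ) : ℂ) • connForm cov₁ p.2 i j q.2 Y) (hsnd w).symm (hsnd w).symm

end PathConnection

section Transgression

variable [VectorBundle ℝ (Fib n) E] [ContMDiffVectorBundle ∞ (Fib n) E I]

theorem transgression_eq {P : MvPolynomial (Fin n × Fin n) ℂ} {k : ℕ}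
    (hP : IsConjInvariant (polarization P (k + 1))) (cov₀ cov₁ : Operator I E) :
    transgression P k cov₀ cov₁ = (frameAtlas I n E).tp P k
      (fun x₀ y i j ↦ connForm cov₀ x₀ i j y) fun x₀ y i j ↦ connForm cov₁ x₀ i j y := by
  refine congrArg fibreIntegral ?_
  funext p
  refine (chernWeil_apply hP _ p).trans ?_
  simp only [connForm_pathConnection]
  rfl

end Transgression

end BundleForms

/-! ### Unitary gauge transformations in local frames -/

section Automorphisms

variable {V : Type*} [NormedAddCommGroup V] [NormedSpace ℝ V]
  {H : Type*} [TopologicalSpace H] {I : ModelWithCorners ℝ V H}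
  {M : Type*} [TopologicalSpace M] [ChartedSpace H M]
  {n : ℕ} {E : M → Type*} [TopologicalSpace (TotalSpace (Fib n) E)]
  [∀ x, NormedAddCommGroup (E x)] [∀ x, InnerProductSpace ℂ (E x)]
  [FiberBundle (Fib n) E] [VectorBundle ℂ (Fib n) E]

variable (n) in
/-- The matrix of a family of endomorphisms of the fibres in the frame at `x₀`. -/
noncomputable def endMat (A : ∀ x, E x →L[ℝ] E x) (x₀ x : M) : Matrix (Fin n) (Fin n) ℂ :=
  Matrix.of fun i j ↦ frameCoord E x₀ i x (A x (frame E x₀ j x))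

theorem frameCoord_apply {A : ∀ x, E x →L[ℝ] E x} {x₀ x : M}
    (hA : ∀ (c : ℂ) v, A x (c • v) = c • A x v) (hx : x ∈ frameDom n E x₀) (x₁ : M) (i : Fin n)
    (v : E x) : frameCoord E x₁ i x (A x v) =
      ∑ l : Fin n, frameCoord E x₁ i x (A x (frame E x₀ l x)) * frameCoord E x₀ l x v := by
  conv_lhs => rw [← sum_frameCoord_smul_frame hx v, map_sum, map_sum]
  refine Finset.sum_congr rfl fun l _ ↦ ?_
  rw [hA, map_smul, smul_eq_mul, mul_comm]

theorem transMat_mul_endMat {A : ∀ x, E x →L[ℝ] E x} {x₀ x₁ x : M}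
    (hA : ∀ (c : ℂ) v, A x (c • v) = c • A x v) (h₀ : x ∈ frameDom n E x₀)
    (h₁ : x ∈ frameDom n E x₁) :
    transMat n E x₀ x₁ x * endMat n A x₁ x = endMat n A x₀ x * transMat n E x₀ x₁ x := by
  ext i j
  exact (frameCoord_eq_sum h₁ x₀ i _).symm.trans (frameCoord_apply hA h₀ x₀ i (frame E x₁ j x))

theorem isUnit_det_endMat {A B : ∀ x, E x →L[ℝ] E x} {x₀ x : M}
    (hA : ∀ (c : ℂ) v, A x (c • v) = c • A x v) (hx : x ∈ frameDom n E x₀)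
    (h : ∀ v, A x (B x v) = v) : IsUnit (endMat n A x₀ x).det := by
  refine (Matrix.isUnit_iff_isUnit_det _).1 <| IsUnit.of_mul_eq_one (endMat n B x₀ x) ?_
  ext i j
  refine (frameCoord_apply hA hx x₀ i (B x (frame E x₀ j x))).symm.trans ?_
  rw [h, frameCoord_frame hx]

omit [TopologicalSpace M] in
theorem unitaryCLM_smul {x : M} (u : E x ≃ₗᵢ[ℂ] E x) (c : ℂ) (v : E x) :
    unitaryCLM u (c • v) = c • unitaryCLM u v :=
  u.map_smul c v

variable [VectorBundle ℝ (Fib n) E] [ContMDiffVectorBundle ∞ (Fib n) E I]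

theorem matSmoothAtM_endMat {A : ∀ x, E x →L[ℝ] E x} {x₀ x : M} (hx : x ∈ frameDom n E x₀)
    (hA : ContMDiffAt I (I.prod 𝓘(ℝ, Fib n →L[ℝ] Fib n)) ∞
      (fun x ↦ TotalSpace.mk' (Fib n →L[ℝ] Fib n) (E := fun x ↦ E x →L[ℝ] E x) x (A x)) x) :
    MatSmoothAtM I (endMat n A x₀) x := by
  intro i j
  have h1 := (Trivialization.contMDiffAt_section_iff
    ((trivializationAt (Fib n) E x₀).continuousLinearMap (RingHom.id ℝ)
      (trivializationAt (Fib n) E x₀)) ⟨hx, hx⟩).1 hA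
  let L : (Fib n →L[ℝ] Fib n) →L[ℝ] ℂ := ((EuclideanSpace.proj i : Fib n →L[ℂ] ℂ).restrictScalars
    ℝ).comp (ContinuousLinearMap.apply ℝ (Fib n) (EuclideanSpace.single j (1 : ℂ)))
  refine ((L.contDiff (n := ∞)).contMDiff.contMDiffAt.comp x h1).congr_of_eventuallyEq ?_
  filter_upwards [frameDom_mem_nhds hx] with z hz
  rw [Function.comp_apply, Trivialization.continuousLinearMap_apply]
  simp only [endMat, Matrix.of_apply]
  rw [frameCoord_eq hz]
  change _ = ((trivializationAt (Fib n) E x₀).continuousLinearMapAt ℝ z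
    (A z ((trivializationAt (Fib n) E x₀).symmL ℝ z (EuclideanSpace.single j 1)))) i
  rw [Trivialization.continuousLinearMapAt_apply_of_mem ℝ _ hz, frame,
    Trivialization.symmL_apply _ hz, Trivialization.symmL_apply _ hz]

theorem IsGauge.isAut {U : ∀ x, E x ≃ₗᵢ[ℂ] E x} (hU : IsGauge I n U) :
    (frameAtlas I n E).IsAut (endMat n fun x ↦ unitaryCLM (U x)) where
  smooth hi := matSmoothAtM_endMat hi hU.contMDiffAt
  isUnit hi := isUnit_det_endMat (B := fun x ↦ unitaryCLM (U x).symm) (unitaryCLM_smul _) hi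
    fun v ↦ (U _).apply_symm_apply v
  trans_mul hi hj := transMat_mul_endMat (unitaryCLM_smul _) hi hj

theorem IsHermitianConnection.gaugeRelAt_gaugeConj [IsManifold I 1 M] {cov : Operator I E}
    (h : IsHermitianConnection n cov) {U : ∀ x, E x ≃ₗᵢ[ℂ] E x} (hU : IsGauge I n U) {x₀ x : M}
    (hx : x ∈ frameDom n E x₀) : GaugeRelAt (endMat n (fun x ↦ unitaryCLM (U x)) x₀)
      (fun y i j ↦ connForm cov x₀ i j y) (fun y i j ↦ connForm (gaugeConj U cov) x₀ i j y) x := by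
  intro w
  ext i j
  have hσ : IsDiffSectionAt I n (fun y ↦ U y (frame E x₀ j y)) x :=
    (isDiffSectionAt_iff_frameCoord hx).2 fun l ↦
      (matSmoothAtM_endMat hx hU.contMDiffAt).mdifferentiableAt l j
  have h1 := h.frameCoord_cov hx hσ i w
  have h2 := frameCoord_apply (A := fun x ↦ unitaryCLM (U x)) (unitaryCLM_smul (U x)) hx x₀ i
    (unitaryCLM (U x).symm (cov (fun y ↦ U y (frame E x₀ j y)) x w))
  have h3 : unitaryCLM (U x) (unitaryCLM (U x).symm (cov (fun y ↦ U y (frame E x₀ j y)) x w)) =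
    cov (fun y ↦ U y (frame E x₀ j y)) x w := (U x).apply_symm_apply _
  rw [h3, h1, add_comm] at h2
  exact h2.symm

variable [IsManifold I ∞ M] [I.Boundaryless] [FiniteDimensional ℝ V] [T2Space M]

omit [T2Space M] in
theorem FrameAtlas.IsConn.of_gaugeRelAt {ι : Type*} {T : FrameAtlas I M n ι}
    {a b : ι → MatCov I M n} {u : ι → M → Matrix (Fin n) (Fin n) ℂ} (ha : T.IsConn a)
    (hu : T.IsAut u) (h : ∀ {i x}, x ∈ T.dom i → GaugeRelAt (u i) (a i) (b i) x) :
    T.IsConn b := by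
  have hc := ha.gaugeCov hu
  have e {i : ι} {x : M} (hi : x ∈ T.dom i) : b i x = OddChernWeil.gaugeCov (u i) (a i) x :=
    (h hi).eq (gaugeRelAt_gaugeCov (hu.isUnit hi) (a i)) (hu.isUnit hi)
  refine ⟨fun {i x} hi ↦ (hc.smooth hi).congr ?_, fun {i j x} hi hj w ↦ ?_⟩
  · filter_upwards [T.dom_mem_nhds hi] with y hy using e hy
  · rw [e hi, e hj]
    exact hc.gauge hi hj w

theorem IsHermitianConnection.isConn_gaugeConj {cov : Operator I E}
    (h : IsHermitianConnection n cov) {U : ∀ x, E x ≃ₗᵢ[ℂ] E x} (hU : IsGauge I n U) :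
    (frameAtlas I n E).IsConn fun x₀ y (i j : Fin n) ↦ connForm (gaugeConj U cov) x₀ i j y :=
  h.isConn.of_gaugeRelAt hU.isAut fun hi ↦ h.gaugeRelAt_gaugeConj hU hi

end Automorphisms

/-! ### Pullback of metrics and gauge transformations -/

section HomSections

variable {V : Type*} [NormedAddCommGroup V] [NormedSpace ℝ V] [FiniteDimensional ℝ V]
  {H : Type*} [TopologicalSpace H] {I : ModelWithCorners ℝ V H}
  {M : Type*} [TopologicalSpace M] [ChartedSpace H M]
  {n : ℕ} {E : M → Type*} [TopologicalSpace (TotalSpace (Fib n) E)]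
  [∀ x, NormedAddCommGroup (E x)] [∀ x, InnerProductSpace ℂ (E x)]
  [FiberBundle (Fib n) E] [VectorBundle ℂ (Fib n) E] [VectorBundle ℝ (Fib n) E]

theorem contDiffAt_clm_of_apply {D F : Type*} [NormedAddCommGroup D] [NormedSpace ℝ D]
    [NormedAddCommGroup F] [NormedSpace ℝ F] {f : D → V →L[ℝ] F} {x : D}
    (h : ∀ v, ContDiffAt ℝ ∞ (fun y ↦ f y v) x) : ContDiffAt ℝ ∞ f x := by
  have hd : Module.finrank ℝ V = Module.finrank ℝ (Fin (Module.finrank ℝ V) → ℝ) := by simp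
  let e₁ := ContinuousLinearEquiv.ofFinrankEq hd
  let e₂ := (e₁.arrowCongr (1 : F ≃L[ℝ] F)).trans (ContinuousLinearEquiv.piRing (Fin _))
  rw [← Function.id_comp f, ← e₂.symm_comp_self]
  exact e₂.symm.contDiff.contDiffAt.comp x (contDiffAt_pi.2 fun i ↦ h _)

theorem contDiffAt_euclidean_of_apply {D : Type*} [NormedAddCommGroup D] [NormedSpace ℝ D]
    {f : D → Fib n} {x : D} (h : ∀ i, ContDiffAt ℝ ∞ (fun y ↦ f y i) x) : ContDiffAt ℝ ∞ f x := by
  let L : Fib n ≃L[ℝ] (Fin n → ℂ) := PiLp.continuousLinearEquiv 2 ℝ fun _ : Fin n ↦ ℂ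
  exact L.symm.contDiff.contDiffAt.comp x (contDiffAt_pi.2 h)

/-- A bundle-valued `1`-form is smooth if its components in a local frame are. -/
theorem contMDiffAt_hom_of_frameCoord [ContMDiffVectorBundle ∞ (Fib n) E I] [IsManifold I ∞ M]
    [IsManifold I 1 M] [I.Boundaryless]
    {A : ∀ x, TangentSpace I x →L[ℝ] E x} {x₀ x : M} (hx : x ∈ frameDom n E x₀)
    (h : ∀ i : Fin n, SmoothFormAt
      (fun y ↦ oneForm (((frameCoord E x₀ i y).restrictScalars ℝ).comp (A y))) x) :
    ContMDiffAt I (I.prod 𝓘(ℝ, V →L[ℝ] Fib n)) ∞ (fun y ↦ TotalSpace.mk' (V →L[ℝ] Fib n)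
      (E := fun y ↦ TangentSpace I y →L[ℝ] E y) y (A y)) x := by
  have hI : IsManifold I (∞ + 1) M := ‹IsManifold I ∞ M›
  have hT : ContMDiffVectorBundle ∞ V (TangentSpace I : M → Type _) I := inferInstance
  rw [Trivialization.contMDiffAt_section_iff
    ((trivializationAt V (TangentSpace I) x).continuousLinearMap (RingHom.id ℝ)
      (trivializationAt (Fib n) E x₀))
    ⟨mem_baseSet_trivializationAt V (TangentSpace I) x, hx⟩]
  have hs : ContDiffAt ℝ ∞ (fun y ↦ ((trivializationAt V (TangentSpace I) x).continuousLinearMap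
      (RingHom.id ℝ) (trivializationAt (Fib n) E x₀)
        ⟨(extChartAt I x).symm y, A ((extChartAt I x).symm y)⟩).2) (extChartAt I x x) := by
    refine contDiffAt_clm_of_apply fun v ↦ contDiffAt_euclidean_of_apply fun i ↦ ?_
    refine (smoothFormAt_oneForm_iff.1 (h i) v).congr_of_eventuallyEq ?_
    filter_upwards [eventually_symm (I := I) (frameDom_mem_nhds hx)] with y hy
    rw [Trivialization.continuousLinearMap_apply]
    have ht := TangentBundle.symmL_trivializationAt (I := I) (x₀ := x)
      (x := (extChartAt I x).symm y) (by
        rw [← extChartAt_source I]; exact (extChartAt I x).map_target hy.1)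
    rw [(extChartAt I x).right_inv hy.1] at ht
    simp only [ContinuousLinearMap.comp_apply]
    rw [ht, Trivialization.continuousLinearMapAt_apply_of_mem ℝ _ hy.2]
    exact (frameCoord_eq hy.2 i _).symm
  refine (hs.contMDiffAt.comp x (extChartAt_contMDiffAt
    (mem_extChartAt_source (I := I) x))).congr_of_eventuallyEq ?_
  filter_upwards [extChartAt_source_mem_nhds (I := I) x] with z hz
  simp only [Function.comp_apply]
  rw [(extChartAt I x).left_inv hz]

end HomSections

section Pullback

variable {V : Type*} [NormedAddCommGroup V] [NormedSpace ℝ V]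
  {H : Type*} [TopologicalSpace H] {I : ModelWithCorners ℝ V H}
  {M : Type*} [TopologicalSpace M] [ChartedSpace H M]
  {n : ℕ} {E : M → Type*} [TopologicalSpace (TotalSpace (Fib n) E)]
  [∀ x, NormedAddCommGroup (E x)] [∀ x, InnerProductSpace ℂ (E x)]
  [FiberBundle (Fib n) E] [VectorBundle ℂ (Fib n) E] [VectorBundle ℝ (Fib n) E]
  [ContMDiffVectorBundle ∞ (Fib n) E I]
  {V' : Type*} [NormedAddCommGroup V'] [NormedSpace ℝ V']
  {H' : Type*} [TopologicalSpace H'] {I' : ModelWithCorners ℝ V' H'}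
  {M' : Type*} [TopologicalSpace M'] [ChartedSpace H' M']
  (φ : C^∞⟮I', M'; I, M⟯)

omit [VectorBundle ℝ (Fib n) E] [ContMDiffVectorBundle ∞ (Fib n) E I] in
theorem isSmoothHermitianMetric_pull (hE : IsSmoothHermitianMetric I n E) :
    IsSmoothHermitianMetric I' n (Pull φ E) := by
  intro x₀ i j
  have h := (hE (φ x₀) i j).comp (s := frameDom n (Pull φ E) x₀) φ.contMDiff.contMDiffOn
    (fun y hy ↦ hy)
  refine h.congr fun y _ ↦ ?_
  rw [frame_pull, frame_pull]
  rfl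

theorem isGauge_gaugePullback {U : ∀ x, E x ≃ₗᵢ[ℂ] E x} (hU : IsGauge I n U) :
    IsGauge I' n (gaugePullback φ U) := by
  intro x
  rw [Trivialization.contMDiffAt_section_iff
    ((trivializationAt (Fib n) (Pull φ E) x).continuousLinearMap (RingHom.id ℝ)
      (trivializationAt (Fib n) (Pull φ E) x))
      ⟨mem_baseSet_trivializationAt (Fib n) (Pull φ E) x,
        mem_baseSet_trivializationAt (Fib n) (Pull φ E) x⟩]
  have h1 := (Trivialization.contMDiffAt_section_iff
    ((trivializationAt (Fib n) E (φ x)).continuousLinearMap (RingHom.id ℝ)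
      (trivializationAt (Fib n) E (φ x)))
      ⟨mem_baseSet_trivializationAt (Fib n) E (φ x),
        mem_baseSet_trivializationAt (Fib n) E (φ x)⟩).1 (hU (φ x))
  refine (h1.comp x φ.contMDiff.contMDiffAt).congr_of_eventuallyEq ?_
  have hd : frameDom n (Pull φ E) x ∈ 𝓝 x :=
    frameDom_mem_nhds (mem_baseSet_trivializationAt (Fib n) (Pull φ E) x)
  filter_upwards [hd] with y hy
  have hy' : φ y ∈ frameDom n E (φ x) := hy
  rw [Function.comp_apply, Trivialization.continuousLinearMap_apply,
    Trivialization.continuousLinearMap_apply]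
  ext1 v
  have hs : (trivializationAt (Fib n) (Pull φ E) x).symmL ℝ y v =
      (trivializationAt (Fib n) E (φ x)).symmL ℝ (φ y) v := by
    rw [Trivialization.symmL_apply _ hy, Trivialization.symmL_apply _ hy',
      ← Trivialization.symmL_apply (R := ℂ) _ hy, ← Trivialization.symmL_apply (R := ℂ) _ hy']
    exact symmL_pull φ x y v
  exact congrArg (fun w : E (φ y) ↦ (trivializationAt (Fib n) E (φ x)).continuousLinearMapAt ℝ (φ y)
    (unitaryCLM (U (φ y)) w)) hs

end Pullback

/-! ### Pullback of connections -/

section ComplexFunctions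

variable {V : Type*} [NormedAddCommGroup V] [NormedSpace ℝ V]
  {H : Type*} [TopologicalSpace H] {I : ModelWithCorners ℝ V H}
  {M : Type*} [TopologicalSpace M] [ChartedSpace H M] {f g : M → ℂ} {x : M}

theorem mvfderiv_congr (h : f =ᶠ[𝓝 x] g) (v : TangentSpace I x) :
    mvfderiv I f x v = mvfderiv I g x v :=
  congrArg (fun L : V →L[ℝ] ℂ ↦ L v) h.mfderiv_eq

theorem mvfderiv_complex_mul (hf : MDifferentiableAt I 𝓘(ℝ, ℂ) f x)
    (hg : MDifferentiableAt I 𝓘(ℝ, ℂ) g x) (v : TangentSpace I x) :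
    mvfderiv I (fun y ↦ f y * g y) x v = mvfderiv I f x v * g x + f x * mvfderiv I g x v := by
  have h : HasMFDerivAt I 𝓘(ℝ, ℂ) (fun y ↦ f y * g y) x
      (f x • mvfderiv I g x + g x • mvfderiv I f x) := hf.hasMFDerivAt.mul hg.hasMFDerivAt
  refine (congrArg (fun L : V →L[ℝ] ℂ ↦ L v) h.mfderiv).trans ?_
  exact (add_comm _ _).trans (congrArg (· + _) (mul_comm _ _))

theorem hasMFDerivAt_clm_comp {F : Type*} [NormedAddCommGroup F] [NormedSpace ℝ F] {f : M → F}
    (hf : MDifferentiableAt I 𝓘(ℝ, F) f x) {G : Type*} [NormedAddCommGroup G] [NormedSpace ℝ G]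
    (L : F →L[ℝ] G) : HasMFDerivAt I 𝓘(ℝ, G) (fun y ↦ L (f y)) x (L.comp (mvfderiv I f x)) :=
  HasMFDerivAt.comp x (L.hasFDerivAt.hasMFDerivAt) hf.hasMFDerivAt

theorem mvfderiv_clm_comp {F : Type*} [NormedAddCommGroup F] [NormedSpace ℝ F] {f : M → F}
    (hf : MDifferentiableAt I 𝓘(ℝ, F) f x) {G : Type*} [NormedAddCommGroup G] [NormedSpace ℝ G]
    (L : F →L[ℝ] G) (v : TangentSpace I x) :
    mvfderiv I (fun y ↦ L (f y)) x v = L (mvfderiv I f x v) :=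
  congrArg (fun A : V →L[ℝ] G ↦ A v) (hasMFDerivAt_clm_comp hf L).mfderiv

theorem mvfderiv_sum_apply {κ : Type} (s : Finset κ) {f : κ → M → ℂ}
    (hf : ∀ i ∈ s, MDifferentiableAt I 𝓘(ℝ, ℂ) (f i) x) (v : TangentSpace I x) :
    mvfderiv I (fun y ↦ ∑ i ∈ s, f i y) x v = ∑ i ∈ s, mvfderiv I (f i) x v := by
  have h : HasMFDerivAt I 𝓘(ℝ, ℂ) (fun y ↦ ∑ i ∈ s, f i y) x (∑ i ∈ s, mvfderiv I (f i) x) :=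
    (HasMFDerivAt.sum fun i hi ↦ (hf i hi).hasMFDerivAt).congr_of_eventuallyEq
      (Eventually.of_forall fun z ↦ by rw [Finset.sum_apply])
  exact (congrArg (fun L : V →L[ℝ] ℂ ↦ L v) h.mfderiv).trans
    (_root_.sum_apply (F := V →L[ℝ] ℂ) ..)

end ComplexFunctions

section PullbackConnection

variable {V : Type*} [NormedAddCommGroup V] [NormedSpace ℝ V]
  {H : Type*} [TopologicalSpace H] {I : ModelWithCorners ℝ V H}
  {M : Type*} [TopologicalSpace M] [ChartedSpace H M]
  {n : ℕ} {E : M → Type*} [TopologicalSpace (TotalSpace (Fib n) E)]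
  [∀ x, NormedAddCommGroup (E x)] [∀ x, InnerProductSpace ℂ (E x)]
  [FiberBundle (Fib n) E] [VectorBundle ℂ (Fib n) E] [VectorBundle ℝ (Fib n) E]
  [ContMDiffVectorBundle ∞ (Fib n) E I]
  {V' : Type*} [NormedAddCommGroup V'] [NormedSpace ℝ V']
  {H' : Type*} [TopologicalSpace H'] {I' : ModelWithCorners ℝ V' H'}
  {M' : Type*} [TopologicalSpace M'] [ChartedSpace H' M']
  (φ : C^∞⟮I', M'; I, M⟯)

omit [VectorBundle ℝ (Fib n) E] [ContMDiffVectorBundle ∞ (Fib n) E I] in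
theorem connPullback_apply (cov : Operator I E) (σ : ∀ x, Pull φ E x) (x : M')
    (v : TangentSpace I' x) : connPullback n φ cov σ x v =
      ∑ j : Fin n, ((mvfderiv I' (fun y ↦ frameCoord (Pull φ E) x j y (σ y)) x v : ℂ) •
        (frame E (φ x) j (φ x) : Pull φ E x) + frameCoord (Pull φ E) x j x (σ x) •
          (cov (frame E (φ x) j) (φ x) (mfderiv I' I φ x v) : Pull φ E x)) := by
  refine (_root_.sum_apply (F := TangentSpace I' x →L[ℝ] E (φ x)) ..).trans
    (Finset.sum_congr rfl fun j _ ↦ ?_)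
  rfl

omit [VectorBundle ℝ (Fib n) E] [ContMDiffVectorBundle ∞ (Fib n) E I] in
theorem frameCoord_connPullback_self (cov : Operator I E) (σ : ∀ x, Pull φ E x) (x : M') (i : Fin n)
    (v : TangentSpace I' x) : frameCoord (Pull φ E) x i x (connPullback n φ cov σ x v) =
      mvfderiv I' (fun y ↦ frameCoord (Pull φ E) x i y (σ y)) x v +
        ∑ j, covPullback I' φ (fun y i j ↦ connForm cov (φ x) i j y) x i j v *
          frameCoord (Pull φ E) x j x (σ x) := by
  have hx : φ x ∈ frameDom n E (φ x) := mem_baseSet_trivializationAt (Fib n) E (φ x)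
  let L := frameCoord (n := n) E (φ x) i (φ x)
  let c (j : Fin n) : ℂ := mvfderiv I' (fun y ↦ frameCoord (Pull φ E) x j y (σ y)) x v
  let s (j : Fin n) : ℂ := frameCoord (Pull φ E) x j x (σ x)
  have hL (e : Fin n → E (φ x)) (w : Fin n → E (φ x)) :
      L (∑ j, (c j • e j + s j • w j)) = ∑ j, c j * L (e j) + ∑ j, s j * L (w j) := by
    simp only [map_sum, map_add, map_smul, smul_eq_mul, Finset.sum_add_distrib]
  refine (congrArg L (connPullback_apply φ cov σ x v)).trans ((hL _ _).trans ?_)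
  refine congrArg₂ (· + ·) ?_ (Finset.sum_congr rfl fun j _ ↦ mul_comm _ _)
  have h (j : Fin n) : L (frame E (φ x) j (φ x)) = (1 : Matrix (Fin n) (Fin n) ℂ) i j :=
    frameCoord_frame (E := E) hx i j
  simp only [h, Matrix.one_apply, mul_ite, mul_one, mul_zero, Finset.sum_ite_eq, Finset.mem_univ,
    if_true]
  rfl

/-- The pulled back connection is `d + φ^* ω` in the pullback of any frame. -/
theorem frameCoord_connPullback [IsManifold I 1 M] {cov : Operator I E}
    (h : IsHermitianConnection n cov) {σ : ∀ x, Pull φ E x} {x₀ x : M'}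
    (hx : x ∈ frameDom n (Pull φ E) x₀) (hσ : IsDiffSectionAt I' n σ x) (i : Fin n)
    (v : TangentSpace I' x) : frameCoord (Pull φ E) x₀ i x (connPullback n φ cov σ x v) =
      mvfderiv I' (fun y ↦ frameCoord (Pull φ E) x₀ i y (σ y)) x v +
        ∑ j, covPullback I' φ (fun y i j ↦ connForm cov (φ x₀) i j y) x i j v *
          frameCoord (Pull φ E) x₀ j x (σ x) := by
  have hx' : φ x ∈ frameDom n E (φ x₀) := hx
  have hxx : φ x ∈ frameDom n E (φ x) := mem_baseSet_trivializationAt (Fib n) E (φ x)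
  have hself : x ∈ frameDom n (Pull φ E) x := hxx
  have hφ : ContMDiffAt I' I ∞ φ x := φ.contMDiff.contMDiffAt
  -- coordinate vectors are encoded as matrices with equal columns
  let c (z : M') (y : M') : Matrix (Fin n) (Fin n) ℂ :=
    Matrix.of fun l _ ↦ frameCoord (Pull φ E) z l y (σ y)
  let g : M' → Matrix (Fin n) (Fin n) ℂ := transMat n E (φ x₀) (φ x) ∘ φ
  have hg : MatSmoothAtM I' g x := MatSmoothAtM.comp hφ (matSmoothAtM_transMat hx' hxx)
  have hc (y : M') (hy : y ∈ frameDom n (Pull φ E) x) : c x₀ y = g y * c x y := by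
    ext l q
    exact frameCoord_eq_sum (E := E) (x₁ := φ x) (x := φ y) hy (φ x₀) l (σ y)
  have hd : dMatM I' (c x₀) x v = dMatM I' g x v * c x x + g x * dMatM I' (c x) x v := by
    refine Eq.trans (dMatM_congr ?_ v) (dMatM_mul (g := g) (h := c x) hg.mdifferentiableAt
      (fun l _ ↦ (isDiffSectionAt_iff_frameCoord (E := Pull φ E) hself).1 hσ l) v)
    filter_upwards [frameDom_mem_nhds hself] with y hy using hc y hy
  have hr := (h.gaugeRelAt_connForm hx' hxx).comp (hφ.mdifferentiableAt (by simp))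
    (matSmoothAtM_transMat hx' hxx) v
  have key : g x * (dMatM I' (c x) x v +
      covMatrix (covPullback I' φ (fun y i j ↦ connForm cov (φ x) i j y) x) v * c x x) =
      dMatM I' (c x₀) x v +
      covMatrix (covPullback I' φ (fun y i j ↦ connForm cov (φ x₀) i j y) x) v * c x₀ x := by
    rw [hd, hc x hself, Matrix.mul_add, ← Matrix.mul_assoc, hr, Matrix.add_mul, ← Matrix.mul_assoc]
    abel
  have hk := congrFun (congrFun key i) i
  refine Eq.trans ?_ hk
  refine (frameCoord_eq_sum (E := E) hxx (φ x₀) i _).trans (Finset.sum_congr rfl fun l _ ↦ ?_)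
  exact congrArg (transMat n E (φ x₀) (φ x) (φ x) i l * ·)
    (frameCoord_connPullback_self φ cov σ x l v)

theorem connForm_connPullback [IsManifold I 1 M] {cov : Operator I E}
    (h : IsHermitianConnection n cov) {x₀ x : M'} (hx : x ∈ frameDom n (Pull φ E) x₀) (i j : Fin n) :
    connForm (connPullback n φ cov : Operator I' (Pull φ E)) x₀ i j x =
      covPullback I' φ (fun y i j ↦ connForm cov (φ x₀) i j y) x i j := by
  ext v
  refine (frameCoord_connPullback φ h hx (isDiffSectionAt_frame hx j) i v).trans ?_
  have hd : mvfderiv I' (fun y ↦ frameCoord (Pull φ E) x₀ i y (frame (Pull φ E) x₀ j y)) x v = 0 := by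
    have he : (fun y ↦ frameCoord (Pull φ E) x₀ i y (frame (Pull φ E) x₀ j y)) =ᶠ[𝓝 x]
        fun _ ↦ (1 : Matrix (Fin n) (Fin n) ℂ) i j := by
      filter_upwards [frameDom_mem_nhds hx] with y hy using frameCoord_frame hy i j
    refine (congrArg (fun L : V' →L[ℝ] ℂ ↦ L v) he.mfderiv_eq).trans ?_
    rw [mfderiv_const]
    rfl
  rw [hd, zero_add]
  simp only [frameCoord_frame hx]
  simp [Matrix.one_apply]

/-- The entries of the Gram matrix of a frame satisfy the product rule of the connection. -/
theorem mvfderiv_gram [IsManifold I 1 M] {cov : Operator I E} (h : IsHermitianConnection n cov)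
    {x₀ x : M} (hx : x ∈ frameDom n E x₀) (i j : Fin n) (v : TangentSpace I x) :
    mvfderiv I (fun y ↦ (inner ℂ (frame E x₀ i y) (frame E x₀ j y) : ℂ)) x v =
      inner ℂ (cov (frame E x₀ i) x v) (frame E x₀ j x) +
        inner ℂ (frame E x₀ i x) (cov (frame E x₀ j) x v) :=
  h.metric _ _ x (isDiffSectionAt_frame hx i) (isDiffSectionAt_frame hx j) v

theorem isCovariantDerivativeOn_connPullback (cov : Operator I E) :
    IsCovariantDerivativeOn (Fib n) (connPullback n φ cov : Operator I' (Pull φ E)) Set.univ := by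
  have hself (x : M') : x ∈ frameDom n (Pull φ E) x :=
    mem_baseSet_trivializationAt (Fib n) (Pull φ E) x
  have hcd {σ : ∀ x, Pull φ E x} {x : M'} (hσ : IsDiffSectionAt I' n σ x) (i : Fin n) :=
    (isDiffSectionAt_iff_frameCoord (E := Pull φ E) (hself x)).1 hσ i
  refine ⟨?_, ?_⟩
  · intro σ τ x hσ hτ _
    ext v
    refine ext_frameCoord (E := Pull φ E) (hself x) fun i ↦ ?_
    have hadd : mvfderiv I' (fun y ↦ frameCoord (Pull φ E) x i y ((σ + τ) y)) x v =
        mvfderiv I' (fun y ↦ frameCoord (Pull φ E) x i y (σ y)) x v +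
          mvfderiv I' (fun y ↦ frameCoord (Pull φ E) x i y (τ y)) x v := by
      simp only [Pi.add_apply, map_add]
      exact congrArg (fun L : V' →L[ℝ] ℂ ↦ L v) (mvfderiv_add (hcd hσ i) (hcd hτ i))
    rw [_root_.add_apply, map_add, frameCoord_connPullback_self, frameCoord_connPullback_self,
      frameCoord_connPullback_self, hadd]
    simp only [Pi.add_apply, map_add, mul_add, Finset.sum_add_distrib]
    ring
  · intro σ g x hσ hg _
    ext v
    refine ext_frameCoord (E := Pull φ E) (hself x) fun i ↦ ?_
    have hsm (y : M') (r : ℝ) (w : Pull φ E y) (l : Fin n) :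
        frameCoord (Pull φ E) x l y (r • w) = (r : ℂ) * frameCoord (Pull φ E) x l y w := by
      rw [← Complex.coe_smul, map_smul, smul_eq_mul]
    have hmul : mvfderiv I' (fun y ↦ frameCoord (Pull φ E) x i y ((g • σ) y)) x v =
        (g x : ℂ) * mvfderiv I' (fun y ↦ frameCoord (Pull φ E) x i y (σ y)) x v +
          (mvfderiv I' g x v : ℝ) * frameCoord (Pull φ E) x i x (σ x) := by
      refine (mvfderiv_congr (Eventually.of_forall fun y ↦ hsm y (g y) (σ y) i) v).trans ?_
      rw [mvfderiv_complex_mul (f := fun y ↦ (g y : ℂ))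
        (hasMFDerivAt_clm_comp hg Complex.ofRealCLM).mdifferentiableAt (hcd hσ i), add_comm]
      congr 2
      exact mvfderiv_clm_comp hg Complex.ofRealCLM v
    have hR : frameCoord (Pull φ E) x i x ((g x • connPullback n φ cov σ x +
        (mvfderiv I' g x).smulRight (σ x)) v) =
        (g x : ℂ) * frameCoord (Pull φ E) x i x (connPullback n φ cov σ x v) +
          (mvfderiv I' g x v : ℝ) * frameCoord (Pull φ E) x i x (σ x) := by
      rw [← hsm, ← hsm, ← map_add]
      rfl
    rw [hR, frameCoord_connPullback_self, frameCoord_connPullback_self, hmul]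
    have hs (j : Fin n) : frameCoord (Pull φ E) x j x ((g • σ) x) =
      (g x : ℂ) * frameCoord (Pull φ E) x j x (σ x) := hsm x (g x) (σ x) j
    simp only [hs, mul_add, Finset.mul_sum, mul_left_comm]
    ring

variable [IsManifold I ∞ M] [I.Boundaryless] [FiniteDimensional ℝ V] [T2Space M]
  [IsManifold I' ∞ M'] [I'.Boundaryless] [FiniteDimensional ℝ V']

/-- The pullback of a Hermitian connection is Hermitian. Compatibility with the metric is the
derivative of the Gram matrix of the frame, pulled back along `φ`. -/
theorem isHermitianConnection_connPullback (hE : IsSmoothHermitianMetric I n E)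
    {cov : Operator I E} (h : IsHermitianConnection n cov) :
    IsHermitianConnection n (connPullback n φ cov : Operator I' (Pull φ E)) := by
  have hself (x : M') : x ∈ frameDom n (Pull φ E) x :=
    mem_baseSet_trivializationAt (Fib n) (Pull φ E) x
  have hcd {σ : ∀ x, Pull φ E x} {x : M'} (hσ : IsDiffSectionAt I' n σ x) (i : Fin n) :=
    (isDiffSectionAt_iff_frameCoord (E := Pull φ E) (hself x)).1 hσ i
  refine ⟨isCovariantDerivativeOn_connPullback φ cov, ⟨?_⟩, ?_, ?_⟩
  · intro σ hσ x _
    have hσ' : ContMDiff I' (I'.prod 𝓘(ℝ, Fib n)) ∞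
      (fun z ↦ TotalSpace.mk' (Fib n) z (σ z)) := contMDiffOn_univ.1 hσ
    refine (contMDiffAt_hom_of_frameCoord (E := Pull φ E) (hself x) fun i ↦ ?_).contMDiffWithinAt
    have hc (j : Fin n) := (contMDiffAt_section_iff_frameCoord (E := Pull φ E) (hself x)).1 (hσ' x) j
    have hs := smoothFormAt_oneForm_add (smoothFormAt_oneForm_mvfderiv (hc i))
      (smoothFormAt_oneForm_sum fun j ↦ smoothFormAt_oneForm_smul (hc j)
        ((h.smoothCovAt_connForm (mem_baseSet_trivializationAt (Fib n) E (φ x))).covPullback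
          φ.contMDiff.contMDiffAt i j))
    refine hs.congr ?_
    filter_upwards [frameDom_mem_nhds (hself x)] with y hy
    refine congrArg oneForm ?_
    ext v
    refine (frameCoord_connPullback φ h hy ((hσ' y).mdifferentiableAt (by simp)) i v).trans ?_
    refine congrArg (_ + ·) ?_
    refine Eq.trans ?_ (_root_.sum_apply (F := TangentSpace I' y →L[ℝ] ℂ) ..).symm
    exact Finset.sum_congr rfl fun j _ ↦ mul_comm _ _
  · intro c σ x hσ v
    refine ext_frameCoord (E := Pull φ E) (hself x) fun i ↦ ?_
    have hmul : mvfderiv I' (fun y ↦ frameCoord (Pull φ E) x i y (c • σ y)) x v =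
        c * mvfderiv I' (fun y ↦ frameCoord (Pull φ E) x i y (σ y)) x v := by
      simp only [map_smul]
      exact mvfderiv_clm_comp (hcd hσ i)
        ((ContinuousLinearMap.mul ℂ ℂ c).restrictScalars ℝ) v
    rw [map_smul, frameCoord_connPullback_self, frameCoord_connPullback_self, hmul]
    simp only [map_smul, smul_eq_mul, mul_add, Finset.mul_sum]
    congr 1
    exact Finset.sum_congr rfl fun j _ ↦ by ring
  · intro σ τ x hσ hτ v
    have hx : φ x ∈ frameDom n E (φ x) := mem_baseSet_trivializationAt (Fib n) E (φ x)
    -- expand both sections in the frame at `φ x`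
    let f (i : Fin n) (y : M') : ℂ := frameCoord (Pull φ E) x i y (σ y)
    let g (i : Fin n) (y : M') : ℂ := frameCoord (Pull φ E) x i y (τ y)
    let G (i j : Fin n) (y : M) : ℂ := inner ℂ (frame E (φ x) i y) (frame E (φ x) j y)
    have hG (i j : Fin n) : MDifferentiableAt I 𝓘(ℝ, ℂ) (G i j) (φ x) :=
      ((hE (φ x) i j).contMDiffAt (frameDom_mem_nhds hx)).mdifferentiableAt (by simp)
    have hφ : MDifferentiableAt I' I φ x := φ.contMDiff.contMDiffAt.mdifferentiableAt (by simp)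
    have hGφ (i j : Fin n) : MDifferentiableAt I' 𝓘(ℝ, ℂ) (G i j ∘ φ) x := (hG i j).comp x hφ
    have hf (i : Fin n) : MDifferentiableAt I' 𝓘(ℝ, ℂ) (f i) x := hcd hσ i
    have hg (i : Fin n) : MDifferentiableAt I' 𝓘(ℝ, ℂ) (g i) x := hcd hτ i
    let conj : ℂ →L[ℝ] ℂ := Complex.conjCLE
    have hcf (i : Fin n) : MDifferentiableAt I' 𝓘(ℝ, ℂ) (fun y ↦ conj (f i y)) x :=
      (hasMFDerivAt_clm_comp (hf i) conj).mdifferentiableAt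
    have hcfg (i j : Fin n) : MDifferentiableAt I' 𝓘(ℝ, ℂ) (fun y ↦ conj (f i y) * g j y) x :=
      (hcf i).mul (hg j)
    have hin (y : M') (a b : Fin n → ℂ) (e e' : Fin n → E (φ y)) :
        (inner ℂ (∑ i, a i • e i) (∑ j, b j • e' j) : ℂ) =
          ∑ i, ∑ j, conj (a i) * b j * inner ℂ (e i) (e' j) := by
      rw [sum_inner]
      refine Finset.sum_congr rfl fun i _ ↦ ?_
      rw [inner_sum]
      refine Finset.sum_congr rfl fun j _ ↦ ?_
      rw [inner_smul_left, inner_smul_right, ← mul_assoc]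
      rfl
    have hexp : (fun y ↦ (inner ℂ (σ y) (τ y) : ℂ)) =ᶠ[𝓝 x]
        fun y ↦ ∑ i, ∑ j, conj (f i y) * g j y * (G i j ∘ φ) y := by
      filter_upwards [frameDom_mem_nhds (hself x)] with y hy
      have hs (ρ : ∀ x, Pull φ E x) : (ρ y : E (φ y)) =
          ∑ i, frameCoord (Pull φ E) x i y (ρ y) • frame E (φ x) i (φ y) :=
        (sum_frameCoord_smul_frame (E := E) hy (ρ y)).symm
      exact (congrArg₂ (fun a b : E (φ y) ↦ (inner ℂ a b : ℂ)) (hs σ) (hs τ)).trans (hin y _ _ _ _)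
    have hcfgG (i j : Fin n) : MDifferentiableAt I' 𝓘(ℝ, ℂ)
        (fun y ↦ conj (f i y) * g j y * (G i j ∘ φ) y) x := (hcfg i j).mul (hGφ i j)
    have hsum (i : Fin n) : MDifferentiableAt I' 𝓘(ℝ, ℂ)
        (fun y ↦ ∑ j, conj (f i y) * g j y * (G i j ∘ φ) y) x :=
      (MDifferentiableAt.sum fun j (_ : j ∈ Finset.univ) ↦ hcfgG i j).congr_of_eventuallyEq
        (Eventually.of_forall fun z ↦ by rw [Finset.sum_apply])
    have hR (a a' b b' : Fin n → ℂ) (e w : Fin n → E (φ x)) :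
        (inner ℂ (∑ i, (a' i • e i + a i • w i)) (∑ j, b j • e j) : ℂ) +
          inner ℂ (∑ i, a i • e i) (∑ j, (b' j • e j + b j • w j)) =
        ∑ i, ∑ j, ((conj (a' i) * b j + conj (a i) * b' j) * inner ℂ (e i) (e j) +
          conj (a i) * b j * (inner ℂ (w i) (e j) + inner ℂ (e i) (w j))) := by
      rw [Finset.sum_add_distrib, Finset.sum_add_distrib, inner_add_left, inner_add_right,
        hin x, hin x, hin x, hin x]
      simp only [← Finset.sum_add_distrib]
      exact Finset.sum_congr rfl fun i _ ↦ Finset.sum_congr rfl fun j _ ↦ by ring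
    have hs (ρ : ∀ x, Pull φ E x) : (ρ x : E (φ x)) =
        ∑ i, frameCoord (Pull φ E) x i x (ρ x) • frame E (φ x) i (φ x) :=
      (sum_frameCoord_smul_frame (E := E) hx (ρ x)).symm
    -- the right-hand side in terms of the coordinates and their derivatives
    have hRHS := hR (fun i : Fin n ↦ f i x) (fun i ↦ mvfderiv I' (f i) x v) (fun i ↦ g i x)
      (fun i ↦ mvfderiv I' (g i) x v) (fun i : Fin n ↦ frame E (φ x) i (φ x))
      (fun i ↦ cov (frame E (φ x) i) (φ x) (mfderiv I' I φ x v))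
    have hσx := connPullback_apply (n := n) φ cov σ x v
    have hτx := connPullback_apply (n := n) φ cov τ x v
    refine Eq.trans ?_ (Eq.trans hRHS.symm (congrArg₂ (· + ·)
      (congrArg₂ (fun a b : E (φ x) ↦ (inner ℂ a b : ℂ)) hσx.symm (hs τ).symm)
      (congrArg₂ (fun a b : E (φ x) ↦ (inner ℂ a b : ℂ)) (hs σ).symm hτx.symm)))
    rw [mvfderiv_congr hexp, mvfderiv_sum_apply _ fun i _ ↦ hsum i]
    refine Finset.sum_congr rfl fun i _ ↦ ?_
    rw [mvfderiv_sum_apply _ fun j _ ↦ hcfgG i j]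
    refine Finset.sum_congr rfl fun j _ ↦ ?_
    rw [mvfderiv_complex_mul (hcfg i j) (hGφ i j), mvfderiv_complex_mul (hcf i) (hg j),
      mvfderiv_clm_comp (hf i) conj]
    have hd : mvfderiv I' (G i j ∘ φ) x v =
        inner ℂ (cov (frame E (φ x) i) (φ x) (mfderiv I' I φ x v)) (frame E (φ x) j (φ x)) +
          inner ℂ (frame E (φ x) i (φ x)) (cov (frame E (φ x) j) (φ x) (mfderiv I' I φ x v)) :=
      (mfderiv_comp_apply x (hG i j) hφ v).trans (mvfderiv_gram h hx i j _)
    rw [hd]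
    rfl

/-- Transgression forms are natural under pullbacks. -/
theorem formPullback_oddChernWeil (hE : IsSmoothHermitianMetric I n E)
    {P : MvPolynomial (Fin n × Fin n) ℂ} {k : ℕ}
    (hP : IsConjInvariant (polarization P (k + 1))) {U : ∀ x, E x ≃ₗᵢ[ℂ] E x} (hU : IsGauge I n U)
    {cov : Operator I E} (h : IsHermitianConnection n cov) :
    formPullback I' φ (oddChernWeil P k U cov) =
      oddChernWeil P k (gaugePullback φ U) (connPullback n φ cov : Operator I' (Pull φ E)) := by
  have h' := isHermitianConnection_connPullback (I' := I') φ hE h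
  have hU' := isGauge_gaugePullback (I' := I') φ hU
  rw [oddChernWeil, oddChernWeil, transgression_eq hP, transgression_eq hP,
    h.isConn.tp_pull hP (h.isConn_gaugeConj hU) φ.contMDiff]
  have h1 {x₀ x : M'} (hx : x ∈ frameDom n (Pull φ E) x₀) :
      covPullback I' φ (fun y i j ↦ connForm cov (φ x₀) i j y) x =
        fun i j : Fin n ↦ connForm (connPullback n φ cov : Operator I' (Pull φ E)) x₀ i j x := by
    funext i j
    exact (connForm_connPullback φ h hx i j).symm
  -- both sides arise from the pulled back connection by the same gauge transformation
  have h2 {x₀ x : M'} (hx : x ∈ frameDom n (Pull φ E) x₀) :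
      covPullback I' φ (fun y i j ↦ connForm (gaugeConj U cov) (φ x₀) i j y) x =
        fun i j : Fin n ↦ connForm (gaugeConj (gaugePullback φ U)
          (connPullback n φ cov : Operator I' (Pull φ E))) x₀ i j x := by
    have hx' : φ x ∈ frameDom n E (φ x₀) := hx
    have hm : endMat n (fun x ↦ unitaryCLM (U x)) (φ x₀) ∘ φ =
        endMat n (fun x ↦ unitaryCLM (gaugePullback φ U x)) x₀ := by
      funext y
      ext i j
      exact congrArg (fun w : E (φ y) ↦ frameCoord E (φ x₀) i (φ y) (U (φ y) w))
        (frame_pull (E := E) φ x₀ j y).symm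
    have hr := (h.gaugeRelAt_gaugeConj hU hx').comp
      (φ.contMDiff.contMDiffAt.mdifferentiableAt (I := I') (by simp))
      (matSmoothAtM_endMat hx' hU.contMDiffAt)
    rw [hm] at hr
    have hr' := h'.gaugeRelAt_gaugeConj hU' hx
    refine GaugeRelAt.eq (a'' := fun y i j ↦ connForm (gaugeConj (gaugePullback φ U)
      (connPullback n φ cov : Operator I' (Pull φ E))) x₀ i j y) hr (fun w ↦ ?_)
      (hU'.isAut.isUnit hx)
    rw [h1 hx]
    exact hr' w
  refine congrArg fibreIntegral (funext fun p ↦ cwForm_congr P (k + 1) ?_)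
  have hp : p.2 ∈ frameDom n (Pull φ E) p.2 := mem_baseSet_trivializationAt (Fib n) (Pull φ E) p.2
  filter_upwards [continuous_snd.continuousAt.preimage_mem_nhds (frameDom_mem_nhds hp)] with q hq
  funext i j
  have e1 := congrFun (congrFun (h1 (x₀ := p.2) (x := q.2) hq) i) j
  have e2 := congrFun (congrFun (h2 (x₀ := p.2) (x := q.2) hq) i) j
  exact congrArg₂ (fun X Y : V' →L[ℝ] ℂ ↦
    ((1 - q.1 : ℝ) : ℂ) • X.comp (mfderiv (𝓘(ℝ, ℝ).prod I') I' Prod.snd q) +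
      ((q.1 : ℝ) : ℂ) • Y.comp (mfderiv (𝓘(ℝ, ℝ).prod I') I' Prod.snd q)) e1 e2

end PullbackConnection

/-! ### Smoothing of homotopies of gauge transformations -/

section Positivity

variable {M : Type*} [TopologicalSpace M]
  {n : ℕ} {E : M → Type*} [TopologicalSpace (TotalSpace (Fib n) E)]
  [∀ x, NormedAddCommGroup (E x)] [∀ x, InnerProductSpace ℂ (E x)]
  [FiberBundle (Fib n) E] [VectorBundle ℂ (Fib n) E]

theorem apply_sum_smul_frame {A : ∀ x, E x →L[ℝ] E x} {x₀ x : M}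
    (hA : ∀ (c : ℂ) v, A x (c • v) = c • A x v) (hx : x ∈ frameDom n E x₀) (z : Fin n → ℂ) :
    A x (∑ j : Fin n, z j • frame E x₀ j x) = ∑ i, (endMat n A x₀ x *ᵥ z) i • frame E x₀ i x := by
  refine ext_frameCoord hx fun i ↦ ?_
  simp only [map_sum, hA, map_smul, smul_eq_mul, frameCoord_frame hx, Matrix.mulVec, dotProduct,
    endMat, Matrix.of_apply, Matrix.one_apply, mul_ite, mul_one, mul_zero, Finset.sum_ite_eq,
    Finset.mem_univ, if_true]
  exact Finset.sum_congr rfl fun j _ ↦ mul_comm _ _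

theorem isUnit_det_endMat_of_injective {A : ∀ x, E x →L[ℝ] E x} {x₀ x : M}
    (hA : ∀ (c : ℂ) v, A x (c • v) = c • A x v) (hx : x ∈ frameDom n E x₀)
    (h : ∀ v, A x v = 0 → v = 0) : IsUnit (endMat n A x₀ x).det := by
  rw [isUnit_iff_ne_zero]
  intro h0
  obtain ⟨z, hz, hz0⟩ := Matrix.exists_mulVec_eq_zero_iff.2 h0
  refine hz (funext fun i ↦ ?_)
  have hv := h _ ((apply_sum_smul_frame hA hx z).trans (by simp [hz0]))
  have := congrArg (frameCoord E x₀ i x) hv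
  simpa [map_sum, frameCoord_frame hx, Matrix.one_apply] using this

/-- The real part of `⟪A v, B v⟫` is positive for all `v ≠ 0`. For a fixed invertible `B`, this is
a convex condition on `A` which implies that `A` is injective. -/
def IsPositivePair {x : M} (A B : E x →L[ℝ] E x) : Prop :=
  ∀ v ≠ 0, 0 < (inner ℂ (A v) (B v) : ℂ).re

omit [TopologicalSpace M] in
theorem IsPositivePair.injective {x : M} {A B : E x →L[ℝ] E x} (h : IsPositivePair A B) (v : E x)
    (hv : A v = 0) : v = 0 := by
  by_contra h0
  simpa [hv] using h v h0

omit [TopologicalSpace M] in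
theorem isPositivePair_unitaryCLM {x : M} (u : E x ≃ₗᵢ[ℂ] E x) :
    IsPositivePair (unitaryCLM u) (unitaryCLM u) := by
  intro v hv
  have h : (inner ℂ (unitaryCLM u v) (unitaryCLM u v) : ℂ) = inner ℂ v v := u.inner_map_map v v
  rw [h, inner_self_eq_norm_sq_to_K, ← RCLike.ofReal_pow]
  exact (Complex.ofReal_re _).symm ▸ (by positivity : 0 < ‖v‖ ^ 2)

/-- Positivity is an open condition, by compactness of the unit sphere of the model fibre. -/
theorem eventually_isPositivePair {A B : ∀ x, E x →L[ℝ] E x} {p : M}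
    (hA : ∀ x (c : ℂ) v, A x (c • v) = c • A x v) (hB : ∀ x (c : ℂ) v, B x (c • v) = c • B x v)
    (hAc : ∀ i j, ContinuousAt (fun q ↦ endMat n A p q i j) p)
    (hBc : ∀ i j, ContinuousAt (fun q ↦ endMat n B p q i j) p)
    (hG : ∀ i j : Fin n,
      ContinuousAt (fun q ↦ (inner ℂ (frame E p i q) (frame E p j q) : ℂ)) p)
    (h : IsPositivePair (A p) (B p)) : ∀ᶠ q in 𝓝 p, IsPositivePair (A q) (B q) := by
  have hp : p ∈ frameDom n E p := mem_baseSet_trivializationAt (Fib n) E p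
  let Φ (q : M) (z : Fib n) : ℂ := ∑ i, ∑ j, starRingEnd ℂ ((endMat n A p q *ᵥ z) i) *
    (endMat n B p q *ᵥ z) j * inner ℂ (frame E p i q) (frame E p j q)
  have hΦ {q : M} (hq : q ∈ frameDom n E p) (z : Fib n) :
      (inner ℂ (A q (∑ j : Fin n, z j • frame E p j q)) (B q (∑ j : Fin n, z j • frame E p j q)) : ℂ) =
        Φ q z := by
    rw [apply_sum_smul_frame (hA q) hq, apply_sum_smul_frame (hB q) hq, sum_inner]
    refine Finset.sum_congr rfl fun i _ ↦ ?_
    rw [inner_sum]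
    refine Finset.sum_congr rfl fun j _ ↦ ?_
    rw [inner_smul_left, inner_smul_right, ← mul_assoc]
  have hmv {X : M → Matrix (Fin n) (Fin n) ℂ} (hX : ∀ i j, ContinuousAt (fun q ↦ X q i j) p)
      (z : Fib n) (i : Fin n) :
      ContinuousAt (fun w : M × Fib n ↦ (X w.1 *ᵥ w.2) i) (p, z) := by
    change ContinuousAt (fun w : M × Fib n ↦ ∑ j, X w.1 i j * w.2 j) (p, z)
    refine tendsto_finsetSum _ fun j _ ↦ ?_
    have h1 : ContinuousAt (fun w : M × Fib n ↦ X w.1 i j) (p, z) :=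
      ContinuousAt.comp (f := Prod.fst) (x := (p, z)) (hX i j) continuousAt_fst
    have h2 : ContinuousAt (fun w : M × Fib n ↦ w.2 j) (p, z) :=
      ((EuclideanSpace.proj j : Fib n →L[ℂ] ℂ).continuous.comp continuous_snd).continuousAt
    exact h1.mul h2
  have hΦc (z : Fib n) : ContinuousAt (fun w : M × Fib n ↦ Φ w.1 w.2) (p, z) := by
    refine tendsto_finsetSum _ fun i _ ↦ tendsto_finsetSum _ fun j _ ↦ ?_
    have h3 : ContinuousAt (fun w : M × Fib n ↦
        (inner ℂ (frame E p i w.1) (frame E p j w.1) : ℂ)) (p, z) :=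
      ContinuousAt.comp (f := Prod.fst) (x := (p, z)) (hG i j) continuousAt_fst
    exact ((Complex.continuous_conj.continuousAt.comp (hmv hAc z i)).mul (hmv hBc z j)).mul h3
  have hpos : ∀ z ∈ Metric.sphere (0 : Fib n) 1, ∀ᶠ w : M × Fib n in 𝓝 (p, z), 0 < (Φ w.1 w.2).re := by
    intro z hz
    refine (Complex.continuous_re.continuousAt.comp (hΦc z)).eventually (lt_mem_nhds ?_)
    change 0 < (Φ p z).re
    rw [← hΦ hp]
    refine h _ fun h0 ↦ ?_
    have hz0 : z = 0 := by
      ext i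
      have := congrArg (frameCoord E p i p) h0
      simpa [map_sum, frameCoord_frame hp, Matrix.one_apply] using this
    simp [hz0] at hz
  filter_upwards [(isCompact_sphere (0 : Fib n) 1).eventually_forall_of_forall_eventually
    (P := fun q z ↦ 0 < (Φ q z).re) hpos,
    frameDom_mem_nhds hp] with q hq hqd v hv
  -- rescale `v` to a vector with coordinates of norm one
  let z : Fib n := WithLp.toLp 2 fun i ↦ frameCoord E p i q v
  have hvz : v = ∑ j : Fin n, z j • frame E p j q := (sum_frameCoord_smul_frame hqd v).symm
  have hz : z ≠ 0 := fun h0 ↦ hv (by rw [hvz, h0]; simp)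
  have h1 := hq ((‖z‖⁻¹ : ℂ) • z) (by simp [norm_smul, hz])
  have hs : ∑ j : Fin n, ((‖z‖⁻¹ : ℂ) • z) j • frame E p j q = (‖z‖⁻¹ : ℂ) • v := by
    conv_rhs => rw [hvz, Finset.smul_sum]
    exact Finset.sum_congr rfl fun j _ ↦ mul_smul _ _ _
  rw [← hΦ hqd, hs, hA, hB, inner_smul_left, inner_smul_right, ← mul_assoc, ← Complex.ofReal_inv,
    Complex.conj_ofReal, ← Complex.ofReal_mul, Complex.re_ofReal_mul] at h1
  exact (pos_iff_pos_of_mul_pos h1).1 (by positivity)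

end Positivity

section Smoothing

variable {V : Type*} [NormedAddCommGroup V] [NormedSpace ℝ V]
  {H : Type*} [TopologicalSpace H] {I : ModelWithCorners ℝ V H}
  {M : Type*} [TopologicalSpace M] [ChartedSpace H M]
  {n : ℕ} {E : M → Type*} [TopologicalSpace (TotalSpace (Fib n) E)]
  [∀ x, NormedAddCommGroup (E x)] [∀ x, InnerProductSpace ℂ (E x)]
  [FiberBundle (Fib n) E] [VectorBundle ℂ (Fib n) E] [VectorBundle ℝ (Fib n) E]
  [ContMDiffVectorBundle ∞ (Fib n) E I]

/-- Every complex linear endomorphism of a fibre extends to a smooth family near this fibre. -/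
theorem exists_local_extension (p : M) (L : E p →L[ℂ] E p) :
    ∃ A : ∀ x, E x →L[ℝ] E x, (∀ x (c : ℂ) v, A x (c • v) = c • A x v) ∧ (∀ v, A p v = L v) ∧
      ContMDiffOn I (I.prod 𝓘(ℝ, Fib n →L[ℝ] Fib n)) ∞
        (fun x ↦ TotalSpace.mk' (Fib n →L[ℝ] Fib n) (E := fun x ↦ E x →L[ℝ] E x) x (A x))
        (frameDom n E p) := by
  have hp : p ∈ frameDom n E p := mem_baseSet_trivializationAt (Fib n) E p
  let e := trivializationAt (Fib n) E p
  let K : Fib n →L[ℂ] Fib n := (e.continuousLinearMapAt ℂ p ∘L L) ∘L e.symmL ℂ p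
  let A (x : M) : E x →L[ℂ] E x := (e.symmL ℂ x ∘L K) ∘L e.continuousLinearMapAt ℂ x
  refine ⟨fun x ↦ (A x).restrictScalars ℝ, fun x c v ↦ (A x).map_smul c v, fun v ↦ ?_, ?_⟩
  · change e.symmL ℂ p (e.continuousLinearMapAt ℂ p (L (e.symmL ℂ p
      (e.continuousLinearMapAt ℂ p v)))) = L v
    rw [Trivialization.symmL_continuousLinearMapAt _ hp,
      Trivialization.symmL_continuousLinearMapAt _ hp]
  · intro x hx
    refine ContMDiffAt.contMDiffWithinAt ?_
    rw [Trivialization.contMDiffAt_section_iff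
      ((trivializationAt (Fib n) E p).continuousLinearMap (RingHom.id ℝ)
        (trivializationAt (Fib n) E p)) ⟨hx, hx⟩]
    refine (contMDiffAt_const (c := K.restrictScalars ℝ)).congr_of_eventuallyEq ?_
    filter_upwards [frameDom_mem_nhds hx] with y hy
    rw [Trivialization.continuousLinearMap_apply]
    ext1 w
    have h1 : e.symmL ℝ y w = e.symmL ℂ y w := by
      rw [Trivialization.symmL_apply _ hy, Trivialization.symmL_apply _ hy]
    have h2 (v : E y) : e.continuousLinearMapAt ℝ y v = e.continuousLinearMapAt ℂ y v := by
      rw [Trivialization.continuousLinearMapAt_apply_of_mem _ _ hy,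
        Trivialization.continuousLinearMapAt_apply_of_mem _ _ hy]
    change e.continuousLinearMapAt ℝ y (e.symmL ℂ y (K (e.continuousLinearMapAt ℂ y
      (e.symmL ℝ y w)))) = K w
    rw [h2, h1, Trivialization.continuousLinearMapAt_symmL _ hy,
      Trivialization.continuousLinearMapAt_symmL _ hy]

variable [IsManifold I ∞ M] [FiniteDimensional ℝ V] [T2Space M] [SigmaCompactSpace M]

/-- Relative smoothing: a continuous family `h` of unitary isomorphisms which is equal to a smooth
family `W` on a closed set `S` is replaced by a smooth family of complex linear isomorphisms, with
the same values on `S`. -/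
theorem exists_contMDiff_isPositivePair (hE : IsSmoothHermitianMetric I n E)
    (h : ∀ x, E x ≃ₗᵢ[ℂ] E x)
    (hc : ∀ p i j, ContinuousAt (fun q ↦ endMat n (fun x ↦ unitaryCLM (h x)) p q i j) p)
    {S O : Set M} (hS : IsClosed S) (hO : IsOpen O) (hSO : S ⊆ O) (W : ∀ x, E x →L[ℝ] E x)
    (hWl : ∀ x (c : ℂ) v, W x (c • v) = c • W x v)
    (hW : ContMDiffOn I (I.prod 𝓘(ℝ, Fib n →L[ℝ] Fib n)) ∞
      (fun x ↦ TotalSpace.mk' (Fib n →L[ℝ] Fib n) (E := fun x ↦ E x →L[ℝ] E x) x (W x)) O)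
    (hWS : ∀ x ∈ S, W x = unitaryCLM (h x)) :
    ∃ A : ∀ x, E x →L[ℝ] E x, ContMDiff I (I.prod 𝓘(ℝ, Fib n →L[ℝ] Fib n)) ∞
      (fun x ↦ TotalSpace.mk' (Fib n →L[ℝ] Fib n) (E := fun x ↦ E x →L[ℝ] E x) x (A x)) ∧
      ∀ x, (∀ (c : ℂ) v, A x (c • v) = c • A x v) ∧ IsPositivePair (A x) (unitaryCLM (h x)) ∧
        (x ∈ S → A x = W x) := by
  let t (x : M) : Set (E x →L[ℝ] E x) := {A | (∀ (c : ℂ) v, A (c • v) = c • A v) ∧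
    IsPositivePair A (unitaryCLM (h x)) ∧ (x ∈ S → A = W x)}
  have ht (x : M) : Convex ℝ (t x) := by
    rintro A ⟨hA, hAp, hAS⟩ B ⟨hB, hBp, hBS⟩ a b ha hb hab
    refine ⟨fun c v ↦ ?_, fun v hv ↦ ?_, fun hx ↦ ?_⟩
    · change a • A (c • v) + b • B (c • v) = c • (a • A v + b • B v)
      rw [hA, hB, smul_add, smul_comm a, smul_comm b]
    · change 0 < (inner ℂ (a • A v + b • B v) (unitaryCLM (h x) v) : ℂ).re
      rw [← Complex.coe_smul a, ← Complex.coe_smul b, inner_add_left, inner_smul_left,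
        inner_smul_left, Complex.conj_ofReal, Complex.conj_ofReal, Complex.add_re,
        Complex.re_ofReal_mul, Complex.re_ofReal_mul]
      have h1 := hAp v hv
      have h2 := hBp v hv
      rcases ha.eq_or_lt with rfl | ha'
      · obtain rfl : b = 1 := by linarith
        simpa using h2
      · have := mul_pos ha' h1
        have := mul_nonneg hb h2.le
        linarith
    · rw [hAS hx, hBS hx, ← add_smul, hab, one_smul]
  have hG (p : M) (i j : Fin n) :
      ContinuousAt (fun q ↦ (inner ℂ (frame E p i q) (frame E p j q) : ℂ)) p :=
    ((hE p i j).contMDiffAt (frameDom_mem_nhds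
      (mem_baseSet_trivializationAt (Fib n) E p))).continuousAt
  have hpos (p : M) {A : ∀ x, E x →L[ℝ] E x} (hA : ∀ x (c : ℂ) v, A x (c • v) = c • A x v)
      (hAs : ContMDiffAt I (I.prod 𝓘(ℝ, Fib n →L[ℝ] Fib n)) ∞
        (fun x ↦ TotalSpace.mk' (Fib n →L[ℝ] Fib n) (E := fun x ↦ E x →L[ℝ] E x) x (A x)) p)
      (hAp : A p = unitaryCLM (h p)) :
      ∀ᶠ q in 𝓝 p, IsPositivePair (A q) (unitaryCLM (h q)) := by
    refine eventually_isPositivePair (B := fun x ↦ unitaryCLM (h x)) hA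
      (fun x ↦ unitaryCLM_smul (h x)) (fun i j ↦ ?_) (hc p) (hG p) ?_
    · exact (matSmoothAtM_endMat (n := n) (mem_baseSet_trivializationAt (Fib n) E p) hAs i j).continuousAt
    · rw [hAp]
      exact isPositivePair_unitaryCLM (h p)
  obtain ⟨s, hs⟩ := exists_contMDiffSection_forall_mem_convex_of_local (n := ⊤) I
    (F_fiber := Fib n →L[ℝ] Fib n) (fun x ↦ E x →L[ℝ] E x) t ht fun p ↦ by
      by_cases hp : p ∈ S
      · have hO' := hO.mem_nhds (hSO hp)
        refine ⟨_, inter_mem hO' (hpos p hWl (hW.contMDiffAt hO') (hWS p hp)), W,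
          hW.mono Set.inter_subset_left, fun y hy ↦ ⟨hWl y, hy.2, fun _ ↦ rfl⟩⟩
      · obtain ⟨A, hA, hAp, hAs⟩ := exists_local_extension (I := I) (n := n) p
          ((h p).toContinuousLinearEquiv : E p →L[ℂ] E p)
        have hd := frameDom_mem_nhds (n := n) (mem_baseSet_trivializationAt (Fib n) E p)
        refine ⟨_, inter_mem (inter_mem hd (hS.isOpen_compl.mem_nhds hp))
          (hpos p hA (hAs.contMDiffAt hd) (ContinuousLinearMap.ext hAp)), A,
          hAs.mono fun y hy ↦ hy.1.1, fun y hy ↦ ⟨hA y, hy.2, fun h ↦ (hy.1.2 h).elim⟩⟩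
  exact ⟨s, s.contMDiff, hs⟩

end Smoothing

section Homotopies

variable {V : Type*} [NormedAddCommGroup V] [NormedSpace ℝ V]
  {H : Type*} [TopologicalSpace H] {I : ModelWithCorners ℝ V H}
  {M : Type*} [TopologicalSpace M] [ChartedSpace H M]
  {n : ℕ} {E : M → Type*} [TopologicalSpace (TotalSpace (Fib n) E)]
  [∀ x, NormedAddCommGroup (E x)] [∀ x, InnerProductSpace ℂ (E x)]
  [FiberBundle (Fib n) E] [VectorBundle ℂ (Fib n) E] [VectorBundle ℝ (Fib n) E]

theorem continuousAt_frameCoord_of_continuousAt {X : Type*} [TopologicalSpace X] {f : X → M}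
    {A : ∀ x, E (f x) →L[ℝ] E (f x)} {x : X}
    (hA : ContinuousAt (fun y ↦ TotalSpace.mk' (Fib n →L[ℝ] Fib n)
      (E := fun x ↦ E x →L[ℝ] E x) (f y) (A y)) x) (i j : Fin n) :
    ContinuousAt (fun y ↦ frameCoord E (f x) i (f y) (A y (frame E (f x) j (f y)))) x := by
  have hx : f x ∈ frameDom n E (f x) := mem_baseSet_trivializationAt (Fib n) E (f x)
  let e := trivializationAt (Fib n) E (f x)
  let e' := e.continuousLinearMap (RingHom.id ℝ) e
  have h1 := (e'.toOpenPartialHomeomorph.continuousAt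
    (x := TotalSpace.mk' (Fib n →L[ℝ] Fib n) (E := fun x ↦ E x →L[ℝ] E x) (f x) (A x))
    (e'.mem_source.2 ⟨hx, hx⟩)).comp_of_eq hA rfl
  have hf : ContinuousAt f x := (FiberBundle.continuous_proj (Fib n →L[ℝ] Fib n)
    (fun x ↦ E x →L[ℝ] E x)).continuousAt.comp hA
  let L : (Fib n →L[ℝ] Fib n) →L[ℝ] ℂ := ((EuclideanSpace.proj i : Fib n →L[ℂ] ℂ).restrictScalars
    ℝ).comp (ContinuousLinearMap.apply ℝ (Fib n) (EuclideanSpace.single j (1 : ℂ)))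
  refine (L.continuous.continuousAt.comp (continuousAt_snd.comp h1)).congr ?_
  filter_upwards [hf.preimage_mem_nhds (frameDom_mem_nhds hx)] with y hy
  have hy' : f y ∈ frameDom n E (f x) := hy
  rw [frameCoord_eq hy']
  change (e.continuousLinearMapAt ℝ (f y)
    (A y (e.symmL ℝ (f y) (EuclideanSpace.single j 1)))) i = _
  rw [Trivialization.continuousLinearMapAt_apply_of_mem ℝ _ hy', frame,
    Trivialization.symmL_apply _ hy', Trivialization.symmL_apply _ hy']

variable [ContMDiffVectorBundle ∞ (Fib n) E I]
  [IsManifold I ∞ M] [FiniteDimensional ℝ V] [T2Space M] [SigmaCompactSpace M]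

/-- Smooth unitary gauge transformations which are homotopic through continuous ones are homotopic
through smooth complex linear automorphisms of the bundle. -/
theorem exists_isAut_of_gaugeHomotopic (hE : IsSmoothHermitianMetric I n E)
    {U₀ U₁ : ∀ x, E x ≃ₗᵢ[ℂ] E x} (h₀ : IsGauge I n U₀)
    (h₁ : IsGauge I n U₁) (h : GaugeHomotopic n U₀ U₁) :
    ∃ u : M → ℝ × M → Matrix (Fin n) (Fin n) ℂ, (frameAtlas I n E).cyl.IsAut u ∧
      (∀ x₀ x, u x₀ (0, x) = endMat n (fun x ↦ unitaryCLM (U₀ x)) x₀ x) ∧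
      ∀ x₀ x, u x₀ (1, x) = endMat n (fun x ↦ unitaryCLM (U₁ x)) x₀ x := by
  obtain ⟨h, hcont, hh0, hh1⟩ := h
  let φ : C^∞⟮𝓘(ℝ, ℝ).prod I, ℝ × M; I, M⟯ := ContMDiffMap.snd
  let g (p : ℝ × M) : Pull φ E p ≃ₗᵢ[ℂ] Pull φ E p :=
    h (Set.projIcc 0 1 zero_le_one p.1) p.2
  have hgc (p : ℝ × M) (i j : Fin n) :
      ContinuousAt (fun q ↦ endMat n (fun x ↦ unitaryCLM (g x)) p q i j) p := by
    have hq : Continuous fun q : ℝ × M ↦ (Set.projIcc (0 : ℝ) 1 zero_le_one q.1, q.2) :=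
      (continuous_projIcc.comp continuous_fst).prodMk continuous_snd
    have := continuousAt_frameCoord_of_continuousAt (f := fun q : ℝ × M ↦ q.2)
      (A := fun q ↦ unitaryCLM (h (Set.projIcc 0 1 zero_le_one q.1) q.2))
      (hcont.comp hq).continuousAt (x := p) i j
    refine this.congr (Eventually.of_forall fun q ↦ ?_)
    exact congrArg (fun w : E q.2 ↦ frameCoord E p.2 i q.2
      (h (Set.projIcc 0 1 zero_le_one q.1) q.2 w)) (frame_pull (E := E) φ p j q).symm
  classical
  -- on the complement of `t = 1 / 2` the two ends are joined by a smooth family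
  let W (p : ℝ × M) : Pull φ E p →L[ℝ] Pull φ E p :=
    if p.1 < 1 / 2 then unitaryCLM (gaugePullback φ U₀ p) else unitaryCLM (gaugePullback φ U₁ p)
  let S : Set (ℝ × M) := {p | p.1 ≤ 0} ∪ {p | 1 ≤ p.1}
  let O : Set (ℝ × M) := {p | p.1 < 1 / 2} ∪ {p | 1 / 2 < p.1}
  have hO0 : IsOpen {p : ℝ × M | p.1 < 1 / 2} := isOpen_lt continuous_fst continuous_const
  have hO1 : IsOpen {p : ℝ × M | 1 / 2 < p.1} := isOpen_lt continuous_const continuous_fst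
  have hWl (p : ℝ × M) (c : ℂ) (v : Pull φ E p) : W p (c • v) = c • W p v := by
    simp only [W]
    split_ifs <;> exact unitaryCLM_smul _ c v
  have hW : ContMDiffOn (𝓘(ℝ, ℝ).prod I) ((𝓘(ℝ, ℝ).prod I).prod 𝓘(ℝ, Fib n →L[ℝ] Fib n)) ∞
      (fun p ↦ TotalSpace.mk' (Fib n →L[ℝ] Fib n) (E := fun x ↦ Pull φ E x →L[ℝ] Pull φ E x)
        p (W p)) O := by
    rintro p (hp | hp) <;> refine ContMDiffAt.contMDiffWithinAt ?_
    · refine (isGauge_gaugePullback φ h₀ p).congr_of_eventuallyEq ?_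
      filter_upwards [hO0.mem_nhds hp] with q hq
      simp only [W, if_pos (show q.1 < 1 / 2 from hq)]
    · refine (isGauge_gaugePullback φ h₁ p).congr_of_eventuallyEq ?_
      filter_upwards [hO1.mem_nhds hp] with q hq
      simp only [W, if_neg (show ¬ q.1 < 1 / 2 from not_lt.2 (le_of_lt hq))]
  have hWS : ∀ p ∈ S, W p = unitaryCLM (g p) := by
    rintro p (hp | hp)
    · have hp' : p.1 ≤ 0 := hp
      simp only [W, if_pos (show p.1 < 1 / 2 by linarith), g, Set.projIcc_of_le_left _ hp']
      exact congrArg unitaryCLM (congrFun hh0 p.2).symm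
    · have hp' : 1 ≤ p.1 := hp
      simp only [W, if_neg (show ¬ p.1 < 1 / 2 by linarith), g, Set.projIcc_of_right_le _ hp']
      exact congrArg unitaryCLM (congrFun hh1 p.2).symm
  obtain ⟨A, hAs, hA⟩ := exists_contMDiff_isPositivePair (I := 𝓘(ℝ, ℝ).prod I)
    (isSmoothHermitianMetric_pull φ hE) g hgc (S := S) (O := O)
    ((isClosed_le continuous_fst continuous_const).union
      (isClosed_le continuous_const continuous_fst)) (hO0.union hO1)
    (by
      rintro p (hp | hp)
      · exact Or.inl (lt_of_le_of_lt (show p.1 ≤ 0 from hp) one_half_pos)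
      · exact Or.inr (lt_of_lt_of_le one_half_lt_one (show 1 ≤ p.1 from hp))) W hWl hW hWS
  have hend {p : ℝ × M} (U : ∀ x, E x ≃ₗᵢ[ℂ] E x) (hp : A p = unitaryCLM (gaugePullback φ U p))
      (x₀ : M) : endMat n A (0, x₀) p = endMat n (fun x ↦ unitaryCLM (U x)) x₀ p.2 := by
    ext i j
    simp only [endMat, Matrix.of_apply, hp]
    exact congrArg (fun w : E p.2 ↦ frameCoord E x₀ i p.2 (U p.2 w))
      (frame_pull (E := E) φ (0, x₀) j p)
  refine ⟨fun x₀ ↦ endMat n A (0, x₀), ⟨fun {x₀ p} hp ↦ ?_, fun {x₀ p} hp ↦ ?_,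
    fun {x₀ x₁ p} hp hp' ↦ ?_⟩, fun x₀ x ↦ ?_, fun x₀ x ↦ ?_⟩
  · exact matSmoothAtM_endMat (E := Pull φ E) (x₀ := (0, x₀)) hp (hAs p)
  · exact isUnit_det_endMat_of_injective (E := Pull φ E) (x₀ := (0, x₀)) (hA p).1 hp
      (hA p).2.1.injective
  · have ht : transMat n E x₀ x₁ p.2 = transMat n (Pull φ E) (0, x₀) (0, x₁) p := by
      ext i j
      exact congrArg (fun w : E p.2 ↦ frameCoord E x₀ i p.2 w)
        (frame_pull (E := E) φ (0, x₁) j p).symm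
    have := transMat_mul_endMat (n := n) (E := Pull φ E) (x₀ := (0, x₀)) (x₁ := (0, x₁)) (hA p).1 hp hp'
    rw [← ht] at this
    exact this
  · refine hend U₀ (((hA (0, x)).2.2 (Or.inl (le_refl (0 : ℝ)))).trans ?_) x₀
    simp only [W]
    exact if_pos (by norm_num)
  · refine hend U₁ (((hA (1, x)).2.2 (Or.inr (le_refl (1 : ℝ)))).trans ?_) x₀
    simp only [W]
    exact if_neg (by norm_num)

end Homotopies

/-! ### Odd Chern-Weil forms -/

theorem gaugeHomotopic_symm {M : Type*} [TopologicalSpace M] {n : ℕ} {E : M → Type*}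
    [TopologicalSpace (TotalSpace (Fib n) E)] [∀ x, NormedAddCommGroup (E x)]
    [∀ x, InnerProductSpace ℂ (E x)] [FiberBundle (Fib n) E] [VectorBundle ℝ (Fib n) E]
    {U₀ U₁ : ∀ x, E x ≃ₗᵢ[ℂ] E x} (h : GaugeHomotopic n U₀ U₁) : GaugeHomotopic n U₁ U₀ := by
  obtain ⟨h, hc, h0, h1⟩ := h
  refine ⟨fun t ↦ h (unitInterval.symm t), hc.comp
    ((unitInterval.continuous_symm.comp continuous_fst).prodMk continuous_snd), ?_, ?_⟩
  · simpa using h1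
  · simpa using h0

section OddForms

variable {V : Type*} [NormedAddCommGroup V] [NormedSpace ℝ V]
  {H : Type*} [TopologicalSpace H] {I : ModelWithCorners ℝ V H}
  {M : Type*} [TopologicalSpace M] [ChartedSpace H M]
  {n : ℕ} {E : M → Type*} [TopologicalSpace (TotalSpace (Fib n) E)]
  [∀ x, NormedAddCommGroup (E x)] [∀ x, InnerProductSpace ℂ (E x)]
  [FiberBundle (Fib n) E] [VectorBundle ℂ (Fib n) E] [VectorBundle ℝ (Fib n) E]
  [ContMDiffVectorBundle ∞ (Fib n) E I]
  [IsManifold I ∞ M] [I.Boundaryless] [FiniteDimensional ℝ V] [T2Space M]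
  {P : MvPolynomial (Fin n × Fin n) ℂ} {k : ℕ} {U U₀ U₁ : ∀ x, E x ≃ₗᵢ[ℂ] E x}
  {cov cov' : Operator I E}

/-- Odd Chern-Weil forms are smooth, as fibre integrals of smooth forms. -/
theorem isSmoothForm_oddChernWeil (hP : IsConjInvariant (polarization P (k + 1)))
    (hU : IsGauge I n U) (h : IsHermitianConnection n cov) :
    IsSmoothForm (oddChernWeil P k U cov) := by
  rw [oddChernWeil, transgression_eq hP]
  exact isSmoothForm_of_smoothFormAt (h.isConn.smooth_tp hP (h.isConn_gaugeConj hU))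

/-- Odd Chern-Weil forms are closed: a connection and its gauge transform have the same Chern-Weil
forms. -/
theorem extD_oddChernWeil (hP : IsConjInvariant (polarization P (k + 1)))
    (hU : IsGauge I n U) (h : IsHermitianConnection n cov) :
    extD (oddChernWeil P k U cov) = 0 := by
  rw [oddChernWeil, transgression_eq hP]
  exact h.isConn.extD_tp_gauge hP (h.isConn_gaugeConj hU) hU.isAut
    fun hx ↦ h.gaugeRelAt_gaugeConj hU hx

/-- The class of an odd Chern-Weil form does not depend on the connection. -/
theorem isExactForm_oddChernWeil_sub (hP : IsConjInvariant (polarization P (k + 1)))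
    (hU : IsGauge I n U) (h : IsHermitianConnection n cov) (h' : IsHermitianConnection n cov') :
    IsExactForm (oddChernWeil P k U cov - oddChernWeil P k U cov') := by
  rw [oddChernWeil, oddChernWeil, transgression_eq hP, transgression_eq hP]
  exact FrameAtlas.isExactForm_tp_sub_tp hP h.isConn (h.isConn_gaugeConj hU) h'.isConn
    (h'.isConn_gaugeConj hU) hU.isAut (fun hx ↦ h.gaugeRelAt_gaugeConj hU hx)
    fun hx ↦ h'.gaugeRelAt_gaugeConj hU hx

/-- The class of an odd Chern-Weil form depends on the gauge transformation only up to continuous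
homotopy. -/
theorem isExactForm_oddChernWeil_of_homotopic [SigmaCompactSpace M]
    (hP : IsConjInvariant (polarization P (k + 1))) (hE : IsSmoothHermitianMetric I n E)
    (h₀ : IsGauge I n U₀) (h₁ : IsGauge I n U₁) (hh : GaugeHomotopic n U₁ U₀)
    (h : IsHermitianConnection n cov) :
    IsExactForm (oddChernWeil P k U₀ cov - oddChernWeil P k U₁ cov) := by
  obtain ⟨u, hu, hu₀, hu₁⟩ := exists_isAut_of_gaugeHomotopic hE h₁ h₀ hh
  rw [oddChernWeil, oddChernWeil, transgression_eq hP, transgression_eq hP]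
  refine FrameAtlas.isExactForm_tp_homotopy hP h.isConn hu (fun {i x} hx ↦ ?_) fun {i x} hx ↦ ?_
  · simp only [hu₀]
    exact h.gaugeRelAt_gaugeConj h₁ hx
  · simp only [hu₁]
    exact h.gaugeRelAt_gaugeConj h₀ hx

end OddForms

end OddChernWeil

theorem mainTheorem5 {m n : ℕ} {B : Type*} [TopologicalSpace B]
    [ChartedSpace (EuclideanSpace ℝ (Fin m)) B] [IsManifold (𝓡 m) ∞ B]
    [CompactSpace B] [T2Space B]
    {E : B → Type*} [TopologicalSpace (TotalSpace (Fib n) E)]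
    [∀ x, NormedAddCommGroup (E x)] [∀ x, InnerProductSpace ℂ (E x)]
    [FiberBundle (Fib n) E] [VectorBundle ℂ (Fib n) E]
    [VectorBundle ℝ (Fib n) E]
    [ContMDiffVectorBundle ∞ (Fib n) E (𝓡 m)]
    (hE : IsSmoothHermitianMetric (𝓡 m) n E)
    (P : MvPolynomial (Fin n × Fin n) ℂ) (hP : IsInvariantPolynomial P) :
    -- the forms are smooth and closed
    (∀ (U : ∀ x, E x ≃ₗᵢ[ℂ] E x) (cov : Operator (𝓡 m) E),
      IsGauge (𝓡 m) n U → IsHermitianConnection n cov →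
      ∀ k, IsSmoothForm (oddChernWeil P k U cov) ∧
        extD (oddChernWeil P k U cov) = 0) ∧
    -- the class does not depend on the connection
    (∀ (U : ∀ x, E x ≃ₗᵢ[ℂ] E x) (cov cov' : Operator (𝓡 m) E),
      IsGauge (𝓡 m) n U → IsHermitianConnection n cov →
      IsHermitianConnection n cov' →
      ∀ k, IsExactForm
        (oddChernWeil P k U cov - oddChernWeil P k U cov')) ∧
    -- the class is invariant under homotopies of the gauge transformation
    (∀ (U₀ U₁ : ∀ x, E x ≃ₗᵢ[ℂ] E x) (cov : Operator (𝓡 m) E),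
      IsGauge (𝓡 m) n U₀ → IsGauge (𝓡 m) n U₁ →
      GaugeHomotopic n U₀ U₁ → IsHermitianConnection n cov →
      ∀ k, IsExactForm
        (oddChernWeil P k U₀ cov - oddChernWeil P k U₁ cov)) ∧
    -- naturality under pullback
    (∀ (m₁ : ℕ) (B₁ : Type*) [TopologicalSpace B₁]
      [ChartedSpace (EuclideanSpace ℝ (Fin m₁)) B₁] [IsManifold (𝓡 m₁) ∞ B₁] [T2Space B₁]
      (φ : C^∞⟮𝓡 m₁, B₁; 𝓡 m, B⟯) (U : ∀ x, E x ≃ₗᵢ[ℂ] E x)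
      (cov : Operator (𝓡 m) E),
      IsGauge (𝓡 m) n U → IsHermitianConnection n cov →
      IsSmoothHermitianMetric (𝓡 m₁) n (Pull φ E) ∧
      IsGauge (𝓡 m₁) n (gaugePullback φ U) ∧
      IsHermitianConnection n
        (connPullback n φ cov : Operator (𝓡 m₁) (Pull φ E)) ∧
      ∀ k, formPullback (𝓡 m₁) φ (oddChernWeil P k U cov) =
        oddChernWeil P k (gaugePullback φ U)
          (connPullback n φ cov)) := by
  have hP' (k : ℕ) := isConjInvariant_polarization hP (k + 1)
  refine ⟨fun U cov hU h k ↦ ⟨isSmoothForm_oddChernWeil (hP' k) hU h,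
      extD_oddChernWeil (hP' k) hU h⟩,
    fun U cov cov' hU h h' k ↦ isExactForm_oddChernWeil_sub (hP' k) hU h h',
    fun U₀ U₁ cov h₀ h₁ hh h k ↦
      isExactForm_oddChernWeil_of_homotopic (hP' k) hE h₀ h₁ (gaugeHomotopic_symm hh) h, ?_⟩
  intro m₁ B₁ _ _ _ _ φ U cov hU h
  exact ⟨isSmoothHermitianMetric_pull φ hE, isGauge_gaugePullback φ hU,
    isHermitianConnection_connPullback φ hE h,
    fun k ↦ formPullback_oddChernWeil φ hE (hP' k) hU h⟩
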